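/- A (five-qubit) unextendible product basis (UPB) of size eight is a family $u_1,\dots,u_8$ of orthonormal product vectors $u_i=\psi_{i1}\otimes\cdots\otimes\psi_{i5}$ in $(\mathbb C^2)^{\otimes 5}$ ($\psi_{ij}$ unit vectors in $\mathbb C^2$) such that no nonzero product vector is orthogonal to all of them. A matrix $A=(A_{ij})$ of positive integers with $8$ rows and $5$ columns represents this UPB if, for all $i,k,j$: $A_{ij}=A_{kj}$ if and only if $\psi_{ij}$ and $\psi_{kj}$ are equal up to a phase factor, and $\psi_{ij}\perp\psi_{kj}$ if and only if $\{A_{ij},A_{kj}\}=\{2p-1,2p\}$ for some $p\ge 1$ (then the two names are called orthogonal). An $8\times5$ unextendible orthogonal matrix (UOM) is a matrix that represents some UPB. Two such matrices are equivalent if one arises from the other by permuting rows, permuting columns, and renaming the entries within each column injectively so that names are orthogonal after the renaming exactly when they were before. Every five-qubit UPB of size eight is represented by some matrix, and all matrices representing it are equivalent to one and the same matrix of the list of $32$ matrices below. Each of the $32$ matrices is a UOM, and they are pairwise non-equivalent. Hence, up to equivalence, there are exactly $32$ five-qubit UPBs ($8\times 5$ UOMs) of size eight. The multiplicity list of a column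 is the unordered list of the unordered pairs $a{:}b$, one for each pair of names $\{2p-1,2p\}$ occurring in the column, where $a$ and $b$ are the multiplicities of the two names in that column. The $32$ matrices are grouped by their (unordered) combinations of the multiplicity lists of the five columns; there are $14$ different combinations, each given in front of its matrices. 1. $[2{:}2, 2{:}2],\ [2{:}2, 2{:}2],\ [1{:}1, 1{:}1, 1{:}1, 1{:}1],\ [1{:}1, 1{:}1, 1{:}1, 1{:}1],\ [1{:}1, 1{:}1, 1{:}1, 1{:}1]$: $$\begin{pmatrix}1&1&1&1&1\\1&1&2&3&3\\2&3&3&5&5\\2&3&4&7&7\\3&4&5&4&2\\3&4&6&2&4\\4&2&7&8&6\\4&2&8&6&8\end{pmatrix}, \begin{pmatrix}1&1&1&1&1\\1&1&3&2&3\\2&3&5&3&5\\2&3&6&5&7\\3&4&2&7&4\\3&4&4&8&2\\4&2&7&4&8\\4&2&8&6&6\end{pmatrix}, \begin{pmatrix}1&1&1&1&1\\1&2&3&3&3\\2&3&5&5&5\\2&3&7&7&6\\3&4&2&4&7\\3&4&4&2&8\\4&1&8&6&2\\4&2&6&8&4\end{pmatrix}, \begin{pmatrix}1&1&1&1&1\\1&2&3&3&3\\2&3&5&5&5\\2&4&7&7&7\\3&3&4&2&6\\3&4&2&4&8\\4&1&8&6&2\\4&2&6&8&4\end{pmatrix},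 \begin{pmatrix}1&1&1&1&1\\1&2&3&3&3\\2&3&5&5&5\\2&4&7&7&7\\3&3&2&6&4\\3&4&4&8&2\\4&1&8&2&6\\4&2&6&4&8\end{pmatrix}, \begin{pmatrix}1&1&1&1&1\\1&2&3&3&3\\2&3&5&5&5\\2&4&7&7&7\\3&3&4&2&6\\3&4&8&4&2\\4&1&2&6&8\\4&2&6&8&4\end{pmatrix}.$$ 2. $[2{:}2, 2{:}2],\ [2{:}2, 2{:}2],\ [2{:}2, 2{:}2],\ [1{:}1, 1{:}1, 1{:}1, 1{:}1],\ [1{:}1, 1{:}1, 1{:}1, 1{:}1]$: $$\begin{pmatrix}1&1&1&1&1\\1&2&3&3&3\\2&3&4&5&5\\2&4&2&7&7\\3&4&4&2&8\\3&3&2&4&6\\4&2&1&6&4\\4&1&3&8&2\end{pmatrix}, \begin{pmatrix}1&1&1&1&1\\1&2&2&3&3\\2&3&3&5&5\\2&4&4&7&7\\3&4&3&2&4\\3&3&4&4&2\\4&2&1&6&8\\4&1&2&8&6\end{pmatrix}, \begin{pmatrix}1&1&1&1&1\\1&2&2&3&3\\2&3&3&5&5\\2&4&4&7&7\\3&4&3&2&4\\3&3&4&4&2\\4&2&1&8&6\\4&1&2&6&8\end{pmatrix},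 \begin{pmatrix}1&1&1&1&1\\1&3&2&3&3\\2&4&3&5&5\\2&2&4&7&7\\3&4&4&2&8\\3&2&3&6&4\\4&1&2&4&6\\4&3&1&8&2\end{pmatrix}.$$ 3. $[2{:}2, 2{:}2],\ [2{:}2, 2{:}2],\ [2{:}2, 1{:}1, 1{:}1],\ [1{:}1, 1{:}1, 1{:}1, 1{:}1],\ [1{:}1, 1{:}1, 1{:}1, 1{:}1]$: $$\begin{pmatrix}1&1&1&1&1\\1&2&3&3&3\\2&3&5&5&5\\2&3&6&7&7\\3&4&5&2&4\\3&4&6&4&2\\4&1&2&8&6\\4&2&4&6&8\end{pmatrix}, \begin{pmatrix}1&1&1&1&1\\1&2&3&3&3\\2&3&5&5&5\\2&4&2&7&7\\3&3&2&6&4\\3&4&4&8&2\\4&1&6&2&8\\4&2&1&4&6\end{pmatrix}, \begin{pmatrix}1&1&1&1&1\\1&2&3&3&3\\2&3&5&5&5\\2&4&2&7&7\\3&3&2&4&6\\3&4&4&8&2\\4&1&6&2&8\\4&2&1&6&4\end{pmatrix}, \begin{pmatrix}1&1&1&1&1\\1&2&2&3&3\\2&3&5&5&5\\2&4&3&7&7\\3&3&6&2&4\\3&4&4&4&2\\4&1&2&8&6\\4&2&1&6&8\end{pmatrix},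 \begin{pmatrix}1&1&1&1&1\\1&2&3&3&3\\2&3&5&5&5\\2&3&6&7&7\\3&4&5&4&2\\3&4&6&2&4\\4&1&2&8&6\\4&2&4&6&8\end{pmatrix}, \begin{pmatrix}1&1&1&1&1\\1&2&2&3&3\\2&3&5&5&5\\2&4&3&7&7\\3&3&6&4&2\\3&4&4&2&4\\4&1&2&8&6\\4&2&1&6&8\end{pmatrix}.$$ 4. $[2{:}2, 2{:}2],\ [2{:}2, 2{:}2],\ [2{:}2, 1{:}1, 1{:}1],\ [2{:}1, 2{:}1, 1{:}1],\ [2{:}1, 2{:}1, 1{:}1]$: $$\begin{pmatrix}1&1&1&1&1\\1&2&3&3&3\\2&1&3&3&3\\2&2&5&5&5\\3&3&2&6&4\\3&4&4&2&6\\4&3&4&2&6\\4&4&6&4&2\end{pmatrix}.$$ 5. $[2{:}2, 2{:}2],\ [2{:}2, 2{:}2],\ [2{:}2, 1{:}1, 1{:}1],\ [2{:}2, 1{:}1, 1{:}1],\ [1{:}1, 1{:}1, 1{:}1, 1{:}1]$: $$\begin{pmatrix}1&1&1&1&1\\1&3&2&3&3\\2&4&5&5&5\\2&2&3&6&7\\3&1&2&4&6\\3&3&1&2&8\\4&4&4&6&2\\4&2&6&5&4\end{pmatrix}.$$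 6. $[3{:}1, 3{:}1],\ [2{:}2, 1{:}1, 1{:}1],\ [2{:}2, 1{:}1, 1{:}1],\ [2{:}2, 1{:}1, 1{:}1],\ [1{:}1, 1{:}1, 1{:}1, 1{:}1]$: $$\begin{pmatrix}1&1&1&1&1\\1&3&2&5&3\\1&4&5&2&5\\2&5&3&3&7\\3&3&1&4&2\\3&4&6&2&8\\3&6&2&1&4\\4&2&4&6&6\end{pmatrix}, \begin{pmatrix}1&1&1&1&1\\1&2&5&3&3\\1&5&2&4&5\\2&3&3&5&7\\3&4&2&3&4\\3&2&4&4&6\\3&1&1&6&2\\4&6&6&2&8\end{pmatrix}.$$ 7. $[3{:}1, 3{:}1],\ [2{:}2, 1{:}1, 1{:}1],\ [2{:}2, 1{:}1, 1{:}1],\ [2{:}2, 1{:}1, 1{:}1],\ [2{:}2, 1{:}1, 1{:}1]$: $$\begin{pmatrix}1&1&1&1&1\\1&3&5&2&2\\1&4&2&5&5\\2&5&3&3&3\\3&3&2&1&4\\3&4&4&6&2\\3&6&1&2&1\\4&2&6&4&6\end{pmatrix}.$$ 8. $[2{:}2, 2{:}2],\ [2{:}1, 2{:}1, 1{:}1],\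 [2{:}1, 2{:}1, 1{:}1],\ [2{:}1, 2{:}1, 1{:}1],\ [2{:}1, 2{:}1, 1{:}1]$: $$\begin{pmatrix}1&1&1&1&1\\1&2&3&3&3\\2&3&3&5&1\\2&5&1&6&3\\3&6&5&4&2\\3&4&6&2&4\\4&6&4&2&5\\4&4&2&4&6\end{pmatrix}.$$ 9. $[2{:}2, 2{:}2],\ [2{:}2, 1{:}1, 1{:}1],\ [2{:}1, 2{:}1, 1{:}1],\ [2{:}1, 2{:}1, 1{:}1],\ [1{:}1, 1{:}1, 1{:}1, 1{:}1]$: $$\begin{pmatrix}1&1&1&1&1\\1&3&2&5&3\\2&5&3&3&5\\2&6&5&5&7\\3&6&5&6&2\\3&2&6&4&4\\4&3&2&6&6\\4&4&4&2&8\end{pmatrix}, \begin{pmatrix}1&1&1&1&1\\1&3&5&2&3\\2&5&3&3&5\\2&3&5&5&6\\3&6&6&5&2\\3&2&4&6&4\\4&6&6&2&7\\4&4&2&4&8\end{pmatrix}, \begin{pmatrix}1&1&1&1&1\\1&3&5&5&2\\2&5&3&3&3\\2&3&5&5&4\\3&6&2&6&5\\3&2&6&4&6\\4&6&2&6&7\\4&4&4&2&8\end{pmatrix}.$$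 10. $[2{:}2, 2{:}2],\ [2{:}2, 1{:}1, 1{:}1],\ [2{:}2, 1{:}1, 1{:}1],\ [2{:}1, 2{:}1, 1{:}1],\ [2{:}1, 2{:}1, 1{:}1]$: $$\begin{pmatrix}1&1&1&1&1\\1&3&5&5&2\\2&5&3&3&2\\2&3&5&5&1\\3&6&6&2&5\\3&2&4&6&6\\4&6&6&2&3\\4&4&2&4&4\end{pmatrix}.$$ 11. $[2{:}2, 2{:}2],\ [2{:}2, 1{:}1, 1{:}1],\ [2{:}2, 1{:}1, 1{:}1],\ [1{:}1, 1{:}1, 1{:}1, 1{:}1],\ [1{:}1, 1{:}1, 1{:}1, 1{:}1]$: $$\begin{pmatrix}1&1&1&1&1\\1&3&2&3&3\\2&5&5&5&5\\2&6&3&7&7\\3&5&6&2&4\\3&6&4&4&2\\4&4&2&6&8\\4&2&1&8&6\end{pmatrix}, \begin{pmatrix}1&1&1&1&1\\1&3&2&3&3\\2&5&5&5&5\\2&6&3&7&7\\3&5&6&2&4\\3&6&4&4&2\\4&4&2&8&6\\4&2&1&6&8\end{pmatrix}.$$ 12. $[2{:}2, 2{:}2],\ [2{:}2, 1{:}1,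 1{:}1],\ [2{:}2, 1{:}1, 1{:}1],\ [2{:}2, 1{:}1, 1{:}1],\ [1{:}1, 1{:}1, 1{:}1, 1{:}1]$: $$\begin{pmatrix}1&1&1&1&1\\1&3&3&2&3\\2&5&5&5&5\\2&6&2&3&7\\3&5&2&6&4\\3&6&4&4&2\\4&4&1&2&6\\4&2&6&1&8\end{pmatrix}.$$ 13. $[3{:}2, 2{:}1],\ [2{:}2, 1{:}1, 1{:}1],\ [2{:}1, 2{:}1, 1{:}1],\ [2{:}1, 2{:}1, 1{:}1],\ [1{:}1, 1{:}1, 1{:}1, 1{:}1]$: $$\begin{pmatrix}1&1&1&1&1\\1&5&5&3&2\\1&6&2&5&3\\2&3&5&1&5\\2&4&3&3&7\\3&5&2&4&6\\3&6&4&2&4\\4&2&6&6&8\end{pmatrix}.$$ 14. $[2{:}2, 1{:}1, 1{:}1],\ [2{:}2, 1{:}1, 1{:}1],\ [2{:}2, 1{:}1, 1{:}1],\ [2{:}1, 2{:}1, 1{:}1],\ [2{:}1, 2{:}1, 1{:}1]$: $$\begin{pmatrix}1&1&1&1&1\\3&5&3&2&1\\5&3&5&5&2\\5&1&3&6&2\\6&6&5&2&5\\2&4&4&3&6\\6&3&2&1&3\\4&2&6&4&4\end{pmatrix},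 \begin{pmatrix}1&1&1&1&1\\3&2&1&1&1\\5&5&2&5&3\\6&3&2&5&3\\6&4&5&2&5\\4&2&6&3&4\\5&6&3&4&2\\2&1&4&6&6\end{pmatrix}.$$ -/

import Mathlib

namespace QubitUPB

/-- The state space of one qubit. -/
abbrev Qubit : Type := EuclideanSpace ℂ (Fin 2)

/-- The `n`-fold tensor product of `ℂ²`, written in the computational basis: a vector has one
coordinate for each bit string of length `n`. -/
abbrev Qubits (n : ℕ) : Type := EuclideanSpace ℂ (Fin n → Fin 2)

/-- The product vector `φ₁ ⊗ ⋯ ⊗ φₙ`. -/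
noncomputable def productVector {n : ℕ} (φ : Fin n → Qubit) : Qubits n :=
  WithLp.toLp 2 fun s => ∏ j, φ j (s j)

/-- The family `u` of `m` vectors is an `n`-qubit unextendible product basis of size `m`:
orthonormal product vectors, fewer than `2 ^ n` of them, such that no (nonzero) product vector is
orthogonal to all of them. -/
structure IsUPB {m n : ℕ} (u : Fin m → Qubits n) : Prop where
  orthonormal : Orthonormal ℂ u
  product : ∀ i, ∃ φ : Fin n → Qubit, u i = productVector φ
  card_lt : m < 2 ^ n
  unextendible : ∀ φ : Fin n → Qubit, productVector φ ≠ 0 →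
    ∃ i, inner ℂ (u i) (productVector φ) ≠ 0

/-- Two names of qubit states in the same column are orthogonal when they are an odd number `i`
and the even number `i + 1`, in either order. -/
def NameOrth (a b : ℕ) : Prop := (Odd a ∧ b = a + 1) ∨ (Odd b ∧ a = b + 1)

/-- `A` is the matrix of names of the family `u`: each `u i` is written as a product of unit qubit
vectors `ψ i j`, and `A i j` is a positive integer naming `ψ i j`, so that within each column
equal names stand for equal states (vectors equal up to a phase factor), and orthogonal names for
orthogonal states. -/
def Represents {m n : ℕ} (A : Matrix (Fin m) (Fin n) ℕ) (u : Fin m → Qubits n) : Prop :=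
  (∀ i j, 1 ≤ A i j) ∧
  ∃ ψ : Fin m → Fin n → Qubit,
    (∀ i j, ‖ψ i j‖ = 1) ∧ (∀ i, u i = productVector (ψ i)) ∧
    ∀ i k j,
      (A i j = A k j ↔ ∃ c : ℂ, ψ k j = c • ψ i j) ∧
      (NameOrth (A i j) (A k j) ↔ inner ℂ (ψ i j) (ψ k j) = 0)

/-- An unextendible orthogonal matrix (UOM): the matrix of names of a UPB. -/
def IsUOM {m n : ℕ} (A : Matrix (Fin m) (Fin n) ℕ) : Prop :=
  ∃ u : Fin m → Qubits n, IsUPB u ∧ Represents A u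

/-- `f` renames the names in `S`: different names stay different, and names are orthogonal after
the renaming exactly when they were before. -/
def IsRenaming (f : ℕ → ℕ) (S : Set ℕ) : Prop :=
  Set.InjOn f S ∧ ∀ a ∈ S, ∀ b ∈ S, (NameOrth (f a) (f b) ↔ NameOrth a b)

/-- `B` arises from `A` by a permutation of the rows, a permutation of the columns, and a renaming
within each column. -/
def Equivalent {m n : ℕ} (A B : Matrix (Fin m) (Fin n) ℕ) : Prop :=
  ∃ (σ : Equiv.Perm (Fin m)) (τ : Equiv.Perm (Fin n)) (f : Fin n → ℕ → ℕ),
    (∀ j, IsRenaming (f j) (Set.range fun i => A i j)) ∧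
    ∀ i j, B (σ i) (τ j) = f j (A i j)

/-- The multiplicity of the name `a` in column `j`. -/
def multiplicity {m n : ℕ} (A : Matrix (Fin m) (Fin n) ℕ) (j : Fin n) (a : ℕ) : ℕ :=
  (Finset.univ.filter fun i => A i j = a).card

/-- The multiplicity list of column `j`: for each pair `{2 p + 1, 2 p + 2}` of orthogonal names of
which at least one occurs in the column, the unordered pair of their multiplicities. -/
def columnFeature {m n : ℕ} (A : Matrix (Fin m) (Fin n) ℕ) (j : Fin n) : Multiset (Sym2 ℕ) :=
  (Finset.univ.image fun i => (A i j - 1) / 2).val.map fun p =>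
    s(multiplicity A j (2 * p + 1), multiplicity A j (2 * p + 2))

/-- The combination of the multiplicity lists of all columns. -/
def columnFeatures {m n : ℕ} (A : Matrix (Fin m) (Fin n) ℕ) : Multiset (Multiset (Sym2 ℕ)) :=
  Finset.univ.val.map (columnFeature A)

/-- The multiplicity list `[3:2, 2:1]` of one column. -/
def col32_21 : Multiset (Sym2 ℕ) := {s(3, 2), s(2, 1)}

/-- The multiplicity list `[3:1, 3:1]` of one column. -/
def col31_31 : Multiset (Sym2 ℕ) := {s(3, 1), s(3, 1)}

/-- The multiplicity list `[2:2, 2:2]` of one column. -/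
def col22_22 : Multiset (Sym2 ℕ) := {s(2, 2), s(2, 2)}

/-- The multiplicity list `[2:2, 1:1, 1:1]` of one column. -/
def col22_11_11 : Multiset (Sym2 ℕ) := {s(2, 2), s(1, 1), s(1, 1)}

/-- The multiplicity list `[2:1, 2:1, 1:1]` of one column. -/
def col21_21_11 : Multiset (Sym2 ℕ) := {s(2, 1), s(2, 1), s(1, 1)}

/-- The multiplicity list `[1:1, 1:1, 1:1, 1:1]` of one column. -/
def col11_11_11_11 : Multiset (Sym2 ℕ) := {s(1, 1), s(1, 1), s(1, 1), s(1, 1)}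

/-- The fourteen combinations of column multiplicities. -/
def heading : Fin 14 → Multiset (Multiset (Sym2 ℕ)) :=
  ![{col22_22, col22_22, col11_11_11_11, col11_11_11_11, col11_11_11_11},
    {col22_22, col22_22, col22_22, col11_11_11_11, col11_11_11_11},
    {col22_22, col22_22, col22_11_11, col11_11_11_11, col11_11_11_11},
    {col22_22, col22_22, col22_11_11, col21_21_11, col21_21_11},
    {col22_22, col22_22, col22_11_11, col22_11_11, col11_11_11_11},
    {col31_31, col22_11_11, col22_11_11, col22_11_11, col11_11_11_11},
    {col31_31, col22_11_11, col22_11_11, col22_11_11, col22_11_11},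
    {col22_22, col21_21_11, col21_21_11, col21_21_11, col21_21_11},
    {col22_22, col22_11_11, col21_21_11, col21_21_11, col11_11_11_11},
    {col22_22, col22_11_11, col22_11_11, col21_21_11, col21_21_11},
    {col22_22, col22_11_11, col22_11_11, col11_11_11_11, col11_11_11_11},
    {col22_22, col22_11_11, col22_11_11, col22_11_11, col11_11_11_11},
    {col32_21, col22_11_11, col21_21_11, col21_21_11, col11_11_11_11},
    {col22_11_11, col22_11_11, col22_11_11, col21_21_11, col21_21_11}]

/-- The number of the combination of column multiplicities of each matrix of the list. -/
def groupIndex : Fin 32 → Fin 14 :=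
  ![0, 0, 0, 0, 0, 0, 1, 1, 1, 1, 2, 2, 2, 2, 2, 2, 3, 4, 5, 5, 6, 7, 8, 8, 8, 9, 10, 10, 11, 12, 13, 13]

/-- The thirty-two matrices of the classification. -/
def uomList : Fin 32 → Matrix (Fin 8) (Fin 5) ℕ :=
  ![!![1, 1, 1, 1, 1; 1, 1, 2, 3, 3; 2, 3, 3, 5, 5; 2, 3, 4, 7, 7; 3, 4, 5, 4, 2; 3, 4, 6, 2, 4; 4, 2, 7, 8, 6; 4, 2, 8, 6, 8],
    !![1, 1, 1, 1, 1; 1, 1, 3, 2, 3; 2, 3, 5, 3, 5; 2, 3, 6, 5, 7; 3, 4, 2, 7, 4; 3, 4, 4, 8, 2; 4, 2, 7, 4, 8; 4, 2, 8, 6, 6],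
    !![1, 1, 1, 1, 1; 1, 2, 3, 3, 3; 2, 3, 5, 5, 5; 2, 3, 7, 7, 6; 3, 4, 2, 4, 7; 3, 4, 4, 2, 8; 4, 1, 8, 6, 2; 4, 2, 6, 8, 4],
    !![1, 1, 1, 1, 1; 1, 2, 3, 3, 3; 2, 3, 5, 5, 5; 2, 4, 7, 7, 7; 3, 3, 4, 2, 6; 3, 4, 2, 4, 8; 4, 1, 8, 6, 2; 4, 2, 6, 8, 4],
    !![1, 1, 1, 1, 1; 1, 2, 3, 3, 3; 2, 3, 5, 5, 5; 2, 4, 7, 7, 7; 3, 3, 2, 6, 4; 3, 4, 4, 8, 2; 4, 1, 8, 2, 6; 4, 2, 6, 4, 8],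
    !![1, 1, 1, 1, 1; 1, 2, 3, 3, 3; 2, 3, 5, 5, 5; 2, 4, 7, 7, 7; 3, 3, 4, 2, 6; 3, 4, 8, 4, 2; 4, 1, 2, 6, 8; 4, 2, 6, 8, 4],
    !![1, 1, 1, 1, 1; 1, 2, 3, 3, 3; 2, 3, 4, 5, 5; 2, 4, 2, 7, 7; 3, 4, 4, 2, 8; 3, 3, 2, 4, 6; 4, 2, 1, 6, 4; 4, 1, 3, 8, 2],
    !![1, 1, 1, 1, 1; 1, 2, 2, 3, 3; 2, 3, 3, 5, 5; 2, 4, 4, 7, 7; 3, 4, 3, 2, 4; 3, 3, 4, 4, 2; 4, 2, 1, 6, 8; 4, 1, 2, 8, 6],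
    !![1, 1, 1, 1, 1; 1, 2, 2, 3, 3; 2, 3, 3, 5, 5; 2, 4, 4, 7, 7; 3, 4, 3, 2, 4; 3, 3, 4, 4, 2; 4, 2, 1, 8, 6; 4, 1, 2, 6, 8],
    !![1, 1, 1, 1, 1; 1, 3, 2, 3, 3; 2, 4, 3, 5, 5; 2, 2, 4, 7, 7; 3, 4, 4, 2, 8; 3, 2, 3, 6, 4; 4, 1, 2, 4, 6; 4, 3, 1, 8, 2],
    !![1, 1, 1, 1, 1; 1, 2, 3, 3, 3; 2, 3, 5, 5, 5; 2, 3, 6, 7, 7; 3, 4, 5, 2, 4; 3, 4, 6, 4, 2; 4, 1, 2, 8, 6; 4, 2, 4, 6, 8],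
    !![1, 1, 1, 1, 1; 1, 2, 3, 3, 3; 2, 3, 5, 5, 5; 2, 4, 2, 7, 7; 3, 3, 2, 6, 4; 3, 4, 4, 8, 2; 4, 1, 6, 2, 8; 4, 2, 1, 4, 6],
    !![1, 1, 1, 1, 1; 1, 2, 3, 3, 3; 2, 3, 5, 5, 5; 2, 4, 2, 7, 7; 3, 3, 2, 4, 6; 3, 4, 4, 8, 2; 4, 1, 6, 2, 8; 4, 2, 1, 6, 4],
    !![1, 1, 1, 1, 1; 1, 2, 2, 3, 3; 2, 3, 5, 5, 5; 2, 4, 3, 7, 7; 3, 3, 6, 2, 4; 3, 4, 4, 4, 2; 4, 1, 2, 8, 6; 4, 2, 1, 6, 8],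
    !![1, 1, 1, 1, 1; 1, 2, 3, 3, 3; 2, 3, 5, 5, 5; 2, 3, 6, 7, 7; 3, 4, 5, 4, 2; 3, 4, 6, 2, 4; 4, 1, 2, 8, 6; 4, 2, 4, 6, 8],
    !![1, 1, 1, 1, 1; 1, 2, 2, 3, 3; 2, 3, 5, 5, 5; 2, 4, 3, 7, 7; 3, 3, 6, 4, 2; 3, 4, 4, 2, 4; 4, 1, 2, 8, 6; 4, 2, 1, 6, 8],
    !![1, 1, 1, 1, 1; 1, 2, 3, 3, 3; 2, 1, 3, 3, 3; 2, 2, 5, 5, 5; 3, 3, 2, 6, 4; 3, 4, 4, 2, 6; 4, 3, 4, 2, 6; 4, 4, 6, 4, 2],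
    !![1, 1, 1, 1, 1; 1, 3, 2, 3, 3; 2, 4, 5, 5, 5; 2, 2, 3, 6, 7; 3, 1, 2, 4, 6; 3, 3, 1, 2, 8; 4, 4, 4, 6, 2; 4, 2, 6, 5, 4],
    !![1, 1, 1, 1, 1; 1, 3, 2, 5, 3; 1, 4, 5, 2, 5; 2, 5, 3, 3, 7; 3, 3, 1, 4, 2; 3, 4, 6, 2, 8; 3, 6, 2, 1, 4; 4, 2, 4, 6, 6],
    !![1, 1, 1, 1, 1; 1, 2, 5, 3, 3; 1, 5, 2, 4, 5; 2, 3, 3, 5, 7; 3, 4, 2, 3, 4; 3, 2, 4, 4, 6; 3, 1, 1, 6, 2; 4, 6, 6, 2, 8],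
    !![1, 1, 1, 1, 1; 1, 3, 5, 2, 2; 1, 4, 2, 5, 5; 2, 5, 3, 3, 3; 3, 3, 2, 1, 4; 3, 4, 4, 6, 2; 3, 6, 1, 2, 1; 4, 2, 6, 4, 6],
    !![1, 1, 1, 1, 1; 1, 2, 3, 3, 3; 2, 3, 3, 5, 1; 2, 5, 1, 6, 3; 3, 6, 5, 4, 2; 3, 4, 6, 2, 4; 4, 6, 4, 2, 5; 4, 4, 2, 4, 6],
    !![1, 1, 1, 1, 1; 1, 3, 2, 5, 3; 2, 5, 3, 3, 5; 2, 6, 5, 5, 7; 3, 6, 5, 6, 2; 3, 2, 6, 4, 4; 4, 3, 2, 6, 6; 4, 4, 4, 2, 8],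
    !![1, 1, 1, 1, 1; 1, 3, 5, 2, 3; 2, 5, 3, 3, 5; 2, 3, 5, 5, 6; 3, 6, 6, 5, 2; 3, 2, 4, 6, 4; 4, 6, 6, 2, 7; 4, 4, 2, 4, 8],
    !![1, 1, 1, 1, 1; 1, 3, 5, 5, 2; 2, 5, 3, 3, 3; 2, 3, 5, 5, 4; 3, 6, 2, 6, 5; 3, 2, 6, 4, 6; 4, 6, 2, 6, 7; 4, 4, 4, 2, 8],
    !![1, 1, 1, 1, 1; 1, 3, 5, 5, 2; 2, 5, 3, 3, 2; 2, 3, 5, 5, 1; 3, 6, 6, 2, 5; 3, 2, 4, 6, 6; 4, 6, 6, 2, 3; 4, 4, 2, 4, 4],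
    !![1, 1, 1, 1, 1; 1, 3, 2, 3, 3; 2, 5, 5, 5, 5; 2, 6, 3, 7, 7; 3, 5, 6, 2, 4; 3, 6, 4, 4, 2; 4, 4, 2, 6, 8; 4, 2, 1, 8, 6],
    !![1, 1, 1, 1, 1; 1, 3, 2, 3, 3; 2, 5, 5, 5, 5; 2, 6, 3, 7, 7; 3, 5, 6, 2, 4; 3, 6, 4, 4, 2; 4, 4, 2, 8, 6; 4, 2, 1, 6, 8],
    !![1, 1, 1, 1, 1; 1, 3, 3, 2, 3; 2, 5, 5, 5, 5; 2, 6, 2, 3, 7; 3, 5, 2, 6, 4; 3, 6, 4, 4, 2; 4, 4, 1, 2, 6; 4, 2, 6, 1, 8],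
    !![1, 1, 1, 1, 1; 1, 5, 5, 3, 2; 1, 6, 2, 5, 3; 2, 3, 5, 1, 5; 2, 4, 3, 3, 7; 3, 5, 2, 4, 6; 3, 6, 4, 2, 4; 4, 2, 6, 6, 8],
    !![1, 1, 1, 1, 1; 3, 5, 3, 2, 1; 5, 3, 5, 5, 2; 5, 1, 3, 6, 2; 6, 6, 5, 2, 5; 2, 4, 4, 3, 6; 6, 3, 2, 1, 3; 4, 2, 6, 4, 4],
    !![1, 1, 1, 1, 1; 3, 2, 1, 1, 1; 5, 5, 2, 5, 3; 6, 3, 2, 5, 3; 6, 4, 5, 2, 5; 4, 2, 6, 3, 4; 5, 6, 3, 4, 2; 2, 1, 4, 6, 6]]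

end QubitUPB

/-!
All that matters about a five-qubit unextendible product basis of size eight is its pattern: which
rows have equal, and which have orthogonal, states in each of the five columns. In `ℂ²` every state
has exactly one orthogonal state up to a phase, so each column is partitioned into classes of equal
states, some of which come in orthogonal pairs. Orthonormality means that every two rows are
orthogonal in some column. A product vector orthogonal to all rows amounts to a choice of one class
in each column such that the chosen classes cover all rows, so unextendibility means that there is
no such choice (`isPattern_of_isUPB`). The factors of a product vector are unique up to phases
(`factor_unique`), hence the matrices that represent the basis are those with its pattern, and two
matrices are equivalent as soon as their patterns agree up to permutations of rows and columns
(`equivalent_of_pattern`).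

The core is the finite classification of patterns, `IsPattern.isListed`. It branches on the column
in which two chosen rows are orthogonal, and closes the relations obtained under the laws of
equality and orthogonality (`holds_merge_eq`, `holds_merge_orth`). A branch ends when

* two rows are both equal and orthogonal in a column,
* one class in each column, chosen greedily in some order of the columns, covers all rows
  (`not_coveredBy`), or
* the state contains, up to permutations of rows and columns, a listed pattern or a state that is
  still to be branched on (`contains_sound`).

The choices of rows, column orders and permutations are read from numerals, the certificate of the
search, so that the kernel only verifies them; the relations are packed into natural numbers to
make this fast. No property of the certificate enters the argument: the checks are sound for every
certificate (`checkSearch_sound`). There are two searches, one from a state with three equal rows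
and a row orthogonal to them (`check_triple`), and one for the patterns without such a class, where
every class that has an orthogonal one has at most two rows (`check_small`). Containing a listed
pattern is enough because a pattern that properly extends a listed one contains another listed
pattern with more orthogonalities (`checkComplete_sound`, `settled_listed`).

Conversely the listed matrices are realized by four rational orthonormal bases of `ℂ²` in general
position, one for each pair of orthogonal names (`isUOM_uomList`). They are pairwise non-equivalent
since a number computed from closed walks along the orthogonalities, invariant under equivalence
(`walkInvariant_of_equivalent`), takes different values at them.
-/

namespace QubitUPB

/-! ### Orthogonality patterns -/

/-- The combinatorial content of a five-qubit unextendible product basis of size eight: `E c i t`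
says that the states of rows `i` and `t` in column `c` are equal up to a phase, `O c i t` that they
are orthogonal. Every two rows are orthogonal in some column (`covers`), and a choice of a class of
equal states in each column never covers all rows (`unext`). -/
structure IsPattern (E O : Fin 5 → Fin 8 → Fin 8 → Prop) : Prop where
  eq_refl : ∀ c i, E c i i
  eq_symm : ∀ c i t, E c i t → E c t i
  eq_trans : ∀ c i t u, E c i t → E c t u → E c i u
  orth_symm : ∀ c i t, O c i t → O c t i
  orth_orth : ∀ c i t u, O c i t → O c t u → E c i u
  eq_orth : ∀ c i t u, E c i t → O c t u → O c i u
  not_both : ∀ c i t, E c i t → ¬ O c i t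
  covers : ∀ i t, i ≠ t → ∃ c, O c i t
  unext : ∀ f : Fin 5 → Fin 8, ∃ i, ∀ c, ¬ E c (f c) i

/-- No class of the pattern that has an orthogonal class contains three rows. -/
def NoTriple (O : Fin 5 → Fin 8 → Fin 8 → Prop) : Prop :=
  ∀ c t a b d, O c t a → O c t b → O c t d → a = b ∨ a = d ∨ b = d

theorem IsPattern.orth_eq {E O} (h : IsPattern E O) (c : Fin 5) (i t u : Fin 8)
    (h1 : O c i t) (h2 : E c t u) : O c i u :=
  h.orth_symm _ _ _ (h.eq_orth _ _ _ _ (h.eq_symm _ _ _ h2) (h.orth_symm _ _ _ h1))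

theorem IsPattern.permute {E O} (h : IsPattern E O) (σ : Equiv.Perm (Fin 8))
    (τ : Equiv.Perm (Fin 5)) :
    IsPattern (fun c i t => E (τ c) (σ i) (σ t)) (fun c i t => O (τ c) (σ i) (σ t)) where
  eq_refl _ _ := h.eq_refl _ _
  eq_symm _ _ _ := h.eq_symm _ _ _
  eq_trans _ _ _ _ := h.eq_trans _ _ _ _
  orth_symm _ _ _ := h.orth_symm _ _ _
  orth_orth _ _ _ _ := h.orth_orth _ _ _ _
  eq_orth _ _ _ _ := h.eq_orth _ _ _ _
  not_both _ _ _ := h.not_both _ _ _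
  covers i t hit := by
    obtain ⟨c, hc⟩ := h.covers (σ i) (σ t) (fun e => hit (σ.injective e))
    exact ⟨τ.symm c, by simpa using hc⟩
  unext f := by
    obtain ⟨i, hi⟩ := h.unext (fun c => σ (f (τ.symm c)))
    exact ⟨σ.symm i, fun c => by simpa using hi (τ c)⟩

theorem NoTriple.permute {O : Fin 5 → Fin 8 → Fin 8 → Prop} (h : NoTriple O)
    (σ : Equiv.Perm (Fin 8)) (τ : Equiv.Perm (Fin 5)) :
    NoTriple (fun c i t => O (τ c) (σ i) (σ t)) := fun c t a b d h1 h2 h3 => by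
  simpa using h _ _ _ _ _ h1 h2 h3

/-! ### Packed relations -/

/-- The relation packed into the bits of `w` (row `i` and row `t` of column `c` at position
`64 * c + 8 * i + t`) is contained in `R`. -/
def Holds (R : Fin 5 → Fin 8 → Fin 8 → Prop) (w : ℕ) : Prop :=
  ∀ (c : Fin 5) (i t : Fin 8), w.testBit (64 * c + 8 * i + t) = true → R c i t

/-- `force n k` is `k n`; the recursion on `n` makes the kernel evaluate `n` before `k` is
unfolded, so that the value is shared by all its occurrences in `k`. -/
def force {α : Type} (n : ℕ) (k : ℕ → α) : α :=
  Nat.rec (motive := fun _ => α) (k 0) (fun m _ => k (Nat.succ m)) n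

@[simp] theorem force_eq {α : Type} (n : ℕ) (k : ℕ → α) : force n k = k n := by
  cases n <;> rfl

/-- Bit `p` of `w`. -/
def bit (w p : ℕ) : Bool := Nat.beq (Nat.land (Nat.shiftRight w p) 1) 1

theorem bit_eq (w p : ℕ) : bit w p = w.testBit p := by
  have h : bit w p = Nat.beq ((w >>> p) &&& 1) 1 := rfl
  rw [h, Nat.testBit_eq_decide_div_mod_eq, Nat.and_one_is_mod, Nat.shiftRight_eq_div_pow]
  rw [Bool.eq_iff_iff]; simp

/-- The set of rows related to row `r` in column `c`, as a mask of eight bits. -/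
def cell (w c r : ℕ) : ℕ :=
  Nat.land (Nat.shiftRight w (Nat.add (Nat.mul 64 c) (Nat.mul 8 r))) 255

theorem testBit_cell (w c r t : ℕ) :
    (cell w c r).testBit t = (decide (t < 8) && w.testBit (64 * c + 8 * r + t)) := by
  have h : cell w c r = (w >>> (64 * c + 8 * r)) &&& (2 ^ 8 - 1) := rfl
  rw [h, Nat.testBit_and, Nat.testBit_shiftRight, Nat.testBit_two_pow_sub_one, Bool.and_comm]

theorem cell_lt (w c r : ℕ) : cell w c r < 256 :=
  lt_of_le_of_lt Nat.and_le_right (by norm_num)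

/-- The rows related to row `r` in column `c`, as a set of bits at the positions
`64 * c + 8 * i`. -/
def comb (w c r : ℕ) : ℕ :=
  Nat.land (Nat.shiftRight w r) (Nat.shiftLeft 0x0101010101010101 (Nat.mul 64 c))

theorem testBit_comb {w c r p : ℕ} (h : (comb w c r).testBit p = true) :
    ∃ i < 8, p = 64 * c + 8 * i ∧ w.testBit (64 * c + 8 * i + r) = true := by
  have e : comb w c r = (w >>> r) &&& (0x0101010101010101 <<< (64 * c)) := rfl
  rw [e, Nat.testBit_and, Nat.testBit_shiftRight, Nat.testBit_shiftLeft, Bool.and_eq_true,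
    Bool.and_eq_true, decide_eq_true_eq] at h
  obtain ⟨h1, h2, h3⟩ := h
  have h4 : p - 64 * c < 64 := by
    by_contra h4
    rw [Nat.testBit_eq_false_of_lt] at h3
    · simp at h3
    · exact lt_of_lt_of_le (by norm_num) (Nat.pow_le_pow_right (n := 2) (by norm_num)
        (not_lt.mp h4))
  have h5 : ∀ q < 64, Nat.testBit 0x0101010101010101 q = true → q % 8 = 0 := by decide
  have h6 := h5 _ h4 h3
  refine ⟨(p - 64 * c) / 8, by omega, by omega, ?_⟩
  rw [← h1]; congr 1; omega

/-- When the bits of `a` have distance eight, the product with a mask of eight bits has no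
carries. -/
theorem testBit_mul_mask (Y : ℕ) (hY : Y < 256) (a : ℕ)
    (ha : ∀ p, a.testBit p = true → p % 8 = 0) (q : ℕ) :
    (a * Y).testBit q = (a.testBit (8 * (q / 8)) && Y.testBit (q % 8)) := by
  induction a using Nat.strong_induction_on generalizing q with
  | _ a ih =>
  by_cases h0 : a = 0
  · simp [h0]
  have hb : a % 256 < 2 := by
    rcases Nat.lt_or_ge (a % 256) 2 with h | h
    · exact h
    exfalso
    have hne : a % 256 ≠ 0 := by omega
    have h1 : (a % 2 ^ 8).testBit (Nat.log2 (a % 256)) = true := Nat.testBit_log2 hne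
    rw [Nat.testBit_mod_two_pow, Bool.and_eq_true, decide_eq_true_eq] at h1
    have h2 := ha _ h1.2
    have h3 : Nat.log2 (a % 256) = 0 := by omega
    have h4 := Nat.lt_log2_self (n := a % 256)
    rw [h3] at h4; omega
  have e : a = 2 ^ 8 * (a / 256) + a % 256 := by omega
  have hs : ∀ p, (a / 256).testBit p = a.testBit (p + 8) := fun p => by
    rw [show (256 : ℕ) = 2 ^ 8 from rfl, Nat.testBit_div_two_pow]
  have hbY : a % 256 * Y < 2 ^ 8 := by
    interval_cases a % 256 <;> omega
  have e2 : a * Y = 2 ^ 8 * (a / 256 * Y) + a % 256 * Y := by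
    conv_lhs => rw [e]
    ring
  rw [e2, Nat.testBit_two_pow_mul_add _ hbY]
  split
  · next hq =>
    rw [show q / 8 = 0 by omega, show q % 8 = q by omega, Nat.mul_zero]
    have h8 : a.testBit 0 = (a % 256).testBit 0 := by
      rw [show (256 : ℕ) = 2 ^ 8 from rfl, Nat.testBit_mod_two_pow]; simp
    rw [h8]
    interval_cases a % 256 <;> simp
  · next hq =>
    rw [ih (a / 256) (by omega) (fun p hp => by have := ha _ ((hs p) ▸ hp); omega), hs]
    congr 2 <;> omega

/-- Adding the orthogonality of rows `r` and `t` in column `c` merges the class of `r` with the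
rows orthogonal to `t`; `mergeMask` is the merged class. -/
def mergeMask (s o c r t : ℕ) : ℕ := Nat.lor (cell s c r) (cell o c t)

/-- The merged class again, at the positions `64 * c + 8 * i`. -/
def mergeComb (s o c r t : ℕ) : ℕ := Nat.lor (comb s c r) (comb o c t)

/-- The products of the combs and the masks of the merged classes, added to `w`. -/
def mergeWord (w a x b y : ℕ) : ℕ := Nat.lor w (Nat.lor (Nat.mul a x) (Nat.mul b y))

theorem mergeMask_lt (s o c r t : ℕ) : mergeMask s o c r t < 256 :=
  Nat.or_lt_two_pow (n := 8) (cell_lt _ _ _) (cell_lt _ _ _)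

theorem holds_mergeWord {R : Fin 5 → Fin 8 → Fin 8 → Prop} {w a x b y : ℕ} (hw : Holds R w)
    (c : Fin 5) (hx : x < 256) (hy : y < 256)
    (ha : ∀ p, a.testBit p = true → ∃ i < 8, p = 64 * c.1 + 8 * i)
    (hb : ∀ p, b.testBit p = true → ∃ i < 8, p = 64 * c.1 + 8 * i)
    (hax : ∀ i t : Fin 8, a.testBit (64 * c + 8 * i) = true → x.testBit t = true → R c i t)
    (hby : ∀ i t : Fin 8, b.testBit (64 * c + 8 * i) = true → y.testBit t = true → R c i t) :
    Holds R (mergeWord w a x b y) := by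
  have key : ∀ a x : ℕ, x < 256 → (∀ p, a.testBit p = true → ∃ i < 8, p = 64 * c.1 + 8 * i) →
      (∀ i t : Fin 8, a.testBit (64 * c + 8 * i) = true → x.testBit t = true → R c i t) →
      Holds R (a * x) := by
    intro a x hx ha hax d i t h
    rw [testBit_mul_mask x hx a (fun p hp => by obtain ⟨i, _, rfl⟩ := ha p hp; omega),
      Bool.and_eq_true] at h
    obtain ⟨h1, h2⟩ := h
    have hi := i.2
    have ht := t.2
    rw [show 8 * ((64 * d.1 + 8 * i.1 + t.1) / 8) = 64 * d + 8 * i by omega] at h1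
    rw [show (64 * d.1 + 8 * i.1 + t.1) % 8 = t by omega] at h2
    obtain ⟨j, hj, e⟩ := ha _ h1
    have : d = c := Fin.ext (by omega)
    subst this
    exact hax i t h1 h2
  intro d i t h
  have e : mergeWord w a x b y = w ||| (a * x ||| b * y) := rfl
  rw [e, Nat.testBit_or, Nat.testBit_or, Bool.or_eq_true, Bool.or_eq_true] at h
  rcases h with h | h | h
  · exact hw _ _ _ h
  · exact key a x hx ha hax _ _ _ h
  · exact key b y hy hb hby _ _ _ h

theorem orth_of_mergeMask {E O} (h : IsPattern E O) {s o : ℕ} (hs : Holds E s) (ho : Holds O o)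
    {c : Fin 5} {r t : Fin 8} (hrt : O c r t) {i : Fin 8}
    (hi : (mergeMask s o c r t).testBit i = true) : O c i t := by
  have e : mergeMask s o c r t = cell s c r ||| cell o c t := rfl
  rw [e, Nat.testBit_or, testBit_cell, testBit_cell, Bool.or_eq_true, Bool.and_eq_true,
    Bool.and_eq_true] at hi
  rcases hi with ⟨_, hi⟩ | ⟨_, hi⟩
  · exact h.eq_orth _ _ _ _ (h.eq_symm _ _ _ (hs _ _ _ hi)) hrt
  · exact h.orth_symm _ _ _ (ho _ _ _ hi)

theorem orth_of_mergeComb {E O} (h : IsPattern E O) {s o : ℕ} (hs : Holds E s) (ho : Holds O o)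
    {c : Fin 5} {r t : Fin 8} (hrt : O c r t) {i : Fin 8}
    (hi : (mergeComb s o c r t).testBit (64 * c + 8 * i) = true) : O c i t := by
  have e : mergeComb s o c r t = comb s c r ||| comb o c t := rfl
  rw [e, Nat.testBit_or, Bool.or_eq_true] at hi
  rcases hi with hi | hi
  · obtain ⟨j, _, e, hj⟩ := testBit_comb hi
    obtain rfl : j = i := by omega
    exact h.eq_orth _ _ _ _ (hs _ _ _ hj) hrt
  · obtain ⟨j, _, e, hj⟩ := testBit_comb hi
    obtain rfl : j = i := by omega
    exact ho _ _ _ hj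

theorem mergeComb_pos {s o c r t p : ℕ} (hp : (mergeComb s o c r t).testBit p = true) :
    ∃ i < 8, p = 64 * c + 8 * i := by
  have e : mergeComb s o c r t = comb s c r ||| comb o c t := rfl
  rw [e, Nat.testBit_or, Bool.or_eq_true] at hp
  rcases hp with hp | hp <;> obtain ⟨j, hj, e, _⟩ := testBit_comb hp <;> exact ⟨j, hj, e⟩

/-- The equalities forced by adding the orthogonality of `r` and `t`. -/
theorem holds_merge_eq {E O} (h : IsPattern E O) {s o : ℕ} (hs : Holds E s) (ho : Holds O o)
    {c : Fin 5} {r t : Fin 8} (hrt : O c r t) :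
    Holds E (mergeWord s (mergeComb s o c r t) (mergeMask s o c r t)
      (mergeComb s o c t r) (mergeMask s o c t r)) := by
  refine holds_mergeWord hs c (mergeMask_lt _ _ _ _ _) (mergeMask_lt _ _ _ _ _)
    (fun p => mergeComb_pos) (fun p => mergeComb_pos) ?_ ?_
  · exact fun i u hi hu => h.orth_orth _ _ _ _ (orth_of_mergeComb h hs ho hrt hi)
      (h.orth_symm _ _ _ (orth_of_mergeMask h hs ho hrt hu))
  · have htr := h.orth_symm _ _ _ hrt
    exact fun i u hi hu => h.orth_orth _ _ _ _ (orth_of_mergeComb h hs ho htr hi)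
      (h.orth_symm _ _ _ (orth_of_mergeMask h hs ho htr hu))

/-- The orthogonalities forced by adding the orthogonality of `r` and `t`. -/
theorem holds_merge_orth {E O} (h : IsPattern E O) {s o : ℕ} (hs : Holds E s) (ho : Holds O o)
    {c : Fin 5} {r t : Fin 8} (hrt : O c r t) :
    Holds O (mergeWord o (mergeComb s o c r t) (mergeMask s o c t r)
      (mergeComb s o c t r) (mergeMask s o c r t)) := by
  have htr := h.orth_symm _ _ _ hrt
  have key : ∀ i u r t, O c r t → O c i t → O c u r → O c i u := fun i u r t hrt hi hu =>
    h.eq_orth _ _ _ _ (h.orth_orth _ _ _ _ hi (h.orth_symm _ _ _ hrt)) (h.orth_symm _ _ _ hu)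
  refine holds_mergeWord ho c (mergeMask_lt _ _ _ _ _) (mergeMask_lt _ _ _ _ _)
    (fun p => mergeComb_pos) (fun p => mergeComb_pos) ?_ ?_
  · exact fun i u hi hu => key _ _ _ _ hrt (orth_of_mergeComb h hs ho hrt hi)
      (orth_of_mergeMask h hs ho htr hu)
  · exact fun i u hi hu => key _ _ _ _ htr (orth_of_mergeComb h hs ho htr hi)
      (orth_of_mergeMask h hs ho hrt hu)


/-! ### Covers and permutations -/

/-- The highest bit of a mask of eight bits, read from a table. -/
def highBit (m : ℕ) : ℕ :=
  Nat.land (Nat.shiftRight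
    0x7777777777777777777777777777777777777777777777777777777777777777777777777777777777777777777777777777777777777777777777777777777766666666666666666666666666666666666666666666666666666666666666665555555555555555555555555555555544444444444444443333333322221100
    (Nat.mul 4 m)) 15

theorem highBit_lt : ∀ m < 256, highBit m < 8 := by decide +kernel

theorem testBit_highBit : ∀ m < 256, m ≠ 0 → m.testBit (highBit m) = true := by decide +kernel

/-- Removes from the row set `unc` the class of its highest row in column `c`. -/
def strike (s unc c : ℕ) : ℕ := Nat.xor unc (Nat.land unc (cell s c (highBit unc)))

theorem testBit_strike (s unc c i : ℕ) :
    (strike s unc c).testBit i = (unc.testBit i && !(cell s c (highBit unc)).testBit i) := by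
  have e : strike s unc c = unc ^^^ (unc &&& cell s c (highBit unc)) := rfl
  rw [e, Nat.testBit_xor, Nat.testBit_and]
  cases unc.testBit i <;> cases (cell s c (highBit unc)).testBit i <;> rfl

theorem strike_lt {unc : ℕ} (s c : ℕ) (h : unc < 256) : strike s unc c < 256 := by
  apply Nat.lt_pow_two_of_testBit (n := 8)
  intro i hi
  rw [testBit_strike, Nat.testBit_lt_two_pow (lt_of_lt_of_le h
    (Nat.pow_le_pow_right (n := 2) (by norm_num) hi))]
  rfl

/-- Taking the columns of the list in turn, and in each the class of the highest row that is not
yet covered, covers the row set `unc`. -/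
def coveredBy (s : ℕ) : List ℕ → ℕ → Bool
  | [], unc => Nat.beq unc 0
  | c :: cs, unc => force (strike s unc c) fun unc' => coveredBy s cs unc'

theorem coveredBy_sound {E : Fin 5 → Fin 8 → Fin 8 → Prop} {s : ℕ} (hs : Holds E s) :
    ∀ (cs : List ℕ) (unc : ℕ), cs.Nodup → (∀ c ∈ cs, c < 5) → unc < 256 →
      coveredBy s cs unc = true →
      ∃ f : Fin 5 → Fin 8, ∀ i : Fin 8, unc.testBit i = true → ∃ c, c.1 ∈ cs ∧ E c (f c) i := by
  intro cs
  induction cs with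
  | nil =>
    intro unc _ _ _ h
    have h0 : unc = 0 := Nat.eq_of_beq_eq_true h
    exact ⟨fun _ => 0, fun i hi => by simp [h0] at hi⟩
  | cons c cs ih =>
    intro unc hnd hlt hunc h
    rw [coveredBy, force_eq] at h
    rw [List.nodup_cons] at hnd
    obtain ⟨f, hf⟩ := ih _ hnd.2 (fun d hd => hlt d (List.mem_cons_of_mem _ hd))
      (strike_lt s c hunc) h
    have hc := hlt c (by simp)
    refine ⟨Function.update f ⟨c, hc⟩ ⟨_, highBit_lt unc hunc⟩, fun i hi => ?_⟩
    by_cases hcell : (cell s c (highBit unc)).testBit i = true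
    · rw [testBit_cell, Bool.and_eq_true] at hcell
      exact ⟨⟨c, hc⟩, by simp, by
        rw [Function.update_self]; exact hs ⟨c, hc⟩ ⟨_, highBit_lt unc hunc⟩ i hcell.2⟩
    · obtain ⟨d, hd, hE⟩ := hf i (by rw [testBit_strike, hi]; simpa using hcell)
      refine ⟨d, List.mem_cons_of_mem _ hd, ?_⟩
      rw [Function.update_of_ne]
      · exact hE
      · rintro rfl; exact hnd.1 hd

/-- The 120 orderings of the five columns, with fifteen bits for each. -/
def orderingTable : ℕ :=
  0x5380a8c17104e129c00b50189831a0a325460266050b0e141c44b8814c42a065c09380a70808b8118c33106a12d401950429885a11326260346088b11942344c68168431066309460a8c82838508cb1126214cc05850c09981a5032a161306280b7014e045c2826445086e109c40b8882138428c87120e145c04350889911a42328c61066210b6214c44598822c44606cc09a80b50840b8818d83130a16540c152029c05a81330a61846408b81950346168328485070b0a260c4c84438888d911342168c0c852109c21a88331161a06440b8c15184632834448887190a340c688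

/-- The `t`-th ordering of the five columns. -/
def ordering (t : ℕ) : List ℕ :=
  force (Nat.shiftRight orderingTable (Nat.mul 15 t)) fun q =>
    [Nat.land q 7, Nat.land (Nat.shiftRight q 3) 7, Nat.land (Nat.shiftRight q 6) 7,
      Nat.land (Nat.shiftRight q 9) 7, Nat.land (Nat.shiftRight q 12) 7]

theorem ordering_valid : ∀ t < 120, (ordering t).Nodup ∧ ∀ c ∈ ordering t, c < 5 := by
  decide +kernel

theorem not_coveredBy {E O} (h : IsPattern E O) {s : ℕ} (hs : Holds E s) {t : ℕ} (ht : t < 120) :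
    coveredBy s (ordering t) 255 = false := by
  by_contra hc
  obtain ⟨h1, h2⟩ := ordering_valid t ht
  obtain ⟨f, hf⟩ := coveredBy_sound hs _ 255 h1 h2 (by norm_num) (by simpa using hc)
  obtain ⟨i, hi⟩ := h.unext f
  have hbits : ∀ i : Fin 8, Nat.testBit 255 i = true := by decide
  obtain ⟨c, _, hE⟩ := hf i (hbits i)
  exact hi c hE

/-- Whether the mask `x` has at least three bits: two of them are removed, the lowest first. -/
def atLeastThree (x : ℕ) : Bool :=
  force (Nat.land x (Nat.pred x)) fun y => Bool.not (Nat.beq (Nat.land y (Nat.pred y)) 0)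

theorem atLeastThree_sound : ∀ x < 256, atLeastThree x = true →
    ∃ a b d : Fin 8, a < b ∧ b < d ∧ x.testBit a = true ∧ x.testBit b = true ∧
      x.testBit d = true := by
  decide +kernel

/-- The bitwise disjunction of `f 0, …, f (n - 1)`. -/
def orRange (n : ℕ) (f : ℕ → ℕ) : ℕ :=
  Nat.rec (motive := fun _ => ℕ) 0 (fun i w => Nat.lor w (f i)) n

theorem testBit_orRange (n : ℕ) (f : ℕ → ℕ) (p : ℕ) :
    (orRange n f).testBit p = true ↔ ∃ i < n, (f i).testBit p = true := by
  induction n with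
  | zero => simp [orRange]
  | succ n ih =>
    have e : orRange (n + 1) f = orRange n f ||| f n := rfl
    rw [e, Nat.testBit_or, Bool.or_eq_true, ih]
    constructor
    · rintro (⟨i, hi, h⟩ | h)
      · exact ⟨i, by omega, h⟩
      · exact ⟨n, by omega, h⟩
    · rintro ⟨i, hi, h⟩
      rcases Nat.lt_succ_iff_lt_or_eq.1 hi with hi | rfl
      · exact Or.inl ⟨i, hi, h⟩
      · exact Or.inr h

/-- The image of row `i` under the row permutation packed into `q`. -/
def rowImage (q i : ℕ) : ℕ := Nat.land (Nat.shiftRight q (Nat.mul 3 i)) 7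

/-- The image of column `c` under the column permutation packed into `q`. -/
def colImage (q c : ℕ) : ℕ := Nat.land (Nat.shiftRight q (Nat.add 24 (Nat.mul 3 c))) 7

/-- The relation `w` carried along the permutations packed into `q`: all rows of all columns are
moved together, then the bits within them, then the columns. -/
def permuteWord (q w : ℕ) : ℕ :=
  force (orRange 8 fun i => Nat.shiftLeft (Nat.land (Nat.shiftRight w (Nat.mul 8 i))
    0xff00000000000000ff00000000000000ff00000000000000ff00000000000000ff)
    (Nat.mul 8 (rowImage q i))) fun w1 =>
  force (orRange 8 fun t => Nat.shiftLeft (Nat.land (Nat.shiftRight w1 t)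
    0x01010101010101010101010101010101010101010101010101010101010101010101010101010101)
    (rowImage q t)) fun w2 =>
  orRange 5 fun c => Nat.shiftLeft (Nat.land (Nat.shiftRight w2 (Nat.mul 64 c))
    0xffffffffffffffff) (Nat.mul 64 (colImage q c))

theorem testBit_shift {w m a b p : ℕ} (hb : b ≤ p) (h : w.testBit (a + (p - b)) = true)
    (hm : m.testBit (p - b) = true) :
    (Nat.shiftLeft (Nat.land (Nat.shiftRight w a) m) b).testBit p = true := by
  have e : Nat.shiftLeft (Nat.land (Nat.shiftRight w a) m) b = ((w >>> a) &&& m) <<< b := rfl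
  rw [e, Nat.testBit_shiftLeft, Nat.testBit_and, Nat.testBit_shiftRight, h, hm]
  simpa using hb

theorem testBit_permuteWord (q w : ℕ) (c : Fin 5) (i t : Fin 8)
    (h : w.testBit (64 * c + 8 * i + t) = true) :
    (permuteWord q w).testBit (64 * colImage q c + 8 * rowImage q i + rowImage q t) = true := by
  have h7 : ∀ i, rowImage q i < 8 := fun i => lt_of_le_of_lt Nat.and_le_right (by norm_num)
  have m1 : ∀ (c : Fin 5) (t : Fin 8),
      Nat.testBit 0xff00000000000000ff00000000000000ff00000000000000ff00000000000000ff
        (64 * c + t) = true := by decide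
  have m2 : ∀ (c : Fin 5) (t : Fin 8), Nat.testBit
      0x01010101010101010101010101010101010101010101010101010101010101010101010101010101
        (64 * c + 8 * t) = true := by decide
  have m3 : ∀ (i t : Fin 8), Nat.testBit 0xffffffffffffffff (8 * i + t) = true := by decide
  have hi := h7 i
  have ht := h7 t
  rw [permuteWord, force_eq, force_eq, testBit_orRange]
  refine ⟨c, c.2, testBit_shift (by dsimp only [Nat.mul_eq]; omega) ?_ ?_⟩
  · rw [testBit_orRange]
    refine ⟨t, t.2, testBit_shift (by dsimp only [Nat.mul_eq]; omega) ?_ ?_⟩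
    · rw [testBit_orRange]
      refine ⟨i, i.2, testBit_shift (by dsimp only [Nat.mul_eq]; omega) ?_ ?_⟩
      · rw [← h]; congr 1; dsimp only [Nat.mul_eq]; omega
      · rw [← m1 c t]; congr 1; dsimp only [Nat.mul_eq]; omega
    · rw [← m2 c ⟨_, hi⟩]; congr 1; dsimp only [Nat.mul_eq]; omega
  · rw [← m3 ⟨_, hi⟩ ⟨_, ht⟩]; congr 1; dsimp only [Nat.mul_eq]; omega

/-- The word `q` packs a permutation of the eight rows and a permutation of the five columns. -/
def isPerms (q : ℕ) : Bool :=
  and (Nat.beq (orRange 8 fun i => Nat.shiftLeft 1 (rowImage q i)) 255)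
    (Nat.beq (orRange 5 fun c => Nat.shiftLeft 1 (colImage q c)) 31)

theorem exists_perm (n : ℕ) (g : ℕ → ℕ)
    (h : (orRange n fun i => Nat.shiftLeft 1 (g i)) = 2 ^ n - 1) :
    ∃ σ : Equiv.Perm (Fin n), ∀ i, (σ i).1 = g i := by
  have hsh : ∀ a p, (Nat.shiftLeft 1 a).testBit p = true ↔ a = p := fun a p => by
    have e : Nat.shiftLeft 1 a = 2 ^ a := by
      rw [show Nat.shiftLeft 1 a = 1 <<< a from rfl, Nat.shiftLeft_eq, one_mul]
    rw [e, Nat.testBit_two_pow]; simp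
  have hlt : ∀ i : Fin n, g i < n := fun i => by
    have : (orRange n fun i => Nat.shiftLeft 1 (g i)).testBit (g i) = true :=
      (testBit_orRange _ _ _).2 ⟨i, i.2, (hsh _ _).2 rfl⟩
    rw [h, Nat.testBit_two_pow_sub_one] at this
    simpa using this
  let F : Fin n → Fin n := fun i => ⟨g i, hlt i⟩
  have hsurj : Function.Surjective F := fun k => by
    have : (orRange n fun i => Nat.shiftLeft 1 (g i)).testBit k = true := by
      rw [h, Nat.testBit_two_pow_sub_one]; simp
    obtain ⟨i, hi, h2⟩ := (testBit_orRange _ _ _).1 this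
    exact ⟨⟨i, hi⟩, Fin.ext ((hsh _ _).1 h2)⟩
  exact ⟨Equiv.ofBijective F ⟨Finite.injective_iff_surjective.2 hsurj, hsurj⟩, fun i => rfl⟩

/-- All bits of `a` are bits of `b`. -/
def isSub (a b : ℕ) : Bool := Nat.beq (Nat.land a b) a

theorem isSub_sound {a b p : ℕ} (h : isSub a b = true) (ha : a.testBit p = true) :
    b.testBit p = true := by
  have h1 : a &&& b = a := Nat.eq_of_beq_eq_true h
  rw [← h1, Nat.testBit_and, Bool.and_eq_true] at ha
  exact ha.2

/-- The state `(s, o)` contains the image of the state `S` under the permutations packed into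
`q`. -/
def contains (s o : ℕ) (S : ℕ × ℕ) (q : ℕ) : Bool :=
  and (isPerms q) (and (isSub (permuteWord q S.2) o) (isSub (permuteWord q S.1) s))

theorem contains_sound {E O : Fin 5 → Fin 8 → Fin 8 → Prop} {s o : ℕ} (hs : Holds E s)
    (ho : Holds O o) {S : ℕ × ℕ} {q : ℕ} (h : contains s o S q = true) :
    ∃ (σ : Equiv.Perm (Fin 8)) (τ : Equiv.Perm (Fin 5)),
      Holds (fun c i t => E (τ c) (σ i) (σ t)) S.1 ∧
      Holds (fun c i t => O (τ c) (σ i) (σ t)) S.2 := by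
  rw [contains, isPerms, Bool.and_eq_true, Bool.and_eq_true, Bool.and_eq_true] at h
  obtain ⟨⟨h1, h2⟩, h3, h4⟩ := h
  obtain ⟨σ, hσ⟩ := exists_perm 8 (rowImage q) (Nat.eq_of_beq_eq_true h1)
  obtain ⟨τ, hτ⟩ := exists_perm 5 (colImage q) (Nat.eq_of_beq_eq_true h2)
  refine ⟨σ, τ, fun c i t hb => hs _ _ _ ?_, fun c i t hb => ho _ _ _ ?_⟩
  · rw [hσ, hσ, hτ]; exact isSub_sound h4 (testBit_permuteWord q _ c i t hb)
  · rw [hσ, hσ, hτ]; exact isSub_sound h3 (testBit_permuteWord q _ c i t hb)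


/-! ### The search -/

/-- A state of the search: the packed equalities and orthogonalities that are assumed. -/
abbrev SearchState : Type := ℕ × ℕ

/-- Reads a reference (ten bits for the position in `L`, 39 bits for the permutations) from the
stream `n`, checks it, and continues with the rest of the stream. -/
def checkReference (s o : ℕ) (L : List SearchState) (n : ℕ) (k : ℕ → Bool) : Bool :=
  match L[Nat.mod n 1024]? with
  | none => false
  | some S =>
    and (force (Nat.mod (Nat.shiftRight n 10) 0x8000000000) fun q => contains s o S q)
      (force (Nat.shiftRight n 49) k)

/-- Disposes of the assumption that rows `r` and `t` are orthogonal in column `c`, in the state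
`(s, o)`. Unless it is contradictory at once, the next seven bits of the stream `n` say how: by a
cover of all rows by classes, by a reference to the list `known` of settled states, by a reference
to the list `acc` of pending states, or by adding the new state to `acc`. -/
def checkChild (small : Bool) (known : List SearchState) (s o c r t n : ℕ)
    (acc : List SearchState) (k : ℕ → List SearchState → Bool) : Bool :=
  bif bit s (Nat.add (Nat.add (Nat.mul 64 c) (Nat.mul 8 r)) t) then k n acc else
  force (mergeMask s o c r t) fun x => force (mergeMask s o c t r) fun y =>
  bif and small (or (atLeastThree x) (atLeastThree y)) then k n acc else
  force (mergeComb s o c r t) fun a => force (mergeComb s o c t r) fun b =>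
  force (mergeWord s a x b y) fun s' => force (mergeWord o a y b x) fun o' =>
  force (Nat.mod n 128) fun tok => force (Nat.shiftRight n 7) fun n' =>
  bif Nat.ble 120 tok then
    bif Nat.beq tok 125 then k n' ((s', o') :: acc) else
    bif Nat.beq tok 126 then checkReference s' o' known n' fun n' => k n' acc else
    checkReference s' o' acc n' fun n' => k n' acc
  else and (coveredBy s' (ordering tok) 255) (k n' acc)

/-- Branches on the column in which two rows, read from the stream, are orthogonal. -/
def checkNode (small : Bool) (known : List SearchState) (s o n : ℕ) (acc : List SearchState)
    (k : ℕ → List SearchState → Bool) : Bool :=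
  force (Nat.mod n 8) fun r => force (Nat.mod (Nat.shiftRight n 3) 8) fun t =>
  bif Nat.beq r t then false else
  checkChild small known s o 0 r t (Nat.shiftRight n 6) acc fun n acc =>
  checkChild small known s o 1 r t n acc fun n acc =>
  checkChild small known s o 2 r t n acc fun n acc =>
  checkChild small known s o 3 r t n acc fun n acc =>
  checkChild small known s o 4 r t n acc k

/-- Branches on all states of a level, collecting the states of the next level in `acc`. -/
def checkLevel (small : Bool) (known : List SearchState) (k : List SearchState → Bool) :
    List SearchState → ℕ → List SearchState → Bool
  | [], _, acc => k acc
  | S :: L, n, acc => checkNode small known S.1 S.2 n acc fun n acc =>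
      checkLevel small known k L n acc

/-- The breadth-first search from the states of a level, with one stream for each level, ends with
an empty level. -/
def checkSearch (small : Bool) (known : List SearchState) : List ℕ → List SearchState → Bool
  | [], L => L.isEmpty
  | n :: ns, L => checkLevel small known (checkSearch small known ns) L n []

/-- The packed relations of the state are relations of the pattern. -/
def Extends (E O : Fin 5 → Fin 8 → Fin 8 → Prop) (S : SearchState) : Prop :=
  Holds E S.1 ∧ Holds O S.2

/-- Every pattern that extends the state (and has no triple classes, when `small`) satisfies
`G`. -/
def Settled (G : (Fin 5 → Fin 8 → Fin 8 → Prop) → (Fin 5 → Fin 8 → Fin 8 → Prop) → Prop)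
    (small : Bool) (S : SearchState) : Prop :=
  ∀ E O, IsPattern E O → (small = true → NoTriple O) → Extends E O S → G E O

/-- The property `G` of patterns does not depend on the order of rows and columns. -/
def PermInvariant (G : (Fin 5 → Fin 8 → Fin 8 → Prop) → (Fin 5 → Fin 8 → Fin 8 → Prop) → Prop) :
    Prop :=
  ∀ E O (σ : Equiv.Perm (Fin 8)) (τ : Equiv.Perm (Fin 5)),
    G (fun c i t => E (τ c) (σ i) (σ t)) (fun c i t => O (τ c) (σ i) (σ t)) → G E O

variable {G : (Fin 5 → Fin 8 → Fin 8 → Prop) → (Fin 5 → Fin 8 → Fin 8 → Prop) → Prop}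

theorem Settled.of_contains (hG : PermInvariant G) {small : Bool} {S : SearchState}
    (hS : Settled G small S) {E O} (hp : IsPattern E O) (hsm : small = true → NoTriple O) {s o q : ℕ}
    (hE : Extends E O (s, o)) (h : contains s o S q = true) : G E O := by
  obtain ⟨σ, τ, h1, h2⟩ := contains_sound hE.1 hE.2 h
  exact hG E O σ τ (hS _ _ (hp.permute σ τ) (fun e => (hsm e).permute σ τ) ⟨h1, h2⟩)

theorem checkReference_sound (hG : PermInvariant G) {small : Bool} {s o n : ℕ}
    {L : List SearchState} {k : ℕ → Bool} (h : checkReference s o L n k = true) :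
    (∃ n', k n' = true) ∧ ((∀ S ∈ L, Settled G small S) → Settled G small (s, o)) := by
  rw [checkReference] at h
  split at h
  · exact absurd h (by simp)
  · next S hS =>
    rw [Bool.and_eq_true, force_eq, force_eq] at h
    exact ⟨⟨_, h.2⟩, fun hL E O hp hsm hE =>
      (hL S (List.mem_of_getElem? hS)).of_contains hG hp hsm hE h.1⟩

theorem checkChild_sound (hG : PermInvariant G) {small : Bool} {known : List SearchState}
    (hknown : ∀ S ∈ known, Settled G small S) {s o n : ℕ} {c : Fin 5} {r t : Fin 8}
    {acc : List SearchState} {k : ℕ → List SearchState → Bool}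
    (h : checkChild small known s o c r t n acc k = true) :
    ∃ n' acc', k n' acc' = true ∧ acc ⊆ acc' ∧ ((∀ S ∈ acc', Settled G small S) →
      ∀ E O, IsPattern E O → (small = true → NoTriple O) → Extends E O (s, o) → O c r t →
        G E O) := by
  simp only [checkChild, force_eq] at h
  have hthree : ∀ E O, IsPattern E O → NoTriple O → Extends E O (s, o) → ∀ r t, O c r t →
      atLeastThree (mergeMask s o c r t) = false := by
    intro E O hp hnt hE r t hrt
    by_contra hc
    obtain ⟨a, b, d, hab, hbd, ha, hb, hd⟩ :=
      atLeastThree_sound _ (mergeMask_lt _ _ _ _ _) (by simpa using hc)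
    have key := fun i hi => hp.orth_symm _ _ _ (orth_of_mergeMask hp hE.1 hE.2 hrt (i := i) hi)
    have := hnt c t a b d (key a ha) (key b hb) (key d hd)
    omega
  have hmerge : ∀ E O, IsPattern E O → Extends E O (s, o) → O c r t →
      Extends E O (mergeWord s (mergeComb s o c r t) (mergeMask s o c r t)
        (mergeComb s o c t r) (mergeMask s o c t r),
        mergeWord o (mergeComb s o c r t) (mergeMask s o c t r)
        (mergeComb s o c t r) (mergeMask s o c r t)) := fun E O hp hE hrt =>
    ⟨holds_merge_eq hp hE.1 hE.2 hrt, holds_merge_orth hp hE.1 hE.2 hrt⟩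
  generalize mergeWord s _ _ _ _ = s' at h hmerge
  generalize mergeWord o _ _ _ _ = o' at h hmerge
  have huse : Settled G small (s', o') → ∀ E O, IsPattern E O → (small = true → NoTriple O) →
      Extends E O (s, o) → O c r t → G E O := fun hS E O hp hsm hE hrt =>
    hS E O hp hsm (hmerge E O hp hE hrt)
  cases h1 : bit s (64 * c + 8 * r + t) with
  | true =>
    have h : k n acc = true := by
      rw [show (bit s (Nat.add (Nat.add (Nat.mul 64 c) (Nat.mul 8 r)) t)) = true from h1] at h
      exact h
    refine ⟨n, acc, h, List.Subset.refl _, fun _ E O hp _ hE hrt => ?_⟩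
    rw [bit_eq] at h1
    exact absurd hrt (hp.not_both _ _ _ (hE.1 _ _ _ h1))
  | false =>
  rw [show (bit s (Nat.add (Nat.add (Nat.mul 64 c) (Nat.mul 8 r)) t)) = false from h1,
    cond_false] at h
  cases h2 : small && (atLeastThree (mergeMask s o c r t) ||
      atLeastThree (mergeMask s o c t r)) with
  | true =>
    rw [h2, cond_true] at h
    refine ⟨n, acc, h, List.Subset.refl _, fun _ E O hp hsm hE hrt => ?_⟩
    rw [Bool.and_eq_true, Bool.or_eq_true] at h2
    obtain ⟨e, h3 | h3⟩ := h2
    · rw [hthree E O hp (hsm e) hE _ _ hrt] at h3; simp at h3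
    · rw [hthree E O hp (hsm e) hE _ _ (hp.orth_symm _ _ _ hrt)] at h3; simp at h3
  | false =>
  rw [h2, cond_false] at h
  generalize Nat.mod n 128 = tok at h
  generalize Nat.shiftRight n 7 = n' at h
  cases h3 : Nat.ble 120 tok with
  | false =>
    rw [h3, cond_false, Bool.and_eq_true] at h
    have h4 : tok < 120 := by
      by_contra hc
      rw [Nat.ble_eq_true_of_le (by omega)] at h3
      simp at h3
    refine ⟨n', acc, h.2, List.Subset.refl _, fun _ E O hp _ hE hrt => ?_⟩
    rw [not_coveredBy hp (hmerge E O hp hE hrt).1 h4] at h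
    simp at h
  | true =>
  rw [h3, cond_true] at h
  cases h4 : Nat.beq tok 125 with
  | true =>
    rw [h4, cond_true] at h
    exact ⟨n', _, h, List.subset_cons_self _ _, fun hacc => huse (hacc _ (by simp))⟩
  | false =>
  rw [h4, cond_false] at h
  cases h5 : Nat.beq tok 126 with
  | true =>
    rw [h5, cond_true] at h
    obtain ⟨⟨n'', hk⟩, h6⟩ := checkReference_sound hG (small := small) h
    exact ⟨n'', acc, hk, List.Subset.refl _, fun _ => huse (h6 hknown)⟩
  | false =>
    rw [h5, cond_false] at h
    obtain ⟨⟨n'', hk⟩, h6⟩ := checkReference_sound hG (small := small) h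
    exact ⟨n'', acc, hk, List.Subset.refl _, fun hacc => huse (h6 hacc)⟩

theorem checkNode_sound (hG : PermInvariant G) {small : Bool} {known : List SearchState}
    (hknown : ∀ S ∈ known, Settled G small S) {s o n : ℕ}
    {acc : List SearchState} {k : ℕ → List SearchState → Bool}
    (h : checkNode small known s o n acc k = true) :
    ∃ n' acc', k n' acc' = true ∧ acc ⊆ acc' ∧ ((∀ S ∈ acc', Settled G small S) →
      Settled G small (s, o)) := by
  simp only [checkNode, force_eq] at h
  obtain ⟨r, hr⟩ : ∃ r : Fin 8, Nat.mod n 8 = r := ⟨⟨_, Nat.mod_lt _ (by norm_num)⟩, rfl⟩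
  obtain ⟨t, ht⟩ : ∃ t : Fin 8, Nat.mod (Nat.shiftRight n 3) 8 = t :=
    ⟨⟨_, Nat.mod_lt _ (by norm_num)⟩, rfl⟩
  rw [hr, ht] at h
  cases h0 : Nat.beq r t with
  | true => rw [h0] at h; simp at h
  | false =>
  rw [h0, cond_false] at h
  have hne : r ≠ t := by
    rintro rfl
    rw [Nat.beq_refl] at h0
    simp at h0
  obtain ⟨_, a1, h, s1, p1⟩ := checkChild_sound hG hknown (c := 0) h
  obtain ⟨_, a2, h, s2, p2⟩ := checkChild_sound hG hknown (c := 1) h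
  obtain ⟨_, a3, h, s3, p3⟩ := checkChild_sound hG hknown (c := 2) h
  obtain ⟨_, a4, h, s4, p4⟩ := checkChild_sound hG hknown (c := 3) h
  obtain ⟨n', a5, h, s5, p5⟩ := checkChild_sound hG hknown (c := 4) h
  refine ⟨n', a5, h, fun S hS => s5 (s4 (s3 (s2 (s1 hS)))), fun ha E O hp hsm hE => ?_⟩
  obtain ⟨c, hc⟩ := hp.covers r t hne
  fin_cases c
  · exact p1 (fun S hS => ha S (s5 (s4 (s3 (s2 hS))))) E O hp hsm hE hc
  · exact p2 (fun S hS => ha S (s5 (s4 (s3 hS)))) E O hp hsm hE hc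
  · exact p3 (fun S hS => ha S (s5 (s4 hS))) E O hp hsm hE hc
  · exact p4 (fun S hS => ha S (s5 hS)) E O hp hsm hE hc
  · exact p5 ha E O hp hsm hE hc

theorem checkLevel_sound (hG : PermInvariant G) {small : Bool} {known : List SearchState}
    (hknown : ∀ S ∈ known, Settled G small S) {k : List SearchState → Bool} :
    ∀ (L : List SearchState) (n : ℕ) (acc : List SearchState),
      checkLevel small known k L n acc = true →
      ∃ acc', k acc' = true ∧ acc ⊆ acc' ∧ ((∀ S ∈ acc', Settled G small S) →
        ∀ S ∈ L, Settled G small S) := by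
  intro L
  induction L with
  | nil => exact fun n acc h => ⟨acc, h, List.Subset.refl _, by simp⟩
  | cons S L ih =>
    intro n acc h
    rw [checkLevel] at h
    obtain ⟨n', a1, h, s1, p1⟩ := checkNode_sound hG hknown h
    obtain ⟨a2, h, s2, p2⟩ := ih _ _ h
    refine ⟨a2, h, fun T hT => s2 (s1 hT), fun ha T hT => ?_⟩
    rcases List.mem_cons.1 hT with rfl | hT
    · exact p1 fun U hU => ha U (s2 hU)
    · exact p2 ha T hT

theorem checkSearch_sound (hG : PermInvariant G) {small : Bool} {known : List SearchState}
    (hknown : ∀ S ∈ known, Settled G small S) :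
    ∀ (ns : List ℕ) (L : List SearchState), checkSearch small known ns L = true →
      ∀ S ∈ L, Settled G small S := by
  intro ns
  induction ns with
  | nil =>
    intro L h
    rw [checkSearch, List.isEmpty_iff] at h
    simp [h]
  | cons n ns ih =>
    intro L h
    obtain ⟨a, h, _, p⟩ := checkLevel_sound hG hknown L n [] h
    exact p (ih a h)

/-- All positions of a column and two rows. -/
def cellTriples : List (ℕ × ℕ × ℕ) :=
  (List.range 5).flatMap fun c => (List.range 8).flatMap fun i =>
    (List.range i).map fun t => (c, i, t)

/-- Every orthogonality that may be added to the state `(s, o)` is contradictory or leads to one of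
the settled states `known`. -/
def checkMaximal (known : List SearchState) (s o : ℕ) (k : ℕ → Bool) :
    List (ℕ × ℕ × ℕ) → ℕ → Bool
  | [], n => k n
  | (c, i, t) :: l, n =>
    bif bit o (Nat.add (Nat.add (Nat.mul 64 c) (Nat.mul 8 i)) t) then
      checkMaximal known s o k l n
    else checkChild false known s o c i t n [] fun n acc =>
      and acc.isEmpty (checkMaximal known s o k l n)

/-- Settles the states of a list in turn. -/
def checkComplete (triples : List (ℕ × ℕ × ℕ)) : List SearchState → List SearchState → ℕ → Bool
  | [], _, _ => true
  | S :: L, known, n =>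
    checkMaximal known S.1 S.2 (fun n => checkComplete triples L (S :: known) n) triples n

theorem checkMaximal_sound (hG : PermInvariant G) {known : List SearchState}
    (hknown : ∀ S ∈ known, Settled G false S) {s o : ℕ} {k : ℕ → Bool} :
    ∀ (l : List (ℕ × ℕ × ℕ)), (∀ q ∈ l, q.1 < 5 ∧ q.2.1 < 8 ∧ q.2.2 < 8) → ∀ (n : ℕ),
      checkMaximal known s o k l n = true →
      (∃ n', k n' = true) ∧ ∀ E O, IsPattern E O → Extends E O (s, o) →
        G E O ∨ ∀ (c : Fin 5) (i t : Fin 8), (c.1, i.1, t.1) ∈ l → O c i t →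
          o.testBit (64 * c + 8 * i + t) = true := by
  intro l
  induction l with
  | nil => exact fun _ n h => ⟨⟨n, h⟩, fun E O _ _ => Or.inr (by simp)⟩
  | cons q l ih =>
    obtain ⟨c, i, t⟩ := q
    intro hl n h
    obtain ⟨hc, hi, ht⟩ := hl (c, i, t) (by simp)
    replace ih := ih fun q hq => hl q (List.mem_cons_of_mem _ hq)
    rw [checkMaximal, bit_eq] at h
    cases hb : o.testBit (64 * c + 8 * i + t) with
    | true =>
      rw [show Nat.testBit o (Nat.add (Nat.add (Nat.mul 64 c) (Nat.mul 8 i)) t) = true from hb,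
        cond_true] at h
      obtain ⟨h1, h2⟩ := ih _ h
      refine ⟨h1, fun E O hp hE => (h2 E O hp hE).imp_right fun h3 c' i' t' hm hO => ?_⟩
      rcases List.mem_cons.1 hm with hm | hm
      · simp only [Prod.mk.injEq] at hm
        obtain ⟨rfl, rfl, rfl⟩ := hm
        exact hb
      · exact h3 _ _ _ hm hO
    | false =>
      rw [show Nat.testBit o (Nat.add (Nat.add (Nat.mul 64 c) (Nat.mul 8 i)) t) = false from hb,
        cond_false] at h
      obtain ⟨n', acc, h, _, h4⟩ := checkChild_sound hG hknown (c := ⟨c, hc⟩) (r := ⟨i, hi⟩)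
        (t := ⟨t, ht⟩) h
      rw [Bool.and_eq_true, List.isEmpty_iff] at h
      obtain ⟨rfl, h⟩ := h
      obtain ⟨h1, h2⟩ := ih _ h
      refine ⟨h1, fun E O hp hE => ?_⟩
      by_cases hO : O ⟨c, hc⟩ ⟨i, hi⟩ ⟨t, ht⟩
      · exact Or.inl (h4 (by simp) E O hp (by simp) hE hO)
      · refine (h2 E O hp hE).imp_right fun h3 c' i' t' hm hO' => ?_
        rcases List.mem_cons.1 hm with hm | hm
        · simp only [Prod.mk.injEq] at hm
          obtain ⟨rfl, rfl, rfl⟩ := hm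
          exact absurd hO' hO
        · exact h3 _ _ _ hm hO'

/-- Every pattern extending one of the states has a further orthogonality, and then contains a state
settled before, or has no orthogonalities beyond those of the state; `G` is assumed in this second
case. -/
theorem checkComplete_sound (hG : PermInvariant G) {triples : List (ℕ × ℕ × ℕ)}
    (ht : ∀ q ∈ triples, q.1 < 5 ∧ q.2.1 < 8 ∧ q.2.2 < 8) :
    ∀ (L known : List SearchState) (n : ℕ), checkComplete triples L known n = true →
      (∀ S ∈ known, Settled G false S) →
      (∀ S ∈ L, ∀ E O, IsPattern E O → Extends E O S →
        (∀ (c : Fin 5) (i t : Fin 8), (c.1, i.1, t.1) ∈ triples → O c i t →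
          S.2.testBit (64 * c + 8 * i + t) = true) → G E O) →
      ∀ S ∈ L, Settled G false S := by
  intro L
  induction L with
  | nil => simp
  | cons S L ih =>
    intro known n h hknown hL
    rw [checkComplete] at h
    obtain ⟨⟨n', h⟩, h2⟩ := checkMaximal_sound hG hknown triples ht n h
    have hS : Settled G false S := fun E O hp _ hE =>
      (h2 E O hp hE).elim id (hL S (by simp) E O hp hE)
    intro T hT
    rcases List.mem_cons.1 hT with rfl | hT
    · exact hS
    · refine ih (S :: known) n' h ?_ (fun U hU => hL U (List.mem_cons_of_mem _ hU)) T hT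
      intro U hU
      rcases List.mem_cons.1 hU with rfl | hU
      · exact hS
      · exact hknown U hU


/-! ### The listed matrices as states -/

/-- The thirty-two matrices, each as a numeral with forty hexadecimal digits. -/
def listedNames : List ℕ :=
  [0x1111111233233552347734542346244278642868,
    0x1111111323235352365734274344824274842866,
    0x1111112333235552377634247344284186242684,
    0x1111112333235552477733426342484186242684,
    0x1111112333235552477733264344824182642648,
    0x1111112333235552477733426348424126842684,
    0x1111112333234552427734428332464216441382,
    0x1111112233233552447734324334424216841286,
    0x1111112233233552447734324334424218641268,
    0x1111113233243552247734428323644124643182,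
    0x1111112333235552367734524346424128642468,
    0x1111112333235552427733264344824162842146,
    0x1111112333235552427733246344824162842164,
    0x1111112233235552437733624344424128642168,
    0x1111112333235552367734542346244128642468,
    0x1111112233235552437733642344244128642168,
    0x1111112333213332255533264344264342644642,
    0x1111113233245552236731246331284446242654,
    0x1111113253145252533733142346283621442466,
    0x1111112533152452335734234324463116246628,
    0x1111113522142552533333214344623612142646,
    0x1111112333233512516336542346244642544246,
    0x1111113253253352655736562326444326644428,
    0x1111113523253352355636652324644662744248,
    0x1111113552253332355436265326464626744428,
    0x1111113552253322355136625324664662344244,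
    0x1111113233255552637735624364424426842186,
    0x1111113233255552637735624364424428642168,
    0x1111113323255552623735264364424412642618,
    0x1111115532162532351524337352463642442668,
    0x1111135321535525136266525244366321342644,
    0x1111132111552536325364525426345634221466]

/-- The name in row `i` and column `c` of the matrix with the digits of `N`. -/
def digit (N i c : ℕ) : ℕ :=
  Nat.land (Nat.shiftRight N (Nat.mul 4 (Nat.sub 39 (Nat.add (Nat.mul 5 i) c)))) 15

/-- Orthogonality of names: one is odd and the other its successor. -/
def orthNames (a b : ℕ) : Bool := Nat.beq (Nat.xor (Nat.pred a) (Nat.pred b)) 1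

/-- Packs a relation into a word. -/
def packWord (f : ℕ → ℕ → ℕ → Bool) : ℕ :=
  orRange 5 fun c => orRange 8 fun i => orRange 8 fun t =>
    bif f c i t then Nat.shiftLeft 1 (Nat.add (Nat.add (Nat.mul 64 c) (Nat.mul 8 i)) t) else 0

/-- The packed relation of equal names. -/
def eqWord (N : ℕ) : ℕ := packWord fun c i t => Nat.beq (digit N i c) (digit N t c)

/-- The packed relation of orthogonal names. -/
def orthWord (N : ℕ) : ℕ := packWord fun c i t => orthNames (digit N i c) (digit N t c)

/-- The states of a list of matrices, evaluated before `k` is unfolded. -/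
def forceStates : List ℕ → (List SearchState → Bool) → Bool
  | [], k => k []
  | N :: l, k => force (eqWord N) fun s => force (orthWord N) fun o =>
      forceStates l fun L => k ((s, o) :: L)

theorem forceStates_eq (l : List ℕ) (k : List SearchState → Bool) :
    forceStates l k = k (l.map fun N => (eqWord N, orthWord N)) := by
  induction l generalizing k with
  | nil => rfl
  | cons N l ih => simp only [forceStates, force_eq, ih, List.map_cons]

/-- The numbers of the matrices, those with more orthogonal pairs of entries first, so that a
matrix is settled before those whose pattern it properly contains. -/
def closureOrder : List ℕ :=
  [6, 7, 8, 9, 16, 17, 10, 11, 12, 13, 14, 15, 20, 25, 28, 0, 1, 2, 3, 4, 5, 18, 19, 21, 22, 23, 24,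
    26, 27, 29, 30, 31]

/-- The matrices in the order in which they are settled. -/
def orderedNames : List ℕ := closureOrder.map fun k => listedNames.getD k 0

/-! ### The certificate of the search -/

/-- For each matrix, in the order of `closureOrder`, and each pair of rows not orthogonal in a
column, the token that tells `checkChild` what becomes of this additional orthogonality. -/
def closureStream : ℕ :=
  0x10204081020f08000040000204081078f1e3c183000c18a060c50a140c18a140c18000000020408102040810204081000000000000000002040810a3316639a027e000400102000010214662cc73404fc040800200a8c4791e2809f80000000081000408100040010004015188f23c5013f0908102040810484081022850a54a952a1408060c183100c00a100c188062800a00005050008116005819606081030000280000028000045801628080020000a002c50b022c0011600000000000300041810200001000c003001140912104df134408313457805010484be01783020c188022009400040001000a03280ca030650380020010002000850a081070a1c0020008000020c0800200001000000000040000604000000000000000000000000000070e6a11bd8d0206fe845913508fa54c8037f11840830f4418016040073508dec681037f0e22d423e953200dfc3c644c8de54c1037f020c0000a8991f58d1006fe0c142820a00785003c60a8991f58d1006fe8991bca98206fe040828004001000a021686f6264011f8c686f6264015f810531a1bd8990057e00021686f6264011f828200022647d6344011f8005001546459b82d015f8005001546459b82d015f8285000028500022647d6344011f8000000000000000000000000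000070e51081061e461164a3d28600581001c447a81c3c60a1a18285180830000082801e1400f182868c040828004001000a00c686f2b44011f8c686f6344013f810531a1bd8d1004fe0000c686f2b44011f828200014647d2a64011f8005001546459f02d013f8005001546459f02d013f8285000028500014647d2a64011f80000000000000000000000000002264260ef2819f848920248098990983bca067e20248091ea07a8503d40f8991f58d10067e00022647d6344019f84081000400140000a0000400002840a1020005001c3820014105001c28504142800a000050014086000408000180060204005001400000000000000000000000000000003a2449012404902024e891e3e80f50207d0103d40f1028408100c514280c40a2828a0a1450503101c607041c1050a082850a1c2820a1c28c0e140050218401020040600180810014005100000000000000000000000000000004a712b099d1f3163c0c3c9bc0074300129c48f983c4081018006140030a00000000c2840a1020305000030200000020000005000028000083000a143070e1830500000000e18006001400000000000000000000000000000001224490124049012244891e00000003c78f1e28500060c50a140c50a140c003060c5001428305000c185000c18000000050a142860c183030600d0006006050600d0000302830a3001a00000000000000000000000000000810200282942c7d2b28013f942c308fb3013f853d02a00067a50301081022850b1f4aca004fe50b0c23ecc04fe060418f020c3000c0078006180800c0c18104081010408001040408100001000404102000408202000020208000040800100080010000000000000000000000000000081021e16187b7142c0c13c282850c0420f8210237060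418f020c30502143030a3c306061418102080810204181060c08306041820204183020408202041000400100020808004040810004081020000002000000200000123c4c10e00790490522848180240e188091e2540f10222647d6344017f83050b13213077940bfc2c30000282801e1400f10222647d6344017fa264260ef2817f858a0c1c00828502801450d05102050828683850a0030000000000000000000000000000000000000000000000000000000000123c4c23a74828841c30f3a1801d0e004891ea080f8991f58d1004fe10202801e28585003e26459b82d013f83050a18000899166e0b404fe102840b8991f58d1004fe0c1c008285028610205001050e0a28703050c1c000000000000000000000000000000000000000000000000000000000006a11f58d10037e1224e87003c8240c01a8459f10d00df971d48b83866a1167c434037e123c4906a11f58d10037e10214647d6344015f83050aa3237953040afc2c30000282801e1400f10214647d6344015f94646f2a60815f858a0ce223e953200afc004142815c446f6340815f840814005143820a1c0ce2237b1a040afc1403888fa54c802bf00000000000000000000000000000000000000000000000000000000001c74e890e011a4201803508fa568801bf3508fac68802bf1d48d423eb1a200afcd423e95a2006fc751870c2480e10344030e1858c06000190c0050700284081a305990c1c600285068600000190050280281430d0c1c6190000000000000000000000000000000000000000000000000000000094387046cd889108a142350d80286c02511223872390d5a831a35a3406000356864cb56864cc81a3400018324481a3468d912060c3200a0500502942800019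00000810000081020408100000000000000000000000000000000000943870450a089108e5ca350e4028720250e1c448a39034683000060c0650a192800514002a40c183469968d24481831a34912060cab54c99ab54c990000000000008100000810204081000000000000000000000000000000000001c3c7422e89192840c58f442c017060070e1e4918f0a0018006002803c181850c0001e0a0c0000d1943e9486808fc000120c1400000009050c143058ca1f4a434047e00003000a002da0014005b4142800014280001800000000000000000000000000019507d282d011f848912244896541f4a0b4047e12244891e3c78f1e3c78f1020400000c5000600500000018010284081400280041c1000a080050a1c28200000050014005021800102000060018081001400500000000000000000000000000000000204086420414142051410c85141050508101830618183020c0810c04083020c1830204102040410202041010204081040410104080810208081040810204080820208101020400102040800000080000008000004891d08b1d22421020c3cb0200743001224711203c40d041800014303050a282801e1400f10305021a2828004001000a023446f2b44013f84020a200008d11bcad1004fe0a080000000000000000000000000000000000000000000000000000000000012247043a54890081c0a33a1c01502004891c448231034083000058c061c3010c00507002840c160468118003800e0800600181070c000070c0000c0000000000000000000000000000000000000000000000000000000012384c22c74811840830f3a1801604004891c4480f1020106000050b0c142820a00785003c40a16201020a0010004002808d11bd8990037e100828800023446f626400df828200000000000000000000000000000000000000000000000000000000000048f12581001e41216488d2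0600901062024789463c588041800014302801e283050a1400f1028502163010100023287d6260809f80002808000280410104063287d6260809f800000000000000000000000000000000000000000000000000000000000128c4c20418791845920f481801604004911e2518f1820105003c50b0a007950c142860000a88140858c04040007111bcad10037e0000a020000a0104041017111bcad10037e00000000000000000000000000000000000000000000000000000000000048e1210e952044207028ca8100743801224711208c408020c000182c1870c54380141800a103058802546000e003820018006041c300001c300003000000000000000000000000000000000000000000000000000000000489265c08624401800c3de1706f00801e24913202418602000010c0c50006240861218181002830100280010a005000a00005021828002000000000000000000000000000000000000000000000000000000000048912100001e3c7841e3c7841e0078f1224488102000314001831400183000000810284080a1400204200020a0010510142850a000000000000000000000000000000000000000000000000000000000000012244810c00890480830f2c080242c0480f124448910200860a145020a007820c00005003c408022810200000000000000000000000000000000000000000000000000000000000000000000000000000000000012247422a08790840438f041c015020048e124078f10280860a145820c0000100147800a3c40b04280810000000000000000000000000000000000000000000000000000000000000000000000000000000000001224742021c890845410f041c0150200490223848f103410600005010c1428100147800a3c40d04280810000000000000000000000000000000000000000000000000000000000000000000000000000000000001c244820e007902a040235c043ae2a09190123c48e103410600005010c1428100147800a3c40d0428081000000000000000000000000000000000000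000000000000000000000000000000000000000000000000

/-- The branchings of the search from a triple class, one numeral for each level. It lists, lowest
bits first, the two rows to branch on for each state of the level and a token for each of the five
columns, as read by `checkNode` and `checkChild`. -/
def tripleStreams : List ℕ :=
  [0x68c1f58d10007f88b1f58d10007f8ca1f58d10007ffa6a0,
    0x3508fac688003fc4c8fac688003ffd401a8,
    0x1c447d6344001ffe9a36070,
    0x1f4e1b34038,
    0xd18359da2000ff1163d99a2000ff1943e95a2000fff51,
    0x3508d7c688003fc4c8f74688003ffdfbf61,
    0x7111bd8d10007ffb8ae06b1a846be344001fe2647ba344001ffefd89c446f6344001ffee2b9f6c,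
    0x7111bd8d10007ffa73e9aa751caff7efae2237b1a2000fff715c0d63888dec688003ffd3973ed558e7dac03c,
    0x7d3e6eb81d1c446f6344001ffee2b86acfa7cd57fb95639f6b00f2b1cfb5bef982c7d37f7e7111bd8d10007ffbf7eb3f4f9afbf71,
    0x3e9c37f7ef3f4e1b35f793a70dfdfbcfd0814002c7e840a001e3f7e9b35f79fbf4e7dfb4d6386907df3efd35f7ee382c1afbf7efa7cdd703a7d066eb05e8e9c375bef5a8e57fa03d6a11af8d10007f8991bd0d18007ffbf59,
    0xd4235f1a2000ff13237a1a3000fff5a7111770d18007ffbf7efdc7e9fac680ea8ccfdfad182df7eb4d4235f1a2000fea322fd1a2000fff7eb20befdfa07afbf4d7dfb8fd3ff6b86d03fd3604373f4e1b201b93bf4dfd0dcfd3e6cd7dd7e9fac680eb58e7d41f7cfa70dfd03c9dfa6fe81e7e8a0a00063f441a100f13a28280fb883fa0808ae417d04042f3f7efdfacfdb3f6bfdd3e9428019fa5040067e8a00659fa54a8167efdfbf59,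
    0x91f695633e0fb1f7e80fb57daff4a7b82c7dfa03ec163efd01f00fbf4cb4a3ed7fa03dd5f6bfd01eeafb5fefdf705837f7efca68c2fbf75ab66ad7fba6afb5fe86f6859335fee9f47fd1e3ea7c082d7fba3888dec688003ffdfa0c345abed7fa17d7f650d7fba41b216bfdd127d346806290e1afa031fa04d150189d3e6be80c7e84346c063f417dfbf6b5c7fed7fba7dfa73e81a571f375fee893e9c340294870e7d0148917f4633f4e1c36029c034dfd01f2e3f5be86d7e9f3668d69f57fdfbf73fa7ce7d014a4fa73e80a7e95a268055f7e82fa0297c0befd03db508d7c688003fa8c8bf4688003ffd6971fadf7eebf6cb5006b41f63efd01f48b2d407dd354eaff437bf7e9aae0b27111770d18007ffaacb34b8fd6fbf75fbf43210d4fd39f7efde5c445dc346001ffefdfa5b3,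
    0xb8fd641f75711177099801ff8d11f5899001fffa5b2fbf7efd2d97d1400280a7e813e18353f4107401e93a7fefdfb4fd1a1c305e477d0e682f276c1afbf7ed470e06fbeae3f5be86d7e8336802f447ee768d281558d7dd7eca7408b59f67d6021b5fb6410835a1194e817db0ed835f7efda8e1c35f7d5c586fdfbafd2df4d00ac08102079fa60d070188138540f290c1afa03148a7e9a0191dfa6837274e7d0dcfd401013274e7d0dcfd2a080818be8166040541fe9b0e1bb486c3fd371aa3f58d06d4ed8fa6807df4f86341b5c023efdfbf183c00180a7e9ffb5fee9f4086aff74fbf4d7d358fdfa6cd73f7efdfa6bb3bf4dfd35cd639f507958e0241f7c05f458203dfd02cc3540be830407b4a7eb1afba82fa6c0f314a0800cfd0330086aeb1cfa83ef8a7e9020cfdad5beeaafefdadf7c040fe8201dbe340ab7df1c446f6344001ffe9c35556fbf6b7df15052d582f9a8911fa1bd5df5ba30d16afb5fe81f540aac6beeb58d7dac03c55f4b5601e29fb5fefdf7efdfa69ee50be9b0df7cfabbe86fb9fdfa040b3f40950206b526be81fbe60b1f4001f940861f405782c7d01f7e502187d115fd1e14000abe946414045f6b5602075fb64dd703a7d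ad58d04d7ed9375c269f6b56161b52853e9515d7dad58086d7ed9055c0e8d0b57fa67d,
    0xfb5ab1a0da9dfa16b00f1759fa680e940a03adf7c5d67ed735a2eac6fe84d5759fa68268a6b1bfa0755367e8103a0f15f4000a87fd0014044f0a7dac03cfac6b0101abcfa69000f1e7da0800475be9a4003cfbf400501182fa5fef5f6b5635aa318b3e4c8003fa318b3e4c8007ffdfad7d963c780a949a02040eb0be9b0c03c52543067bafd5bf7e80c971aaff7efa76c7d35f7e78f3ebe7b9bc79f5f3dcfe801400055f40830206bfa041fd035e9ad5beebf6c9b105f4c163e8001f7dad58d6aaca7dac03cfb67ed7fba60b1f4d81f9e00fa001e5f4e7dfa2bacf58288fbafd380be8ae8103fbf40763ec050003efa2800501182fa5fefdebe83060c0c41457d0a03351f7efd0194639f4529f3efdfb5c045f4dd635f75982c315fbabd05f4101efefdfa09045f530304ca92bf409a8be8bac040ebf62647ba328049fc37d0117dfa68380c527d346836290e1afa1b105f42820bd7d386c305e7e9cfbf40d7f4f9a001b1fa70d1b0d89dfa14006c7efdfbf4d67f4e1bfa6b9fa73efda487dfa0592147e8167efdfa000458069bfbf7e5c7e0fd51a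bd03f4081ea107fa1c3770c3fdfa1bbfbf43490117dfbf7e808beb96800dc5f4d87fa6e35257e813512903f4080a94fd204190870806e667dfa0594bf7e8265e952bf4056bfe810eca5fa04b33f421503ca405f4d00cd51c19f42faa8e0c35f7d3b60d1afbf7d1e14000c751c386fefa3beb40267c5d3c17d0daaeb3f409ad077d68042f93ec7d0003e0834da00bd0e19f7eb476c1a0203e3b60d067111770d1800fffbe94381c053a8e1c0ff7d7111770d18007ffbf7eb4b8f85fbf755c7eb7d03abe0887e82cde18fa700e4f88fd360b27a40d7d039ea3873e86f7e8038003d7f4656421ab7813e9b038bc79f4d96c571f3883eea76c1a35f7e,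
    0x7d32c9000a4ed8346befcb8fbafbf755c50c7dfba8e1a68d05ec48d360407676c1a0007e35f4f9b0d59bfa69007a807d367c0740be833417bd470e0101e9db017e85f968d386befae222ee1a3000fff7e96ccd7d0c84355f4d56fa1abfbf4d9b01d80fa00300e550c6a03ee8a027d0e071adf428535e11695be8cd4e83ae6fefaa019a35f7d54d2b7d0da85fbf4d00e527d8c800520be82020792234d1a05f111a68d85fbefd05f405274a82fa029025cd01e409734079fa04a9b019fd3f58080d5f820e6bee823e880dd7d285809a8bed821f4376f7e8102d1020180e5f5cb4006e25c1cd7d015aa9bf4d00a88969c300464160824023fa73e950dd10fa408808c31cfa543750be861a02387f441a015c20c18306ebe880e1d9fa04d80c9f07faf9f66180fd0207afa1be86fb9901000033f450a3c0235df7e80a8851fa023fa01b800157d14280808878ffbf406403e9b01c8f386fe8fe478ffa6c06474a0501f69468fe99cbe87381c3d32c07d3590f97f47e41050304cfd3e6ebfdd0e9c3604d73f4e1b026b9fa7cd450d8fd386fe9ae4e850bf4363f411bae534fa7cdd7fba29fa40833f7efd1e03a50a3efd01966fb5c06293efdfa0325c08157fba102018080c92fd341c062a8b02646e35c54139351fd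041ebfdd3e8304099fa07e94fba2ffa00032b839b0ff74fa541ab011fd2a54b008d77dfa6bed42be8a03d0515f4280cc28a65f40675beaaac03cd5f6b9a01eaefa0c1d5f42822c0637ea7e9a0397d060818188780fa15afa09f9a0118f3e17e80fbe900a041e40cf85100f2fa0cb828fe820f5c0e8a0a56100b53a5be9aabe9a3402aadf4d0f1fe0fad5beeb5be9bac17c1e7fefd5191455f4a00c8ed8fa6c0fdf6c9bafa1d0617e81fb5172c680fbf41ab0206a5257e8165495fa0591ff4501011047ef8d7df823f7c6befdabed734a7d7af5f3e7b9fd32040b3f4d0635f757a00001019a32a000b3f4abc02c860c6fe94ed77d1e040c540c7d000327a04cfd0198f4df4d8ffb00335f40fce410102cfd06040b23fe8102cfd899034ad1e007ffbf5a8823ed601e00fbf7ef6ba2fd1203479f43a00d1a80003e808d41415f404677ed737f7dd5f4d1afbe9dfb5cdfdf757d346befa76c163603e1e282fd01f56fa6cd80f175637f436aa86fdae5b4,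
    0x1c3061b01f2806680fdf4e83ae03efbf4e56340353bf4d56f0e9a355bef95be8532023ac68d9bfbe1dfa6ab7874a9aacca805f133821ffe3dfa14c808e1153619a306b3a6403fffc1e005000158f0014000ac40835f7b79f4da001e3c1143e808c1020a03ef41428501f7ac020d7d03f3cfb400008fefd0068055f4e1baff741e03e8569e0afa15afa5008167e8f4a6c0e5f4a95360632df4d81e8e9cfa07a505038001e8ffa140808be830a04045f4d290ccfd963c780abed1faf59d5f6b9a53eeafaf8d29f4e9cfa03a53f7e818df8357f40d4f40fd36073502ab1afba9d899034ad1e007f0a800795be994003cfa0c1160318f01f4035f637d519fd1a15a858c79ffa3c065f6b1b35f753a00dfd01d031868402c9715820416abbe832e06b502eb01fba80fa28000e9703fa04056a3e83000225c70182a90012df7b7df4103031152bf7e85eab14fb5807874d575207dfa1631b0318ffa68000afe9c1828fc5f44080eca4fa6806490ffd0192efa54afdafe9ffb5f41ff5b9a0f53c0e53e80ade00fa00064b8d05326a35347e8167ecc7042afa3cd000188f70091a08c20403c850a039fbf40630be869cd2909f4063f419b0207923f442d6546451f4066a078210032fa47e8f01d803814073f409bae2f487f447d015fd50b17cc990007f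fbf59fa7017d059452814033f409a2a0713a7cd7d0d89d386e61ae4e810df40e2f00060003b7cf9f7d0d9fd6e70dfda48fd3203ed21fe87346b9fa78d050110f1ff7e80cbea00041998047810d58f1ff4d00c87cb0e8c06647ea346cae282be80a971efa040444691202022202000067e942864056b8a0a3c02bfa0c18267e9f0a0406a37e8565e8105f40641040735f7e49f41870117dcaccd00abe88340235df7efd0157d0c186808d77dfbf4055f4aac1a0230df437d0dc910ecd000afe87361fee8aa6fd3402a020417d031fd281c01b8be94042cfc4bbeb13602a522c301fbafd3e84d7dd5428fa0416477e812c07b13f4280018fd38090208be952a079fa6cb33f4e3f400290a73e9a01cfd1e08380c7e9c0a00052d0b573467d49f7103fb624fa681d5b0716ae6837bf7efdfb183fa08180e640d6804cf86ca14fa02bfa74d80e7e87381c053f509a0c17b487febdcfe850e182f46fe9c0e1abfa32b210d59db01433888bb868c003ffcb469c37f7d5c2ab02fbaae3c03efdd7efd0ff5a3b60d10fbf6a3803e80f751c0007efba8e1cfb93dd470e1afbefd32c9000a48a3fa031,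
    0x13f461a01c9a2818380acebf346b2fc75f9a3793e3a0c28103f1d0614000fbe9c20180f7f46870267a282039a29d2afa0be87af51701f42fba8b800df7dd40ce7d01efd0cdd080a870d34682f7f40070c03b7111770d18007ffbf55e638e1a3417b3bf4dfdcc397109bd4c814bf8801c8985a1e6a99040ff0a00052f00003403bfa3428c67e9c000c0592069b00334920cd8893a2d39881fdb2b0336064f803e85020399a5a57d8d20ffa6c06247e8000029fa099020152409f4d80c4efd7a07959f409665716fa02a08280856521c045bec694103fa02b0400380efefd5602afa01b80015141050074a407d3602a5001800015390e3001ad21fd0c05afa6eb070fa90704439b8be810204053f419c0e0290df43100dc87fa08080e487d0c40374401c4c89c565608bf810dd51fa546b2f817d04d06fa6ca86e830371102cecac1b7f021ba4800381fb9900c6c329cd203fa02a0e07e8103d7d0a04100ae10efa04164a0728020f20d33e9001d37fa0003290006fa0325053e806838c0ff40663c00ffa0331e04e7da47800e64067f460032c8f3268048a88cdfa683d5f46080ecfd3800002e48fd101d913f48901fcfd7ff4d331440800ca8102003330e7d02cfd0468162901407c06afbf7e800117dfbf440088a704bba64003fca704bba64001ffefd6a1060c1837540a140202a8df501b0d97d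082c072f07c101cfdfa1f48088e88000390833e96656811060066384021603a5204418019a9ca21500cc07d01cae2bf410089400fa00064f3e9b01d070003b1e087cc0f5ad0bf4306ad71fac687eb0c4080eca401f4b00cce9c366c0f4742023607a4997e80c8808fa6c065f4a1900d7dfa1403494f823403e5257e816921f37f41e5f4d03015250208001fbe9a0602a503fe816be833748056f4102042bb0a0817d0bdfd1600001d15c006540d6a091baff74d5f6b9a03e8f1a3fea8c87fd82f1a1f1a0fd6bec1aaa337df41190317dfbf40563fe829c0227a54d81fbda9fa5c0c6abeab04d0f05f40818920037f4065f5f9a786ab3a6bebd51e4efa185868897d3440344bbe8502062fa3c79b0193e0614c808d4050a580463cf9bfa032fa0ca010312e2a6c056a3e952c063fa0c9000157d28040008947d0200044a5fd02c0235158d9afbafd283eb808947d295c044a047d0002bfa1cd87fba3c1017e808de08a068046a147d4002bfa3be80cb00835f40fdf40050c022fa07efd01d8059f4000ebe800a6004401605fa03a01002fd01d2bb3f4a80d3e830b5404403e852a03a,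
    0x1000be80ed704fa0c055f4185320230214c80eca853203b5c13e840157d066c200a8cd43203a831322715a3841fe14074f204101d29fb40000abe87361fee9f651b0007a78216b50d1fd621c0fdd54280e14057f408202022506eb00fbafd4cc174e9902f7f68c135099e2f7f3397dac6cd7dd479f5a3f278fe8160118307f4074b800afa02a0072b0fd54b03405e78b8e050a02a1e52b0fd542b0cd0346a41832e063fa4891a21503386c0f4468917aca8a1f5eb3f4a000a023087010215d84065810aec782fa040c4a7ec102d7d06ac500a9b812a04054dc2032a02a1e3fe8f0152e07f405600f80fa02b1e7be8f1f58f01f4a0fac780fa01a1e0c1fd015a8fa0be80cbee45a023560c10201eae040be808c07d0404074a0a8c02d6f6057fc005015a50417e81f8295fa17b487c29a0390f2810000ac7d052000561547d0153d10bbeb42729b3603a3a00dfd01da90607eb3f4e0a0202207f4d80e87903468064a3e8a01528080c380cbe87321da87f5687694048ca1f4a990207f100321423e8ae927dfa6c047f7efd0d97dfa00081abefd0206a1ff7e810357dfa00081abefd0206a51f7e810351d046c005e571cfa0232057e830111071f47808beb71e408d5f4407020398a28007644fd000007248a02701ebfa2838c01100fa03a7803e8001dfdfbf4d00ed2280c6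c06508306020335c50a19011befa146808d414000406aa7e83015292a07e81efe950208046040fd0402a2023e80ac27d0404075f46860c1b9fa20400afe83061d9a234afd6610685f43760408b8602bfbf4d8767eb51801979f52306a80101f4056ac17d340b223f73870dd7d4a1c002cd48b035c0e8a41d634d1d1408a00c520405f40626a57d0a02a228fe800197d04c8000a8d4afa00054741820203cbff4c808d19c362341e7028001a2e3e0c47dd0095fa080d468ffd141aa5c7c2a6fbaa21a73efdf571f0083eea03e803403a080c280fbf7d0014000abe800a040d447e910e0b3fa7038101d7dfa14d82cd49c39f4afbf4a1c0e02a,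
    0x68a0a0e02b05f4181e818d2003b23f40200f5840017e81cc21c0203b305cd1bfbf182e68d7df940ffa0806490e7d0c0323b6039a29f2e3e17ecbd7e800acc35676c1a6667efa2860b0bd3d0608080eab1cfa2c07874b9a17e49fa14300c87fd0065a01f405601d49fa14280c97080404dc7f721a0152b05f41018be9a04062fbf4d80019800604374d438d4002bfa20387014a4fa1c380a7ec42a19920183060ddfd064805313e9262029201837d014c2060be80ec97d0a480524001b001b453f4082015fdfa0cb008be830a022fa181050110f899184ed1a1e7f0c180723c3fd01c82899184ed1a1d7f0e08073f4d0000022040030001d80fa00074f8544fa023fa2838c01100966c075f66120357d2014083c921c046c0e7f4386c807d0d97d281c36490a7d0d97d001c36493e870d97d341b23ff4365f4a1a0d92429f41e5f4f9a0d924fa681e5f7e9a50022fa73e9b35d1dfbf4d9aebe9c1006bfa6c0d6141850817b0e1c387011c3221c3808d200fa000648ce0503f6251f4005011a41c00066f81820f50f020eb85d0983046807bf44162ad2415f4d00cbe830028045f41b2040227c03e83cd47d0001a50cbe986be83019fd0b5546675ffdac3fc3affed61fe00295807dd5202066c066507fd56d0a3ff4a00c924607f406410a82042bb1e0407d0158334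6c328f0e923607a200d28501dbc006fe80c9e03065c046a0e1b47f74aa70d88fba7d020838089403560005407e8100d28381c07dd04fd121a20257e806941bac03eeaf40fd00d2bfa147808804000c9a07f429601100fa6c000ebefd34023,
    0x3eab2e0221e3d180880802c00076b41fdfad280014c808c01c5403afa041070117d02040808849408044d5f418400022fa002000112806ac000a91830608044ac1832e023fa0038701501fa00067f419400cfd045804603e82000323bf415601e0f2c8fe82d47b90107eea201875c07e560c15601e7d06002008be80000004443e8500d23b264000d1700a95030bf5a600ca95075fd00142b5f508540d3efa140b4a041b1653b5000d8b01dfd0e1c04473ea80117d2c0838088e9ffaa0045f4d1003528fa68801a8184040057474e070053a065000ae8e943600a743ce001fd0f086c00fe80090e00074740070003a0020000e8e880e000742400001d09121c000e927d0206a1e4089a0d90f97f6435f4f070a022080017d0198f0c1835400000e977d2002a83f41006be8328059200fe8165200fa08067f4096021b90e1c10001c820620380ed2010245a101c05690a882a023780007274372dc41100d28026c442d0e9c0e1c3740cd1a059117209047f42010207a781417d0159147f4380cbe8e00180750dcb40319d0c01ee4009114c17b3a4888681f2896cc067f4a060153d2bf4056f0a7d015970203b0635e80ed103fa19a,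
    0x905050c535500009b019a90200066bbe8500d3c2817e80ac07d001c074a00020e03309f4296693845de32801ffc08104d1d0004a8c4bf168019fc076a7e8202d3dfa080b49037d04033ca1828101a8415f43808c4a30003a009c22ef194002fe000753281b0119d0a182f414c9a0bd033e00081a888204400d43ce000206a481c801a8780fa09902897a001d8f0c03e80cefd6420351e54000015b2fba40663c180fa023080c17d01e847e44d01f8483aff407bf4180080221e0c17d0158000dc0008887d0000076a007d015a8280c080a94290604054a01800002a500c200015230658100abe830408054ac0fd0002a,
    0x1898be60d100bf0302000560c79898978cca00bf00ad201463167c99000ff020331ea322fd032809fc53825dd16001fe01a040c000cc78001f4046200a660b30e5a00bf0001f04b008a01f80820003300001346097705a00bf008c094fa00076903008991a7a0a6057e019800000076001818d11f581a204fe01da708f2e08b02bf030152efa0c054f4503fa02b780c17d015a8006c0666811c0002b,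
    0xa00020e033520338d11f581a204fe02000560403310d3d08b027f01f008200033]

/-- The branchings of the search among the patterns without triple classes, in the same
format as `tripleStreams`. -/
def smallStreams : List ℕ :=
  [0xd113eb1a2000ff110feb1a2000ff190beb1a2000ff1a07eb1a2000fff48,
    0x68c1f58d10007f88b1f58d10007f8ca1f58d10007ffbf50,
    0x1a307d6264003fe22c7d6264003fe3287d6264003fe3447d6264003fd86a11f58d10007f8991f58d10007ffb1a07eb194000fff58,
    0xd423eae22002ff1323eae22002ff1a23eae22002fff607111f58d10007ffb190beb116000ff1a07eb194000fff60,
    0x3888fa5688007fc688fa5688007fc650f958c800bfc688f9d88800bfd1f6221fd5a30001fe3217d622c001fe340fd6328001ffed0d423eb1a2000ff1323eb1a2000fff68,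
    0x3888f1ea88003fc688f1ea88003fa1c23447ba344003fe22c7d5a84001fe3287d6264001ffee0d113e8d1a000ff110fead18000ff190beb116000ff1a07eb194000fff70,
    0xd1827cd52000ff1162fcd42000ff1942fd132000ff1a22fd1a2000ffc7d101f8,
    0x6a11357d10007f8991f57110007ffb1a07dd194000fff51,
    0x35089abe88003fc4c8fab888003ffdc9c444d7b44001ffefdfbf71,
    0xe2226bda2000fff7efdcdc444d7b44001ffefdfacb8889af688003ffdfbf7ed5f6264755cc4001ffefdfbcb8889af688003ffdfbf5a,
    0x1f7e8d8be8e1b17d0ff7ec5f6264755cc4001ffefda7efdfbf7ec247efdfbf7e13f7efdfacb8889af688003ffd92d38889af688003ffda5c444d7b44001ffec9fb9fdfbf437de9c444d7b44001ffed8a9c444d7b44001ffed3f447dfbcb8889af688003ffdfb938889af688003ffdcbe88fbf7e,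
    0x3e90fb97d0e1fee9f487dcbe8d0ff7e711135ed10007ffacfd93f7efa03ec3f5cd22407dfb0fd61f79fbf7ef3f7efd1bf625f1a07dd194021fff7efa22260f39ca8037ffefde44fdfa37ec4e2226bda2000fff64fd6be880df7efa87efdf7e88fa1ba13f6264755cc400bfe264755cc4005fe113f6264755cc4007ffefd8588afb48915f7ec30c47dfbf7c8623efdf3efdfbf7561f7efdfbec4c8eab98801bfc4c8eab988007fc4c8eab98800bfc4c8eab988003fb31323aae62005fe2c5fd66264755cc4005fc58bfacc4c8eab98800bf8b17f5987f7efdfacfdfbf7ec3f4a7dfbaa8fbf7eb3f4402e83080dd0911f7ef41be86ebe882dd09fa5ba,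
    0x4e1185f1943cff5191859d943cfffacb50882eeca1c3fc4c8e2e8ca1c3ffd653843467d40e3fd464347cd40e3ffeea1fe87fbdfdfbf7ed91323cb982800fff7ef2a222c59d3c08bffe264755cc4003ffec2a054650afe88117bfc2a057d87efd2967d3df59fbf7ed51323aae62001fe285331941cfaa040dfe285331323aae62000fe28532f222c47d5c081bffefd657fdfbf69fbf7ed2c3efda7efdfb4a85851df81123f9f174fd3e7e9fa2cfd21c67dee1fdfbf7c0033efdefefd40cfd55233fa97ee7f5cfdcfe8c19f740ff7ef6a3e94f7e8211f7ec7f7ec681f7465008bffdf7e8c19f74127bed3f4f0aa448a071323aae62003ff088fbf7cfa28bd224f0aa449efb4fd0c362121be8d8be94facfd441fed7f7efde7e801a03412006fdd1c444d7b44001ffee5f4406fbd7dfbf7212524fd68499fad06fa1fef61be871bf7b8423ef90847dfbe7d2865afa524946be9928d42fb27eb5f5cb5f447d84457fbd7d2908929f611253ed2eca52d03fd87e94a5414fb4fd941f4132bee9f7ec8fbe8611a090c23ee824390fba07fa3b4fa38665f7efdcbe8617a420df74,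
    0x202fefd68827085eb80e30fffd8befdfb0b50898bea800fffd31f6afbf5efda888c8990a5ec1c5dfffad7d30d4222afe20bbff53881977650293ffdabec4c8eab9882ebf908480bfbf628d111de81c5cff113b41047ef3f7e926668cfbf6251f4a7db087dfbf7d19f74fa6fef422328776644001ffef8a004650eecc88003ffdb3e94d8022fa7295e73ed30cdecfb17dfa506fdd3efd361befc43ee5f7efdfbafd0023efd8fefdfba85fa1790d1a07dd194038fe37b61f5088f3e8638cb0fa3bc21f437c128e513079ce5401efe781e4268c9684c98ed7d31f5afa00680884801bf62fbf4080ebe904997dfa37ec5f57f42517dfb58945f4e57f4287b20850ff6cfa506c2f0a7d86c8acb0dccbefd199c4c8eab988003ffdfbf7d13f7efda7efdfbf62fbf7e9dafec298fa54c1003f93fbf5afa53ed90fefd905330ff41761fe8cfbdfd18abbfbf4a0c8be8c2d0be19f610e53ef6bfe9cf7efdfbefdfb23ee79157dcfe8c37a4319f74fa09068f817dd1f0219a7d2232169f4642f3e9cf1e0cfbe0719f4e761c67defe94fa72c8650679f4308fb1d7fb63ed81fe87fbf7bfbf7efd3f67dfbf7eafafe89fbf63fbf7efdabefdfbf4fd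9f4488fbf63fbf7efdb3e8911f63fa2447d8fe8911f638623efdf3efda91fdad1fd29f6cfa3fed9f4f1985e1efb0fd015a83df6117f7e8be8cfd01f6a8991e5cc14007ffbf7dfbf43c2f810837f63fbf447dac67dfb091fbf618623efdf3efdfbcb8889af688003ffdc5c444d7b44001ffee2e2226bda2000fff71,
    0x7d13f63061fef3f49fd661fd7110c59b9489fff147df4a7df430611f634e1185739499ff899105cf948ffffbc821047ec7f7efdf5f0819f63fa23efdf5f02106fec7f447df7efdfbaaa11f7efdf3e8b058fd1223ec6343fdefefd0f60cfbf7a79f7efdb057d415070ff7bfa78f32a0f7d65e09116bec6004883df63fa787c2a0791fb123fa7abfa6c3748c014b3eb08fd318ca11fd5026cff8fd001223ec7f7e8afbd07fa1c5f6cfec6fad07fa1cff65367db03fd0fdbd3ff7ec46c488fb1fd1223ec7f7206fb99529f7ec4cc47dfbf7c8e40ffd8881f8df62fbf7e81d547dfa53d2823efd8c488fbf63fbf72fbf7ed7f457d898fdfbd1017f4951d3efdfbd3d25f620ec03fdfbd8739f7ef6d4061cfd402afff7eb3abe93fbf5afbf7e8b3debb107bef81fe87fbf7b8ff7eefabe8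8fbf63fa23ec6c3efdf6188ae7fef81fe87d1dfdfb1da844367d8830bfbd7dfbf6a07f50f40fea1ebe8911f4047f4488fa023682440cfb1c8122107d8c88911f414644488fa0a3222447d2d1911223e968fead19f624a33ed247e9dfbf6bfa33efd67efdfad7dfbf5afa2fefd67ea435f72fa33ee8a8b7d0562a2df4159f43966a1fd2cd7d19f7ec3f467dfb0fd19f4dc3f417d91f73fb1307d4e1c036fff7eeb34a7d3b67d19f615033ec3f4d8b01d7d111affa72afa1c5fdefefd4f54681f74650093ffd4f57d121e31230153f4a1cfb57d121fec7f44888fe8910063fa2440b8fe80fb57dfa76b1003efdf3e80d547dd5e091157ec60048833f635c6beb3a8d7d844891167d341a1120047db04a2fb5fdfa18075f4406fbd3cfaea3447563c4007fdafaee3447563c4003fdafa0c6c42458d3917d16072fbf469cd3e9b0df7efa63ee6c3ef9f7efcc3e86110fdfa18442182fdec37d046fb0df501bed7fd1bf74fbf72faa0cc2f147d87efd9398ffa032fa7037dfa108fbf7cfa8c6fdd3ee4183fdfbdfdcbea8fb0fdcbee44507da596bfbb3ed9f74350ca7d6befda8e7d07efdfa01afa22a8623ef844488fb1c311f7c0e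283fdefe943d5fd3df75fa5e4fdebe9ea8411fbcc3fa43ec3f4390210fd17f5afa7eafbf7ed487ef4b164afad04fa37ef5f7efdb15be85f7afbf7ed7f7ea5fbd7dfbf7d2224452fb1fd2df697df7eb3f459a6887d0df6221f6a,
    0x1029f6221f4e550d57df1728c878f8a8063fd4a9c285fa340ac5fc152a8b7da7e82654170217b85665ffb30c47dfbe40101817df3e82fb62a21f7afa102c5f517de427d883ab0ea7ef61d5fdfbdbf65f5afb45fc8fad7dfa22b29f62fbf6b1ff4055f6264287b172fbffed4b020efb17d1865a07f7a41f7a85f7ed8a05fd6921d17f61fb13079ce5413ffff6a8d11dd881cbcff21a7d224391047ef3f4390210982ee2213b38396fffd23513bec2e2213338b972fee2213338b971ff1a07dd19404eff57d0b523fb5a3fbf751eebeebf7e80aa1886a032e7ca0b5fffbe073833ef6bc47d6be94a97fdabefd8beb0e98fdebec30cdfd8bed7ae7fdfad0939f7a50002fdd458623f7301f4373f6365f4f0a71a7d10506fdd3efd35f590c483fdefe88fb1cb5bf753bf437df4a7dfb67dcbee43c27dce260f39ca8183fc26513079ce540b1ff900fa1b95053e85b3e9f1ba7d339fd3636269f7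2fbf4357afeaafa1abfa8016bf43066587d0cca85d4fdfb4fdfb97d4bafdfbf752813ee9f4c6620c7dcfedbcbe8601f7d083b47e244fd8c67d8bee5f6480684c9fad7d1124e3427ec938d090022cfa6833214488fb1fd381b9fa20372a007db1422fb5c73df7267f72fa44e998be873b5fd455030ff7bfbf6bfbf7ed9f7ee893efdd3efdfba7d01f7d16f866820dfde978061f5afbf4e55f44d9f4409b3e88fa26cfa205008fe8bfbd4329f4644703fdefe883957d1833633f450cb8cc319f763393eeb0be8acbe94fa72c5ab72fa142e5f5105c928cfa8192a57a7233e94d3e8911f630257a8633eb27467da54a9ebe8cfaa345058002fb5105b94319f7eb24467dd3efdfb942fbf72fa20e7dae10cfbf74b283ed3f458c8610bfb0fdfa573fa53ec457efd67efd3917dfb93d1023e808f0a0fb4fd1832119f61c283ed2a3efd51ea8faa3d8623efdf088911f57462447dfb1fdfa6e1fa33ed76528cfbf614a33efd643fdfbdb4fbf7ef9f4e4247ec8fb9fd167d923f467dd3e89062fec7f410817f63fb97d19f74fa72158afefda837daff7a0c22bfdea190d9f6263f717b8abfdd467de867dfbd47fa7c67d89e9f19f628df4f8cfb10cfbf7e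f4f4f8cfb143fbaeb87f75d65047d29194102fec62cdfde83fd0ff7ef6ec41efbe070ff7ef627efdfb58bfabd474ac3a05c5a8ee11ebff62d7fdebe9bb05fd37600fa023002fec7f7e9364d47547c67d885fd24f740ff59f61e67dec27dfb92911f7ed0f187d147a2602057d8be9ee990cfad6bfb628fa2bd65f45d9f454443e8a883fd0ea3b87f75d61fe8729d9529f627a23ef818afde9201fba7d175aafbf7efdf7efd01f7ed7f7efd15ec620505451c81f4117dfa1bee7f729a2b9150df57544187d51f7d11f57d623ea8f3206fb99a21f62fa90d29c977d8ed6bfbf6cfb5feebf7eb5f43f61cfc6fb17dfb987fa1fb0ff43fdec185fbf07fa1fb284bec42657d6be9e1f0a8fb34db4f0f7d65180fbf74468fefdcfe9e85409116bec600a7dfb5bc37f45581fe87ec07d11f6b1858374f0b7db088cfbf7d160b5fbf416bf44880b188fbf7c29f6c221feb3f7efdd3efdfb739fbf7513f7d13f7efbf717da441bfbdfdfbf755423efdf151bfbe7dfb5b173f7ed2abefd29e0837f7c55f7ed6a847dfb5fdfbf7451f7dfa9187d6407df1e00fbe2829e8527f4943abed7f4406843fda1d8c11f61,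
    0x7d2e1e173f5857f7ec7f42fdd3ea20f1f921022c672a3c00fe2fee81847d0119a3bf6121f59e2a447dfb608faa7c2c446e0d7800fffbf7916cd9780841bfb1bc39f69d7f48d2d26c688e8c7a867bfd223e9b23db82a574fa23efbf488836c89fb5fdae329295e3447463d432ffe97c23e948fefd05a08fa0bef6cc41e227a910fe1d4538d47da5428fb4aa106c679f707b89a3016a7c284bffd5420dfdf2bd8fb4c3fbf69fa5fefbf7efde7eb32ba08c00bef7f4596039fd1e2a115f45423fe8f87efdf043efbe43461feb3f4a7db308c24033862c3fdafee1494910ff6b01f7ed602340fba3282f5fc4568c505d4785fbac301f7c0023ed62be80a9e7d102ac50a305d5e1c155ff580107bec7f4068a3ed7f51e6a3ed8004881ff63106c874f3eb224a7d3710929f5835f7efdfbe87ec0090ff63201487df62640563c7801ffed7f46b5f7efdf7e8840cbafbf6c55f46e7f50fdccf7dd117dae7fd861cdfdf0d14fb110190b3fbf6bbce920b0da7d50a5a20c037df8488fb1880ff547bf4488fbf6370180ea1be9b29d07fa1fb0e1c07643e8b16d7d0f67d3882bfaa5729c99fd16d7db198bfad06fabd97443ed4f447df3e88fb5a95df72f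bf7e94f7e8911f630e503fdefe8929186fa6ca7454a7dfb108fa7bd21f7efd88208e990c684a60e2bdfa085d89c41b15f7c65d09fa4da6023e9369807fac9a0ff6877f550267109faf5a1233eb4a447d61e290ff63f9f7ebce847d5be0b5ff7a11f7ec7f4be623e9e39e0c1603d0e53dfa31e441feb2ec9fda8b87fbd93fb50bfbf7ef4ebefdfbefdfbf0afbd7d1652315f7afae8a34c7e94f18fd3c6fcfbf7eea80a7bf463dd1708fbe33107cdf91c41ffb124fa334fa50023aca7db127d19a7d162da6673e8bf3e9b3c2ec6628f7842c1bfbf62faa305d5e1c0d0ffa90486bee4d40738a8e4c6fe2c367f521ac8d1c3ff6afb4a8fb20a35f6923f75877ce2449591fb21afa79a7df4e43f50b4fbed8660ad0b11111f7379f615bf4cb44447dd1e0cfaca801f6b17f7a3c7fef51befde85fdebea0a7e8c8618835e7d18cfd861fd87e8c6618cfac8cfb08c55f6110b96f9f510c8889afa1ac682017df087dad51111f4658e143772a0411fe0a1fa975542442afb1fd18821fa2fed867e81888380a7ee80a2b7fc5f40e443e81ca108fb1fd16321fa64ae4545fd87e8dfb538facfd1021a288fe8810a9447f45a08487d6837d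11f73fa2d032b85fd6617dfbbf37bf7ee7f527dcfefd499a9fbf752208b7dcd7a0fb4fd400a92233ee5f540890a338633ee167e8c40cfd1220b7d8c31ae9f0cfacfdfbf75220847d8c88d91f5a2214a7d8947d0de8cfa461fa701f5f7ee4f007dfb1a8fb4a8fbf690ff4577f7ee8205fdebe8900d7d4f547fa24535f438b15e9b0df7a101fefa1ca7a20dfde889bfba8837f4075f403000d7dfbf74281fef7f4d80d458a8887d88e07fbf0bfb11c0ff7e21f62fa1fb100bef858375f44580c3fdefe960865afa204d800389b3ec3100230e2c57c1c58afa340fba3280a1fc008b1c40cbbb280b9fd108ac400fbe08015bef9f4386ede09fb181c9c44457bc4001ffefdc80e4432101ba100407403e8703d880c03efbf72101807c20709d4187fbd960c53efa269fa107681fec6ec7fda44fd4d9fd6befd0b0a8fbf59fbf6950ba94a0be86afe82101ac545a4fd6be9fa617d0d62f0d26e6708dc9fad08fa1be85f45670847d0de081bf59500fefa78f62cca48159fd121a3fab83422437d8d40893f73fb4c6fa3cd32cbec3f4a0d29a7d101a329f79a02037d8fee5f728df4d432fed3f440d659000ba8ffb0fd510c329f6238bfef424e57fbd09a5408fad0929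f5a8ca1dcb902007fa987daa194fb1103df42e5f46fd03911fb4be2043ec5f5d75f7a86223215f1e0887bffef817ed5f7ed5f7ed4a3ec5f4500abec4c8e2c4ce003ffdfb4fd11f63fa2447d8c809fb6e38623eadf3e8b3952429f7ed9f467d6819bfbd7d14d7d1801a061fef1ec41bfbd00061fe9eec3830ff47f61c187fbdfda5efda7e9b29d7d101fd13f43fa50a7d8be92fbf7dfad19b2e84fd011fdb4f59faffeb427efd687fd2e0610bec34c3dafa107288be85a5efda4387fbf7bfab620ff467dec8fd2d639fa5ac0ff43fdecdfdfbc8757f7b,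
    0x182bfbec311f7c5e6a340fba3282dfffd21f4e55f7efdf7e88a55aafa22956a23447463d42f7fc17bf41b2a3e85aa38cebe831df620bf40f300401fbe436135434ac298fbe7d8e72bfa2abfafa17421f0bfbd7d7de88faf4e781c3fdfbdab0efbef6b487d8482822a2246a3ec3f5ffda7ea8514fd10c4db423d39ea81a154643c7c5403bffdfa3c67de7efdfbcfd23cad1df7ed6f44fd8e109fb1fd1851afa27ec60d57de880907f638623ef8404fd8fefdf5e08fbf7cfa1fef7f5e57f43a8ed47d7aa6902300fd8808111f632eabef46040dfbe28fa69afa6fa1ff62000040afb1fdfad2d29f5a33f6a5023eb424a7d68d7da9288fbafd11108fb17d8927d0b94329f5a6112810c22207fee5f4da85113abd4f25ce142f7320516ff480fa1b9782447d8c488fb1fd0dc88fb1fd239fdfb9fd0c6a1fb98b101bec7f429a67e8a850fd355fdfb97dfb94203f63fa1c6fdefe840f5fd388690df437dec4a00df7d0c3745ff64e7f467d89e080d67d2c34dc4a8b0dfb17d0418047f7ea10d644fbf6b007eb5003ec3f40056587d0ac8e111090038969f42b3f4ab220300f82fdafe9f34c8511f6311f4bc640080f918111f635627ea18c47d0de0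5fb67dfbd7d12203462fe85d0284d488a1a17301f6c0d19f08d1a007f29f6207f7a01f7cfa907d5f4e88019fdfbafd3a20067f4dfdd52fd3951cfbf7efdf4600d449ea7efd3957d55a7d55a1c0ff7efa51800683467c2346801fc57d8beac00d0d07afd4f51efbf7d87f4e808a3fd8c416fbe10fb17d102e35003e828d40015f636800146abe96a7e85c878afb1cdfbf6afa7a9fa3062467e8819b2b23f6435f4285ebe8c87ed30fe9c65cfda7e8c414fd1000156a840005588fad2bfa9698633efd64288fbd3efa217d78467dd168c18c90fbf5a4962afa935202feb5f46d4905fd67e8b68809fab63fa36afa2cab5f458c8610bfb090fad2900ab5201bec5f547dce3fda59fda48082c6a3fa5b52bf69206bee4186c099d7c2c2267fe708416fb190fb9811023e808defd5ba0111f4047f45c2f05fd84488fb1fd5a32272e7eb41fefdefed21fe8ced77dfbf7d87f643420879f460c67ea5a48fd3767d4b4a519f6bd7f4653f5052b867d87e9cafe80bb5343fe07fa7fb0e44ff61fef6c1053f50e5043fd8980ca7e8cfacfd8618a1917d65400bb559ebe9c90733fafeb330be9cb15a817f6c33f44476a1000df730df6bf430b7dabe8bd1d17d7e87b15915df725c2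3ef9f463dd190afad24fa1fefa2feb493e86fbefd0ff7e0e5c3d3fbd8cfba07741d1fdefefd8be883dec32830a44a107a30ce9f440ac75072e5fbfa5ebd6e9d1bedd88fa5fcfb4f57623e9ef1d883c6fcfa23e9e8feafebeaa5ad1c5ff7a5aab31551efa33ec4ebe9f6be806757dfbf6cfab65e7f528c55a3311f5834c7ed4419fda3f1067f68fc1a20e06255f46476be83ac3fd4fdfd129e3fa253c67feb28840015f7cfa98301cfe8d5cd4339f6b21f620df4d94ebe8d34d7d106da025e0e8f447df3e908887d89790fb13f43593af5fd08a00c443ed44bed41fe9bec00911f63102feb41e376221c6f030840cbafabd4741c3fdee1fd0e82b0c2087de8806fbf7d10a0db41fe87efe8751efd50a5a1223ec623ea8f037d16a7a0c217fde8447fad0184633fa6ac55f6b86d7efda847d3507c123abfde8b504d7845803febfdfbaeb8531bd8116007fc5f6c3df629bf753b63ed586efd6b587fb627fb63ed424720fbd7d281b50df4055f4505f878005f741e003fdd3e9342d104bd0415f720a5f20020f7d8fe8fafe85a849703f071a1fb125c0fc8fefdd057da987db2188fbe0c1e2bef433ea5e9e7d1163c01f6cfbf7cc01fed7f4488fb1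af4bf591bf5477f4c800b5fd2c03ed7f44288f07d5e0e979f6fe3f4a1ed7efddd8fd0403b5053efa421c3f71fa22bc3f6bc3f7ed7e448bfa0abc2bfeb20c1088983ca72e0007ffb1fdb9f7111f4dfdef0fdfb8fd266d9facb151f4dfbf501bf4500fb08f01f6111f4d8ced2fd115d9fa46bb3f465623e9b29db173f4dd3f66d7e7ea0115d9fbf7511f7ef9f6bfbf4be20fea9e4306c5f63fb6355c68e7dacdfd0fcfd0e0eb0c03ec68be80a7ea10bf0ffb9fda1db0b7f5ed24247df98c600fe9,
    0x4d8c2346f0a6c57f9d2f461f6bfac2b423fe11f7dfbefd0a52b85f4383b3edd0d88939f792023ed7f45c7cfe88560992023e826441a23f7b640b4fb712f3f6e63f519b6410837f63120feb2258031a77143c4b7fd7f70d7e7efdd5a1bfb1be101fec7f4420652fdd7e80658a8fa9790053edce7eb23fcaafb78dc387e9b67096fb9910ec3eb24befd87e8866b96fb9e2fa0f30ff4142777304b4fd115e1fb5e119f6e525fee297096fb9a33df7e55f4081d150ba1f5996dfeb2a007dc55612df73a03097dcc687fa77b1a1eb7defe82c478c25f73fa0fd4bf711a1fefdefeaa6019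91a1d27defe88291fd370878d11f58d10017f0ff7b0ff6340df320caa3ffb21f7e462beea1e14c5de260803ffb61f7c87f4ff8081c5f7ec4a3e9a6befd21f281df730027ec6c8e5617e8a8befd0157d114123414a0afb10ffb57dfb63ed5f6cfac1a4e1ce7df35fdb018719d8dfb67d182bafb5d0ebafe8fb2cfdd305911f74fb61e7d8bec5f66b493e9fa8efd3653afa72c541febc8bee40ca33fa194ea23ea8f03080df7afa204561c37d51e086ff637a04a0a8a3873ff7ec5f45af6837d41d7d102d7b590329cd4230c07321f40fdf486288357fbd7da97fd36d06faf3a87f4d35f44568d09a0391006180e7f5a03f54e81ca784018603990fad7d1f17d0ed2afb588fa28f791bed63c1fd039b063f6a841bec508350898fd60d7d61507491fd53afd3957d1682a29f62fbf733df59d42fe8b01d7d3cd7d36a0f451c41e8fe885117dafefdafefdfbefdafefd3da3a2faa8fa29a13f6b17f4a75f6357f5935f57e7f5934a408bfad3317f4e344c81f5393039efd1072a6623efdf3e9ac87fd03a0833e251960911f51f4c047d8c809fb18205f7a340cffda87fd0153e0d9b0390fda7e9c87e9491f5a91f5a7ff5afa321fb085e9afdd637debe9cfb5a8fad33fa445f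81fe9aecb7db1cfd5d61d11f42f9f52eaaa188fbe2dfb17d2cd09106bafa302b3f463268d7debe800b12efb0fd1008047f4d33f56a58beae6be9aefeb9b087dfbf73fa36de605c08cbf321095fc401ce3054f7305139ffec30be9433128fb49019f4d681bed6e3ed2c1e34415c401f6bfa35a21f5a2057ed4403446beb4bbeb4a3ed4a3e956be88455a3fb57d163212068febf6a21f6a462329a82e3c80ff52429f6afa0b30ff7b2003441f69222042afb1881083ec694ec80199129f416a6c47d05591fa58dd8f0b7d8feaf6528cfa0b41823ee907a0c37ed50bea3c940afbb1923f64344647d6be9e3a32b4bf71540fe95ea37d14d2500673fbf46691d27dcbe9b01ab3fa2ab29f6a37f455807e89b05fde9e140117d37d1d85f73fa74000cc807fb1900ff63865137d6bea3ac891fb9043807ed3f7e9ca8c8635d7d281623a03ee7f6afa422fbeeefb94721f6249f720628350d19c2b8a9ffafa22bfa5ba0d19f0711a007f4667ee5f407d09afdfae2065dd94070ff17dfbe886829b0df7c8d03ee8ca023fffb12bfa180f8000870ddfd0c7fc11f4378ba00e0d5bc11650101a8c6c3e82840000e1bec6c0386fb1b0fa16cfa384580007d011fd1b58efb12f3620d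d9f4b4936d2a05f4359f5a1b6a134fad7dfb9140afb54a8340003ef3f59e417ed27fee473eb2900fd1b5fd239cc23f7317f7913f633a1fd97f6914203722f3105067dd3ec6cbee5f724897511f4378264fdcfe9967e8d0b4fd1035987f5ac56b50603a6827ec66847d8c907fa8fb342447d8febb75d4217f72307b3e48cbe7c860cfbd7d28ea2fa29d442bec48fed3d147d36d09fad7d11d00fa679561fef65c39eede891092379596faa3c561fef7f4500a8b7dfbe00fa73bfbf794877ec223ed66fed2e4809fa52349f50c226344705397001fe30695c4469e90d057ffa10fbef9f6311f457823e80f00fd67ecc116040ff7bfb4bdfa13d13f7ec3f448823189fbf611ff6159f5915f5aa20bef23ca00b26077d64cfa42c107857d8beb266cfda509cfb4fd4cf99108c7fd8a1b1fb6293ec3eb3f7ed997efd09088fa0a1fac94b3f532965f1691f5a53f41525c081ee55803fff6afad3eb5f7efde4a16e547de4a44c8f8b8a8007f96e57fd39ec311182ba72e2000fff7c,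
    0xdc4c154467e467ff3f4ffd64b7dabe86fa02399026740cde914feaaa120feb3f46208bed4b54fa0d4fde82c688e8c7a847ff82b0783fb0b2100635190d1f350967f06c90067a30a23ef3f44d6107c5944188c402fb1bc37308fde520c6a11157f108d7f884d1faa79fa3dafafbd153067de7e887b5c6faf592a2bafa10c43f479121c84fa559123feb34befa13e95644fd6427d535fd1221a464befab44fd8fe8185888ea3b3105ffe20c9abb1a227fec50326c7f0489ff50326c7f048b7fb037dac1b811c457e23d7f9ae81fd1b5a4fb4e1fa21911f46d800b9f8fefdfb5fdf7efd32cfd183e253f4082a64140a3ec2ff7ef5f64f588411ebe7d1141947534286e2106fafa229e63c2d2cbe85a797de9e168991f1715072ffb3e94a4d09fb69a381c0adec417f03815dd9c0e04ff693ec6cbe85a7e800b588fbcfd18cfdfa6a1107856820a0dd0406fb1a4fba8911f79dc1c3760c38cec97c23e0ff4680efe9d0dc805bf6bfacfd339a82817d01f40723fec3f5a7dcfeaacbefd939a3fb97d1a19a13efd11606f407dad47d1b5a8fa66c602437d8fefd390fdfa721fbf50b223ef5f57fdea088d9f62fa23301f5a160f40615f7c14351fbe9609f5afa204b4152ea77e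a5ae3fd15947fa05a8435f270523f7f075fd41594fad1c0e03e28c3eb427e83a54aefb943faac2b44439bccefda441b01d10fa3f21ff4c65f43c681650f74003ffdec680fbefd12d7d0117df3ef8416e4705fdee6fd3957d3dd7d3603511f46440c415ebe8869403f7efd90d1c7a53a17d2519f61fa8a9c033ec25006bf7ed208416fb1fd01991fbf6b025c155f4000cda7d519fdfb4d739abffa0aed4a8b6a185c0d14c437e23bfc4c1f5387023bfe7f45b4404fd8c87d68800fb1a917f5a0c23ed643e808cd06fb12417f73466a260fa9c3810bff50cd7ee5f6c550beb440b59f59fbf752bf4a45f6c55f592033e9fd087db792d4362b4c86b17f69fad5afa0b5542447d5d1aefb08911f7ef9f70b2deed5f514493edda9e0c0b08821f7a10b96f9f7efd89da5af5aea7e88afe885d5fd42d47fb526fb97dabe9468806cdf0cfacb069f696123ed22861c882c8cfe94e867db0c82fb1a8fa6990ff43f640106cd5200fe3efb53217f45b4a8dd4a02fdb137d015100d9fdfbf6bfa1b25602bfa040e423e9e8c4fd3df08fa7a319f74fa6da2798fd490ce80867de83fd8fe888c97dabe8e3d17d25547fad33abefd6a1fd6a1fd6882dfb97d38d0a15f6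213f57aee8a7d23609fa6ca75f43fa2441bfbd7d2397dfa0c0e413e81c880ba3a243f90963f597bf6387f6cfbd89064fafa0c9f41bea8e881e8d03ca8ee0217f03a900c0734673101d577dad5293403dfa072808abfa24447f5a755eb508d0571bed483ed4cbee41068741de40c5737a040fd8bea852d07fbf5e45f4329d487d5069a202147d68a55f43f7f58b468d9ffb107c5f62fb75ee48fee7afeecfb658fbf0ffb121fb906fa28f784cb0bf498737f7c13f7efc7fec41cda0fbe6bfb61f3eb62fa7d44414a0afb11015f750a2057dc11092943eb43c2fdcbe940157d815fd6be90e947d2f9a211d07fa1eb77f4df5f7eb5f7eebf4692fad300bf7c8415279f4412fad60fa6cbd253ec3f4488fb1a8fb0a851f61fa30916cfe8224fb3860fe81ac68303d8b0ff59fa1d03380aaffb48d2a03b4a53eea03ef220960ecb8be7ec2f447d8447de1daa11f590803eb227ed296dfda7eefe5303d3582fba7d0f0ab57f598644e0286b82fba7d0f08cfb9fd116cdc2dc57dfbed765414d5e14fb889c35f911f4a77f4079f71fb889fa0991094047f7eb9c44dc49c8023f73180807640fa9f987d374902f8bcfb8a8171fee668587fb0fd3472b202fee9306fdcfe87b3e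870f60b91f7e61f7b,
    0x1f6c8c2346f0a676ff9d434fbf69129fec6b937d6480b0ba90171fee6905c7fb98601f63482007daebfd22af30437413f7924911f6c6b80074a82df73fa7f9fa8395208a78a904688f8c6a8033fe7f48d3f7ed765b9b64109d0642c287077a327fe6443b036c83c3f41f20bee84439236c9d5190d5f31069ffc55083ff590803eb3f7120d015640b82afefd2f481faca828785fa5a82ae0e7001fff447d6478c25f73fa2c1623097dcce7da547dd4417fbe7d281b1fa1b15030866a98066687d1019987f4333f4414fb13c1053ec5f427d8a3440d5c47803fc70cfb13c1c33ec5f447d6947dd3e8a3713c15f6207f5a626fef820be8a047d69e0ffb17dee005ebe8388a03fb128fa02a50142fdb3e9438d4bc9386361bef9f7efc81475f41836bea2a8ffd15111fb67d060e2fa6c7f4a0a05b02fdd81628450a45f43f75de7422bbcebe9cafd062b914fa96cfb94d65f57544098c6868783d94fb506101bef41be86ea1a0d0207fbdfd05908c3d627917d0c212c640b94fa11bb950c27d86fa28f784de1001efd79938fa58aeaa925620b0f47e09fbf25fba261a0f5fb57d0e2bd38310c42d000ebefda8488172fa11191fb97dab77d8857d8be91ae09e8fe90c5107cfed7f489e8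befda8488fbe9241e8bfbd0305e882df7cfa6ce57f7ed5f7ed5f7ed4a0a21fb67dfa00fd5f7efdc9f1c05d090ff7c607214a8647dcfe8c841e452c6142c04321b5f6a51f4a34c807dad9d88bef42147a2147ab42d2b51521fe9037d876bf7b22144570fec86beb400d1aebefd67ed3f572dec082ad6fd88105fb9a941f69fbf6c32a467da4afda481afb9062e02371f69842fec2406e708da8fb17d50aa2fa34e5418a54a4e82ad20819f6c5a28cb28c42d015fd29542102ac8427e958dffd8befdafefdd477debeb5f50c86a1fd67efdac17dafefdafefdafe8c18c9e21f7a082beb5f6afaca8b757dc847d1917d1157d292621033ef81a30eb1ae000fff5afa4054490341cfef63bec2acc01fb90d25f5a8277ee704efdcc407fbdfd0672afaa14b4f4a7d6841b01d0801d080e5c0f6202f48d0d674fe64547dcfe910313c2253ec4200747c07defe8911f634083e4a0befa00034990d710e56d8e583ce5878e5888e583c682cfe8cafe99b3efd6bd0c1fea88c51dfbcfdcbee4334fb97dc8488471c801f6328002ebf4373f50b3f42d2a0a07f7e8bcfe8fa68e644d584511ab3ea0a7e94015870ddaa0df5ba5f0988308fbd0012146c6208f535a03f40565befa20b60f152b7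a0a9fa306a68947d0152b0758305594fbd8206cfd11e8854c82565a93420ffda7e812ec871bdfd29e0819f7911f4079f4412facfdcf627fb48929f693053ed307ea384a01fb4944c4274ee84047fa7ed6220b3e7e8b8440205e7d24cd97bf691019174441422447d8c7fd5308905ea8fab9913f4173f417a5867d8be96a848b070fd2ccbefac89fb5c68842b9ce003f9d190be3bf61,
    0xa8152241d8081c2ae9422030febeae5bd7d2e49a05f7afab6206639fa281b227ea9e5efd5348afad7bf44108c3d9f40d7f44208fe8464a6787e88163a184205fd846fdf5488fb188fa1bd0823908082f6a23447c6354001ffbfbf591833a53f6a51f48d464001fb4903e1bee7f7311f63282bef32d6ebf50d7f4d2da407c1837633419a0dd01e9f4e0667ed71942eee20400fe1a25df62fbf5afa3bec440500c91da15a3215a7d1220347f4175f417433efc41081c8308fb5a2421723bf42e67007c1be97ac71b01d0a0216913f5ed3185fd8e1fd6be9413110fb98afb91bfb5881be1bfa06bfa3210dd0f13f63fa30a34729fb67db3ed9f6cb3ed3f69fa35afa86afa332fa35afb5fdafed9f6cfad10108ab201bec640d9cd4d0bfb495b151040ab22288165f5033f4055f504295101cd2d8ad2d8ade7d8887db7943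0e43c73f6c6b5aafb0fd8441a8c3a119d8819e34fbec30487c1e0b5fb634b07d254b34a0a1bfb6191e7a28eb8cc44be8ca8616fbd0f33f72fa02bfb67db3ed9f6cfb67db0dfdb157d79afd50d7d14d7dafed697ed5f4be7f5afa7a2fb5542bec4221687ca32286bfe3fb67db06abd467a203f922a8ecfed5f450cf08fdb12d697e8a6be84d1ea1020aa0ff5e440c380ec13ed05bed0da547e240cf7221f7a20032440b25ef3a301bd142fa861fee8087fd88102ea187fba1ffa7e2203c2fdc9694a1f5a0bf72fa2c2e412034a0afd65609fa080f4207c5f4f07f91880594617f63fa2cfc6cbe8bcbe87897fd8878a33f72fa28ce5f418869803fad11141fee7f418cc88800bf74fb8fd161b125f7378309668d1d06707dade7d06c8d0faa0f6e03f5a547db007d03cfd3d4d6c7ed3c528111f591e33182acc63f4be3f4607cdffd074fde14aa51f615483ec200114ec9fdcc10cd017dd157dac80c2ba3c51c21466d3846f5c05001fec1e28e7db0d7d859fdaee1bcc280fa03c1007d,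
    0xfaba15c03bfa1b121f42ea21980ec417f010cd3ea9cd2b5081f545c117fd2954645f902e089fe1fa0a1203fefa2c0d6f14641f90ae085feb4627eb2f4156f40f6a3e88ad18ac4685ec687d42bb37f69fb1fd0633ee5f44808fe8319f729633ee5f4601cbe880f1c1040bec6cc346b85c6a0366fbee9f4de840df43c07dd1b80fba00060fec6a3ea1cfe8a0b90f03f7321f7201f4045f4102a8d0001144c1f5387005ff9988a070bdfd080b2041bee66037a6fed9f72f7dfa1721e672fad75a92cbdf6e54213178d57df4dae7bafbefbefbeb215f5a111306fc0c4c0cffd7d339322df751e28b7dd3e81d3ed34d258527b82640afe212d64351ff7470225e802b4a23ee6a837d88308fb5a61d9ebad967d51108e884645119cacb35d75d420cfb182fb59e154e6e039ff4e0715f7d0da029cb8c4c7007f8027190fb97d3fe7d163fb060fb3265a206c36bf4384d3e8a1b9910437ee6414449476809f684b3039fdfb9fa33311f790e17dfa1a13282b0e1fb482feea10007fbda819f695362a11580fb0e42f488fa1bc7810388ca721d80dfe9fa20d84a7e883612979f61500ec03f7cfb61d8878187e84847fd847742feb5f5344a7d,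
    0x454a323540b9c23ff6388197765005bfd23c345f4457f4046cc41c07ad40affe7d1218c47f4486a918d2fe8e28e02b7ae0280bff48c4217a96b88097fe878171109cf4e005feb04fdfbed8994643c7c54025ffdfa1b4fb97d0017422002fdd3efdefe8dd477c40369f43fa0c177f6bc880d0dac2116103567dd4456bbee68c538889f262903ff6a06045dde045801fc0fd884fdf5697fbafd195073d1fdd024ce8e0bf547db3ea301d7d05d7d1ed7d0fe8f0bdac0ca004688732e2903bf66b8757f418eac187f8c022be0935f7d0a7f28d031d23e4077e000340a0c0350859ca78043f661fee7f43e6e204f8f2a00cfc002e8d4063e45c803fc2407d8fe8a0f1a04f8f2a00efd9c6813dcca8037f0a0f9b501739172013f0901f631a54a764a3447c6354001ff3fa2c36bf6b17f7305a7d53a09351a21cdd0a40bfde9003f69049f9,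
    0x211a21cdd0a40bfc175d4412ede44c89de42901ff669887280fac06fc140fcd405ce45c804fc283e6002b501739172013f68d4063e45c803fc002e92c046813dcca8037f46d4063e45c803fc000c707e14d42168cde004fda87f902660fa20e901bf649c226e98a406fda024e03dc346403fef9440d185fca801bf681fe5183ec2c64037e23d098d109f94e005fef488cfbaa38d109f94e005fed2221b23eaa003fb5211a047c8cac06fd586f7e8dd4b887acc0b003f807c9018c0390549e036a027c6b50027ef81b5013e3ca800ff7cbb445c0cc1eac007e8d10d4dc5202fec88bcf0e8b898367791005fef45876a111f435201feac0866a10e74352027eb118c7cc531003f81fa1508cbbc89900ffbc,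
    0x234427bc14811fbe271a213f29c00bfc17e]

/-- The state in which no rows are known to be related. -/
def emptyState : SearchState := (packWord fun _ i t => Nat.beq i t, 0)

/-- The state in which rows 1, 2 and 3 are orthogonal to row 0 in column 0. -/
def tripleState : SearchState :=
  (packWord fun c i t => or (Nat.beq i t) (and (Nat.beq c 0)
    (and (and (Nat.ble 1 i) (Nat.ble i 3)) (and (Nat.ble 1 t) (Nat.ble t 3)))),
  packWord fun c i t => and (Nat.beq c 0) (or (and (Nat.beq i 0) (and (Nat.ble 1 t) (Nat.ble t 3)))
    (and (Nat.beq t 0) (and (Nat.ble 1 i) (Nat.ble i 3)))))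

/-- The kernel evaluates the closure check: a pattern that extends a listed one by further
orthogonalities contains a listed pattern with more orthogonalities. -/
theorem check_complete :
    (forceStates orderedNames fun L => checkComplete cellTriples L [] closureStream) = true := by
  decide +kernel

/-- The kernel evaluates the search among the patterns with a class of three rows that has an
orthogonal class. -/
theorem check_triple :
    (forceStates orderedNames fun L => force tripleState.1 fun s => force tripleState.2 fun o =>
      checkSearch false L.reverse tripleStreams [(s, o)]) = true := by
  decide +kernel

/-- The kernel evaluates the search among the remaining patterns, from the state without
assumptions. -/
theorem check_small :
    (forceStates orderedNames fun L => force emptyState.1 fun s => force emptyState.2 fun o =>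
      checkSearch true L.reverse smallStreams [(s, o)]) = true := by
  decide +kernel

/-! ### Classification of patterns -/

/-- The pattern is the pattern of one of the listed matrices, up to permutations of rows and
columns. -/
def IsListed (E O : Fin 5 → Fin 8 → Fin 8 → Prop) : Prop :=
  ∃ (k : Fin 32) (σ : Equiv.Perm (Fin 8)) (τ : Equiv.Perm (Fin 5)), ∀ c i t,
    (E (τ c) (σ i) (σ t) ↔ uomList k i c = uomList k t c) ∧
    (O (τ c) (σ i) (σ t) ↔ NameOrth (uomList k i c) (uomList k t c))

theorem permInvariant_isListed : PermInvariant IsListed := by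
  rintro E O σ τ ⟨k, σ', τ', h⟩
  exact ⟨k, σ'.trans σ, τ'.trans τ, h⟩

instance (a b : ℕ) : Decidable (NameOrth a b) := by unfold NameOrth; infer_instance

/-- The entry of a listed matrix, as a function with values in `ℕ` on the nose, for which
decidability instances are found under binders. -/
def listedEntry (k : Fin 32) (i : Fin 8) (c : Fin 5) : ℕ := uomList k i c

theorem digit_listedNames (k : Fin 32) (i : Fin 8) (c : Fin 5) :
    digit (listedNames.getD k 0) i c = uomList k i c := by
  have h : ∀ (k : Fin 32) (i : Fin 8) (c : Fin 5),
      digit (listedNames.getD k 0) i c = listedEntry k i c := by decide +kernel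
  exact h k i c

theorem uomList_mem (k : Fin 32) (i : Fin 8) (c : Fin 5) :
    1 ≤ uomList k i c ∧ uomList k i c < 9 := by
  have h : ∀ (k : Fin 32) (i : Fin 8) (c : Fin 5),
      1 ≤ listedEntry k i c ∧ listedEntry k i c < 9 := by decide +kernel
  exact h k i c

theorem orthNames_iff : ∀ a < 9, ∀ b < 9, 1 ≤ a → 1 ≤ b →
    (orthNames a b = true ↔ NameOrth a b) := by decide +kernel

theorem testBit_packWord (f : ℕ → ℕ → ℕ → Bool) (c : Fin 5) (i t : Fin 8) :
    (packWord f).testBit (64 * c + 8 * i + t) = f c i t := by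
  have hsh : ∀ (b : Bool) (m p : ℕ), (bif b then Nat.shiftLeft 1 m else 0).testBit p = true ↔
      b = true ∧ m = p := fun b m p => by
    have e : Nat.shiftLeft 1 m = 2 ^ m := by
      rw [show Nat.shiftLeft 1 m = 1 <<< m from rfl, Nat.shiftLeft_eq, one_mul]
    cases b
    · simp
    · rw [cond_true, e, Nat.testBit_two_pow]; simp
  rw [Bool.eq_iff_iff, packWord, testBit_orRange]
  simp only [testBit_orRange, hsh]
  constructor
  · rintro ⟨c', hc', i', hi', t', ht', hf, e⟩
    have e : 64 * c' + 8 * i' + t' = 64 * c.1 + 8 * i.1 + t.1 := e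
    obtain rfl : c' = c := by omega
    obtain rfl : i' = i := by omega
    obtain rfl : t' = t := by omega
    exact hf
  · exact fun h => ⟨c, c.2, i, i.2, t, t.2, h, rfl⟩

theorem testBit_eqWord (k : Fin 32) (c : Fin 5) (i t : Fin 8) :
    (eqWord (listedNames.getD k 0)).testBit (64 * c + 8 * i + t) = true ↔
      uomList k i c = uomList k t c := by
  rw [eqWord, testBit_packWord, digit_listedNames, digit_listedNames, Nat.beq_eq]

theorem testBit_orthWord (k : Fin 32) (c : Fin 5) (i t : Fin 8) :
    (orthWord (listedNames.getD k 0)).testBit (64 * c + 8 * i + t) = true ↔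
      NameOrth (uomList k i c) (uomList k t c) := by
  rw [orthWord, testBit_packWord, digit_listedNames, digit_listedNames]
  have h := uomList_mem k i c
  have h' := uomList_mem k t c
  exact orthNames_iff _ h.2 _ h'.2 h.1 h'.1

theorem NameOrth.symm {a b : ℕ} (h : NameOrth a b) : NameOrth b a := Or.symm h

theorem NameOrth.unique {a b d : ℕ} (h : NameOrth a d) (h' : NameOrth b d) : a = b := by
  unfold NameOrth at h h'
  rcases h with ⟨h1, h2⟩ | ⟨h1, h2⟩ <;> rcases h' with ⟨h3, h4⟩ | ⟨h3, h4⟩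
  · omega
  · subst h2; rw [Nat.odd_add_one] at h3; exact absurd h1 h3
  · subst h4; rw [Nat.odd_add_one] at h1; exact absurd h3 h1
  · omega

/-- In the listed matrices the orthogonal of every name occurs in the same column. -/
theorem exists_nameOrth : ∀ (k : Fin 32) (c : Fin 5) (i : Fin 8),
    ∃ t, NameOrth (uomList k i c) (uomList k t c) := by
  have h : ∀ (k : Fin 32) (c : Fin 5) (i : Fin 8), ∃ t : Fin 8,
      orthNames (digit (listedNames.getD k 0) i c) (digit (listedNames.getD k 0) t c) = true := by
    decide +kernel
  intro k c i
  obtain ⟨t, ht⟩ := h k c i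
  rw [digit_listedNames, digit_listedNames] at ht
  have h := uomList_mem k i c
  have h' := uomList_mem k t c
  exact ⟨t, (orthNames_iff _ h.2 _ h'.2 h.1 h'.1).1 ht⟩

/-- Equality of states in a pattern is determined by its orthogonalities if every state has an
orthogonal one, so it suffices to bound the orthogonalities from above. -/
theorem isListed_of_orth_subset {E O} (hp : IsPattern E O) (k : Fin 32)
    (hE : Extends E O (eqWord (listedNames.getD k 0), orthWord (listedNames.getD k 0)))
    (h : ∀ c (i t : Fin 8), t < i → O c i t → NameOrth (uomList k i c) (uomList k t c)) :
    IsListed E O := by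
  have hO : ∀ c i t, O c i t ↔ NameOrth (uomList k i c) (uomList k t c) := fun c i t => by
    refine ⟨fun hO => ?_, fun hO => hE.2 _ _ _ ((testBit_orthWord k c i t).2 hO)⟩
    rcases lt_trichotomy i t with hit | rfl | hit
    · exact (h c t i hit (hp.orth_symm _ _ _ hO)).symm
    · exact absurd hO (hp.not_both _ _ _ (hp.eq_refl _ _))
    · exact h c i t hit hO
  refine ⟨k, Equiv.refl _, Equiv.refl _, fun c i t => ⟨⟨fun h' => ?_, fun h' =>
    hE.1 _ _ _ ((testBit_eqWord k c i t).2 h')⟩, hO c i t⟩⟩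
  obtain ⟨u, hu⟩ := exists_nameOrth k c i
  have h1 : O c i u := (hO c i u).2 hu
  have h2 : O c t u := hp.eq_orth _ _ _ _ (hp.eq_symm _ _ _ h') h1
  exact hu.unique ((hO c t u).1 h2)

theorem cellTriples_lt : ∀ q ∈ cellTriples, q.1 < 5 ∧ q.2.1 < 8 ∧ q.2.2 < 8 := by
  decide +kernel

theorem mem_cellTriples (c : Fin 5) (i t : Fin 8) (h : t < i) :
    (c.1, i.1, t.1) ∈ cellTriples := by
  simp only [cellTriples, List.mem_flatMap, List.mem_map, List.mem_range]
  exact ⟨c, c.2, i, i.2, t, h, rfl⟩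

theorem settled_listed :
    ∀ S ∈ orderedNames.map fun N => (eqWord N, orthWord N), Settled IsListed false S := by
  have h := check_complete
  rw [forceStates_eq] at h
  refine checkComplete_sound permInvariant_isListed cellTriples_lt _ [] _ h (by simp) ?_
  intro S hS E O hp hE hmax
  have hlt : ∀ k ∈ closureOrder, k < 32 := by decide
  simp only [orderedNames, List.mem_map] at hS
  obtain ⟨N, ⟨k, hk, rfl⟩, rfl⟩ := hS
  refine isListed_of_orth_subset hp ⟨k, hlt k hk⟩ hE fun c i t hti hO => ?_
  exact (testBit_orthWord ⟨k, hlt k hk⟩ c i t).1 (hmax c i t (mem_cellTriples c i t hti) hO)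

theorem Settled.mono {G} {S : SearchState} (h : Settled G false S) (small : Bool) :
    Settled G small S := fun E O hp _ hE => h E O hp (by simp) hE

theorem settled_tripleState : Settled IsListed false tripleState := by
  have h := check_triple
  rw [forceStates_eq, force_eq, force_eq] at h
  exact checkSearch_sound permInvariant_isListed
    (fun S hS => settled_listed S (List.mem_reverse.1 hS)) _ _ h _ (by simp)

theorem settled_emptyState : Settled IsListed true emptyState := by
  have h := check_small
  rw [forceStates_eq, force_eq, force_eq] at h
  exact checkSearch_sound permInvariant_isListed
    (fun S hS => (settled_listed S (List.mem_reverse.1 hS)).mono true) _ _ h _ (by simp)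

/-- Every pattern is the pattern of a listed matrix: the searches from the two initial states cover
the patterns with and without a triple class. -/
theorem IsPattern.isListed {E O} (hp : IsPattern E O) : IsListed E O := by
  by_cases hnt : NoTriple O
  · refine settled_emptyState E O hp (fun _ => hnt) ⟨fun c i t h => ?_, fun c i t h => ?_⟩
    · rw [emptyState, testBit_packWord, Nat.beq_eq] at h
      rw [Fin.ext h]; exact hp.eq_refl _ _
    · simp [emptyState] at h
  · simp only [NoTriple, not_forall, not_or] at hnt
    obtain ⟨c, t, a, b, d, ha, hb, hd, hab, had, hbd⟩ := hnt
    have hirr : ∀ i, ¬ O c i i := fun i => hp.not_both _ _ _ (hp.eq_refl _ _)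
    have hta : t ≠ a := by rintro rfl; exact hirr _ ha
    have htb : t ≠ b := by rintro rfl; exact hirr _ hb
    have htd : t ≠ d := by rintro rfl; exact hirr _ hd
    obtain ⟨σ, h0, h1, h2, h3⟩ : ∃ σ : Equiv.Perm (Fin 8),
        σ 0 = t ∧ σ 1 = a ∧ σ 2 = b ∧ σ 3 = d := by
      have hinj : Function.Injective ![t, a, b, d] := by
        intro x y hxy
        fin_cases x <;> fin_cases y <;> simp_all
      have := Equiv.Perm.isMultiplyPretransitive (Fin 8) 4
      obtain ⟨g, hg⟩ := MulAction.exists_smul_eq (Equiv.Perm (Fin 8))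
        (⟨![0, 1, 2, 3], by decide⟩ : Fin 4 ↪ Fin 8) ⟨![t, a, b, d], hinj⟩
      have e := fun x => DFunLike.congr_fun hg x
      exact ⟨g, e 0, e 1, e 2, e 3⟩
    refine permInvariant_isListed E O σ (Equiv.swap 0 c) (settled_tripleState _ _
      (hp.permute σ (Equiv.swap 0 c)) (by simp) ⟨fun c' i j h => ?_, fun c' i j h => ?_⟩)
    · rw [tripleState, testBit_packWord] at h
      have hO : ∀ i : Fin 8, 1 ≤ i.1 → i.1 ≤ 3 → O c t (σ i) := by
        intro i hi1 hi3
        obtain rfl | rfl | rfl : i = 1 ∨ i = 2 ∨ i = 3 := by omega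
        · rwa [h1]
        · rwa [h2]
        · rwa [h3]
      simp only [Bool.or_eq_true, Bool.and_eq_true, Nat.beq_eq, Nat.ble_eq] at h
      rcases h with h | ⟨hc, ⟨hi1, hi3⟩, hj1, hj3⟩
      · rw [Fin.ext h]; exact hp.eq_refl _ _
      · obtain rfl : c' = 0 := Fin.ext hc
        rw [Equiv.swap_apply_left]
        exact hp.orth_orth _ _ _ _ (hp.orth_symm _ _ _ (hO i hi1 hi3)) (hO j hj1 hj3)
    · rw [tripleState, testBit_packWord] at h
      have hO : ∀ i : Fin 8, 1 ≤ i.1 → i.1 ≤ 3 → O c t (σ i) := by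
        intro i hi1 hi3
        obtain rfl | rfl | rfl : i = 1 ∨ i = 2 ∨ i = 3 := by omega
        · rwa [h1]
        · rwa [h2]
        · rwa [h3]
      simp only [Bool.or_eq_true, Bool.and_eq_true, Nat.beq_eq, Nat.ble_eq] at h
      obtain ⟨hc, ⟨hi, hj1, hj3⟩ | ⟨hj, hi1, hi3⟩⟩ := h
      · obtain rfl : c' = 0 := Fin.ext hc
        obtain rfl : i = 0 := Fin.ext hi
        rw [Equiv.swap_apply_left, h0]
        exact hO j hj1 hj3
      · obtain rfl : c' = 0 := Fin.ext hc
        obtain rfl : j = 0 := Fin.ext hj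
        rw [Equiv.swap_apply_left, h0]
        exact hp.orth_symm _ _ _ (hO i hi1 hi3)


/-! ### Product vectors -/

theorem norm_eq_one_of_inner_self {E : Type*} [NormedAddCommGroup E] [InnerProductSpace ℂ E] {v : E}
    (h : inner ℂ v v = (1 : ℂ)) : ‖v‖ = 1 := by
  have h2 := inner_self_eq_norm_sq (𝕜 := ℂ) v
  rw [h] at h2
  have h3 : (1 : ℝ) = ‖v‖ ^ 2 := by simpa using h2
  nlinarith [norm_nonneg v]

theorem inner_qubit (x y : Qubit) :
    inner ℂ x y = (starRingEnd ℂ) (x 0) * y 0 + (starRingEnd ℂ) (x 1) * y 1 := by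
  rw [PiLp.inner_apply, Fin.sum_univ_two]
  simp [mul_comm]

theorem inner_productVector {n : ℕ} (φ χ : Fin n → Qubit) :
    inner ℂ (productVector φ) (productVector χ) = ∏ j, inner ℂ (φ j) (χ j) := by
  have h : ∀ j, inner ℂ (φ j) (χ j) = ∑ b : Fin 2, inner ℂ (φ j b) (χ j b) := fun j =>
    PiLp.inner_apply _ _
  simp_rw [h, Finset.prod_univ_sum, Fintype.piFinset_univ, PiLp.inner_apply]
  refine Finset.sum_congr rfl fun s _ => ?_
  simp only [productVector, RCLike.inner_apply, map_prod, ← Finset.prod_mul_distrib]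

theorem productVector_ne_zero_iff {n : ℕ} (φ : Fin n → Qubit) :
    productVector φ ≠ 0 ↔ ∀ j, φ j ≠ 0 := by
  rw [← inner_self_ne_zero (𝕜 := ℂ), inner_productVector, Finset.prod_ne_zero_iff]
  simp

/-- The vectors orthogonal to a nonzero vector form a line. -/
theorem exists_smul_of_inner_eq_zero {x y z : Qubit} (hx : x ≠ 0) (hy : y ≠ 0)
    (hxy : inner ℂ x y = 0) (hzy : inner ℂ z y = 0) : ∃ c : ℂ, z = c • x := by
  rw [inner_qubit] at hxy hzy
  have hdet : x 0 * z 1 = x 1 * z 0 := by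
    apply (starRingEnd ℂ).injective
    simp only [map_mul]
    by_cases h0 : y 0 = 0
    · have h1 : y 1 ≠ 0 := fun h1 => hy (by ext b; fin_cases b <;> simp [h0, h1])
      simp only [h0, mul_zero, zero_add, mul_eq_zero, h1, or_false] at hxy hzy
      simp [hxy, hzy]
    · refine mul_right_cancel₀ h0 ?_
      linear_combination (starRingEnd ℂ (z 1)) * hxy - (starRingEnd ℂ (x 1)) * hzy
  by_cases h0 : x 0 = 0
  · have h1 : x 1 ≠ 0 := fun h1 => hx (by ext b; fin_cases b <;> simp [h0, h1])
    refine ⟨z 1 / x 1, ?_⟩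
    have hz : z 0 = 0 := by
      rw [h0, zero_mul, eq_comm, mul_eq_zero] at hdet
      exact hdet.resolve_left h1
    ext b; fin_cases b
    · simp [h0, hz]
    · simp [h1]
  · refine ⟨z 0 / x 0, ?_⟩
    ext b; fin_cases b
    · simp [h0]
    · simp only [Fin.mk_one, PiLp.smul_apply, smul_eq_mul]
      field_simp
      linear_combination hdet

/-- A vector orthogonal to `x`. -/
noncomputable def perp (x : Qubit) : Qubit :=
  !₂[-(starRingEnd ℂ) (x 1), (starRingEnd ℂ) (x 0)]

theorem inner_perp (x : Qubit) : inner ℂ x (perp x) = 0 := by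
  rw [inner_qubit]; simp [perp]; ring

theorem perp_ne_zero {x : Qubit} (hx : x ≠ 0) : perp x ≠ 0 := by
  intro h
  apply hx
  have h0 : perp x 0 = 0 := by rw [h]; rfl
  have h1 : perp x 1 = 0 := by rw [h]; rfl
  simp [perp] at h0 h1
  ext b; fin_cases b
  · simpa using h1
  · simpa using h0

/-- The factors of a product of unit vectors are determined up to phases. -/
theorem factor_unique {n : ℕ} {φ χ : Fin n → Qubit} (hφ : ∀ j, ‖φ j‖ = 1)
    (hχ : ∀ j, ‖χ j‖ = 1) (h : productVector φ = productVector χ) (j : Fin n) :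
    ∃ c : ℂ, c ≠ 0 ∧ χ j = c • φ j := by
  have hone : ∏ j, ‖(inner ℂ (φ j) (χ j) : ℂ)‖ = 1 := by
    rw [← norm_prod, ← inner_productVector, ← h, inner_productVector, norm_prod]
    exact Finset.prod_eq_one fun j _ => by
      rw [inner_self_eq_norm_sq_to_K, hφ]; simp
  have hle : ∀ j, ‖(inner ℂ (φ j) (χ j) : ℂ)‖ ≤ 1 := fun j => by
    simpa [hφ, hχ] using norm_inner_le_norm (𝕜 := ℂ) (φ j) (χ j)
  have hj : ‖(inner ℂ (φ j) (χ j) : ℂ)‖ = 1 := by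
    refine le_antisymm (hle j) ?_
    rw [← hone, ← Finset.mul_prod_erase _ _ (Finset.mem_univ j)]
    exact mul_le_of_le_one_right (norm_nonneg _)
      (Finset.prod_le_one (fun _ _ => norm_nonneg _) fun i _ => hle i)
  have h0 : ∀ x : Qubit, ‖x‖ = 1 → x ≠ 0 := fun x hx => by
    rintro rfl; simp at hx
  exact (norm_inner_eq_norm_iff (h0 _ (hφ j)) (h0 _ (hχ j))).1 (by rw [hj, hφ, hχ, one_mul])

/-! ### The pattern of a product basis -/

/-- The states of rows `i` and `t` in column `c` are equal up to a scalar. -/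
def SameState (ψ : Fin 8 → Fin 5 → Qubit) (c : Fin 5) (i t : Fin 8) : Prop :=
  ∃ z : ℂ, ψ t c = z • ψ i c

/-- The states of rows `i` and `t` in column `c` are orthogonal. -/
def OrthState (ψ : Fin 8 → Fin 5 → Qubit) (c : Fin 5) (i t : Fin 8) : Prop :=
  inner ℂ (ψ i c) (ψ t c) = 0

/-- In `ℂ²` the vectors orthogonal to a given one form a line, which gives the laws of a pattern.
Orthonormality says that every two rows are orthogonal in some column; unextendibility, applied to
products of vectors `perp (ψ (f c) c)`, that no choice of classes covers all rows. -/
theorem isPattern_of_isUPB {u : Fin 8 → Qubits 5} (hu : IsUPB u) {ψ : Fin 8 → Fin 5 → Qubit}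
    (hψ : ∀ i j, ‖ψ i j‖ = 1) (huψ : ∀ i, u i = productVector (ψ i)) :
    IsPattern (SameState ψ) (OrthState ψ) := by
  have h0 : ∀ i j, ψ i j ≠ 0 := fun i j h => by simpa [h] using hψ i j
  have hz : ∀ c i t (z : ℂ), ψ t c = z • ψ i c → z ≠ 0 := by
    rintro c i t z h rfl
    exact h0 t c (by simpa using h)
  refine ⟨fun c i => ⟨1, by simp⟩, ?_, ?_, fun c i t h => inner_eq_zero_symm.1 h, ?_, ?_, ?_,
    ?_, ?_⟩
  · rintro c i t ⟨z, h⟩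
    exact ⟨z⁻¹, by rw [h, smul_smul, inv_mul_cancel₀ (hz _ _ _ _ h), one_smul]⟩
  · rintro c i t v ⟨z, h⟩ ⟨w, h'⟩
    exact ⟨w * z, by rw [h', h, smul_smul]⟩
  · intro c i t v h h'
    exact exists_smul_of_inner_eq_zero (h0 i c) (h0 t c) h (inner_eq_zero_symm.1 h')
  · rintro c i t v ⟨z, h⟩ h'
    rw [OrthState, h, inner_smul_left, mul_eq_zero] at h'
    exact h'.resolve_left (by simpa using hz _ _ _ _ h)
  · rintro c i t ⟨z, h⟩ h'
    rw [OrthState, h, inner_smul_right, mul_eq_zero, inner_self_eq_zero] at h'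
    exact h'.elim (hz _ _ _ _ h) (h0 _ _)
  · intro i t hit
    have h : inner ℂ (u i) (u t) = 0 := hu.orthonormal.2 hit
    rw [huψ, huψ, inner_productVector, Finset.prod_eq_zero_iff] at h
    obtain ⟨c, _, hc⟩ := h
    exact ⟨c, hc⟩
  · intro f
    obtain ⟨i, hi⟩ := hu.unextendible (fun c => perp (ψ (f c) c))
      ((productVector_ne_zero_iff _).2 fun c => perp_ne_zero (h0 _ _))
    rw [huψ, inner_productVector, Finset.prod_ne_zero_iff] at hi
    refine ⟨i, fun c ⟨z, h⟩ => hi c (Finset.mem_univ _) ?_⟩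
    rw [h, inner_smul_left, inner_perp, mul_zero]

theorem exists_unit_factors {u : Fin 8 → Qubits 5} (hu : IsUPB u) :
    ∃ ψ : Fin 8 → Fin 5 → Qubit, (∀ i j, ‖ψ i j‖ = 1) ∧ ∀ i, u i = productVector (ψ i) := by
  have key : ∀ i, ∃ ψ : Fin 5 → Qubit, (∀ j, ‖ψ j‖ = 1) ∧ u i = productVector ψ := by
    intro i
    obtain ⟨φ, hφ⟩ := hu.product i
    have h1 : ∏ j, ‖φ j‖ = 1 := by
      have h := hu.orthonormal.1 i
      have h2 : (inner ℂ (u i) (u i) : ℂ) = 1 := by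
        rw [inner_self_eq_norm_sq_to_K, h]; simp
      rw [hφ, inner_productVector] at h2
      have h3 : ((∏ j, ‖φ j‖ ^ 2 : ℝ) : ℂ) = 1 := by
        rw [← h2]; push_cast
        exact Finset.prod_congr rfl fun j _ => by rw [inner_self_eq_norm_sq_to_K]; rfl
      rw [Finset.prod_pow] at h3
      have h4 : (∏ j, ‖φ j‖) ^ 2 = 1 := by exact_mod_cast h3
      have h5 : 0 ≤ ∏ j, ‖φ j‖ := Finset.prod_nonneg fun _ _ => norm_nonneg _
      nlinarith
    have h0 : ∀ j, ‖φ j‖ ≠ 0 := fun j h => by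
      rw [Finset.prod_eq_zero (Finset.mem_univ j) h] at h1
      simp at h1
    refine ⟨fun j => ((‖φ j‖⁻¹ : ℝ) : ℂ) • φ j, fun j => ?_, ?_⟩
    · rw [norm_smul, Complex.norm_real, norm_inv, norm_norm, inv_mul_cancel₀ (h0 j)]
    · rw [hφ]
      ext s
      have h2 : ∏ j, ((‖φ j‖⁻¹ : ℝ) : ℂ) = 1 := by
        rw [← Complex.ofReal_prod, Finset.prod_inv_distrib, h1]; simp
      simp only [productVector, PiLp.smul_apply, smul_eq_mul, Finset.prod_mul_distrib, h2, one_mul]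
  choose ψ hψ using key
  exact ⟨ψ, fun i => (hψ i).1, fun i => (hψ i).2⟩

/-- Names can be given to the classes of a pattern: a class together with its orthogonal class, if
there is one, is numbered by `e`, and gets the names `2 e + 1` and `2 e + 2`. -/
theorem IsPattern.exists_names {E O : Fin 5 → Fin 8 → Fin 8 → Prop} (hp : IsPattern E O)
    (c : Fin 5) :
    ∃ a : Fin 8 → ℕ, (∀ i, 1 ≤ a i) ∧ ∀ i t, (a i = a t ↔ E c i t) ∧
      (NameOrth (a i) (a t) ↔ O c i t) := by
  classical
  let R : Setoid (Fin 8) :=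
    { r := fun i t => E c i t ∨ O c i t
      iseqv := ⟨fun i => Or.inl (hp.eq_refl c i),
        fun h => h.imp (hp.eq_symm _ _ _) (hp.orth_symm _ _ _),
        fun h h' => by
          rcases h with h | h <;> rcases h' with h' | h'
          · exact Or.inl (hp.eq_trans _ _ _ _ h h')
          · exact Or.inr (hp.eq_orth _ _ _ _ h h')
          · exact Or.inr (hp.orth_eq _ _ _ _ h h')
          · exact Or.inl (hp.orth_orth _ _ _ _ h h')⟩ }
  let e : Quotient R → ℕ := fun q => Fintype.equivFin (Quotient R) q
  have he : Function.Injective e := fun q q' h =>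
    (Fintype.equivFin (Quotient R)).injective (Fin.ext h)
  let rep : Fin 8 → Fin 8 := fun i => (Quotient.mk R i).out
  have hrep : ∀ i, E c (rep i) i ∨ O c (rep i) i := fun i => Quotient.mk_out (s := R) i
  have hsame : ∀ i t, e (Quotient.mk R i) = e (Quotient.mk R t) ↔ (E c i t ∨ O c i t) :=
    fun i t => he.eq_iff.trans Quotient.eq
  have hrr : ∀ i t, (E c i t ∨ O c i t) → rep i = rep t := fun i t h => by
    have : Quotient.mk R i = Quotient.mk R t := Quotient.sound h
    simp only [rep, this]
  let a : Fin 8 → ℕ := fun i => 2 * e (Quotient.mk R i) + if E c (rep i) i then 1 else 2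
  have ha1 : ∀ i, E c (rep i) i → a i = 2 * e (Quotient.mk R i) + 1 := fun i h => by
    simp only [a, if_pos h]
  have ha2 : ∀ i, ¬ E c (rep i) i → a i = 2 * e (Quotient.mk R i) + 2 := fun i h => by
    simp only [a, if_neg h]
  have hnb := fun i t => hp.not_both c i t
  refine ⟨a, fun i => ?_, fun i t => ?_⟩
  · by_cases h : E c (rep i) i
    · rw [ha1 i h]; omega
    · rw [ha2 i h]; omega
  by_cases hR : E c i t ∨ O c i t
  · have hq := (hsame i t).2 hR
    have hr := hrr i t hR
    by_cases hi : E c (rep i) i <;> by_cases ht : E c (rep t) t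
    · have hE : E c i t := hp.eq_trans _ _ _ _ (hp.eq_symm _ _ _ hi) (hr ▸ ht)
      rw [ha1 i hi, ha1 t ht, hq]
      simp [hE, hnb i t hE, NameOrth]
    · have hO : O c i t :=
        hp.eq_orth _ _ _ _ (hp.eq_symm _ _ _ hi) (hr ▸ (hrep t).resolve_left ht)
      have hE : ¬ E c i t := fun h => hnb i t h hO
      rw [ha1 i hi, ha2 t ht, hq]
      simp [hE, hO, NameOrth]
    · have hO : O c i t :=
        hp.orth_eq _ _ _ _ (hp.orth_symm _ _ _ ((hrep i).resolve_left hi)) (hr ▸ ht)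
      have hE : ¬ E c i t := fun h => hnb i t h hO
      rw [ha2 i hi, ha1 t ht, hq]
      simp [hE, hO, NameOrth]
    · have hE : E c i t := hp.orth_orth _ _ _ _
        (hp.orth_symm _ _ _ ((hrep i).resolve_left hi)) (hr ▸ (hrep t).resolve_left ht)
      rw [ha2 i hi, ha2 t ht, hq]
      simp [hE, hnb i t hE, NameOrth]
  · have hq := fun h => hR ((hsame i t).1 h)
    rw [not_or] at hR
    have h1 : a i ≠ a t := fun h => hq (by
      by_cases hi : E c (rep i) i <;> by_cases ht : E c (rep t) t <;>
      simp only [ha1, ha2, hi, ht, not_false_eq_true] at h <;> omega)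
    have h2 : ¬ NameOrth (a i) (a t) := fun h => hq (by
      have h := h
      unfold NameOrth at h
      simp only [Nat.odd_iff] at h
      by_cases hi : E c (rep i) i <;> by_cases ht : E c (rep t) t <;>
      simp only [ha1, ha2, hi, ht, not_false_eq_true] at h <;> omega)
    simp [h1, h2, hR]

theorem exists_represents {u : Fin 8 → Qubits 5} (hu : IsUPB u) :
    ∃ A : Matrix (Fin 8) (Fin 5) ℕ, Represents A u := by
  obtain ⟨ψ, hψ, huψ⟩ := exists_unit_factors hu
  choose a ha using (isPattern_of_isUPB hu hψ huψ).exists_names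
  exact ⟨fun i j => a j i, fun i j => (ha j).1 i, ψ, hψ, huψ, fun i t j => (ha j).2 i t⟩


/-! ### An invariant of equivalence -/

/-- The number of rows `k` orthogonal to `i` in column `c` and to `t` in column `d`. -/
def walkCount (B : Fin 5 → Fin 8 → Fin 8 → Bool) (c d : Fin 5) (i t : Fin 8) : ℕ :=
  ∑ k, (B c i k && B d k t).toNat

/-- The number of closed walks `i, k, t, l, i` whose steps are orthogonalities in columns
`c, d, c, d` for some `c` and `d`. -/
def closedWalks (B : Fin 5 → Fin 8 → Fin 8 → Bool) (i t : Fin 8) : ℕ :=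
  ∑ c, ∑ d, walkCount B c d i t * walkCount B c d t i

/-- The sum over all pairs of rows of the cube of the number of closed walks; as the listed matrices
show, it is fine enough to tell their patterns apart. -/
def walkInvariant (B : Fin 5 → Fin 8 → Fin 8 → Bool) : ℕ :=
  ∑ i, ∑ t, closedWalks B i t ^ 3

theorem walkInvariant_congr {B B' : Fin 5 → Fin 8 → Fin 8 → Bool} (σ : Equiv.Perm (Fin 8))
    (τ : Equiv.Perm (Fin 5)) (h : ∀ c i t, B' (τ c) (σ i) (σ t) = B c i t) :
    walkInvariant B' = walkInvariant B := by
  have hw : ∀ c d i t, walkCount B' (τ c) (τ d) (σ i) (σ t) = walkCount B c d i t := by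
    intro c d i t
    rw [walkCount, ← Equiv.sum_comp σ]
    simp only [h, walkCount]
  have hc : ∀ i t, closedWalks B' (σ i) (σ t) = closedWalks B i t := by
    intro i t
    rw [closedWalks, ← Equiv.sum_comp τ]
    refine Finset.sum_congr rfl fun c _ => ?_
    rw [← Equiv.sum_comp τ]
    simp only [hw]
  rw [walkInvariant, ← Equiv.sum_comp σ]
  refine Finset.sum_congr rfl fun i _ => ?_
  rw [← Equiv.sum_comp σ]
  simp only [hc]

/-- The sum `f 0 + ⋯ + f (n - 1)`. -/
def sumTo (n : ℕ) (f : ℕ → ℕ) : ℕ :=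
  Nat.rec (motive := fun _ => ℕ) 0 (fun i w => Nat.add w (f i)) n

theorem sumTo_eq (n : ℕ) (f : ℕ → ℕ) : sumTo n f = ∑ i : Fin n, f i := by
  rw [Fin.sum_univ_eq_sum_range]
  induction n with
  | zero => rfl
  | succ n ih => rw [Finset.sum_range_succ, ← ih]; rfl

/-- The number of bits of a mask of eight bits, read from a table. -/
def bitCount (m : ℕ) : ℕ :=
  Nat.land (Nat.shiftRight
    0x8776766576656554766565546554544376656554655454436554544354434332766565546554544365545443544343326554544354434332544343324332322176656554655454436554544354434332655454435443433254434332433232216554544354434332544343324332322154434332433232214332322132212110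
    (Nat.mul 4 m)) 15

theorem bitCount_eq : ∀ m < 256, bitCount m = ∑ k : Fin 8, (m.testBit k).toNat := by
  decide +kernel

/-- The value of `walkInvariant` for a packed relation. -/
def walkWord (w : ℕ) : ℕ :=
  sumTo 8 fun i => sumTo 8 fun t => Nat.pow (sumTo 5 fun c => sumTo 5 fun d =>
    Nat.mul (bitCount (Nat.land (cell w c i) (cell w d t)))
      (bitCount (Nat.land (cell w c t) (cell w d i)))) 3

theorem walkWord_eq (w : ℕ) (B : Fin 5 → Fin 8 → Fin 8 → Bool)
    (hw : ∀ (c : Fin 5) (i t : Fin 8), w.testBit (64 * c + 8 * i + t) = B c i t)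
    (hB : ∀ c i t, B c i t = B c t i) : walkWord w = walkInvariant B := by
  have h : ∀ (c d : Fin 5) (i t : Fin 8),
      bitCount (Nat.land (cell w c i) (cell w d t)) = walkCount B c d i t := by
    intro c d i t
    have hlt : Nat.land (cell w c i) (cell w d t) < 256 :=
      lt_of_le_of_lt (Nat.and_le_left (n := cell w c i)) (cell_lt _ _ _)
    rw [bitCount_eq _ hlt]
    refine Finset.sum_congr rfl fun k _ => ?_
    rw [show Nat.land (cell w c i) (cell w d t) = cell w c i &&& cell w d t from rfl,
      Nat.testBit_and, testBit_cell, testBit_cell, hw, hw, hB d t k]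
    simp
  have hpow : ∀ a b : ℕ, Nat.pow a b = a ^ b := fun _ _ => rfl
  have hmul : ∀ a b : ℕ, Nat.mul a b = a * b := fun _ _ => rfl
  simp only [walkWord, sumTo_eq, walkInvariant, closedWalks, h, hpow, hmul]

/-- The values of the invariant at the listed matrices. -/
def walkValues : List ℕ :=
  [41560, 34904, 22488, 27480, 24152, 18904, 70784, 69248, 62080, 51072, 42924, 42860, 31020, 40300, 42028, 43628, 45728, 61888, 20640, 19728, 31044, 14760, 14232, 13624, 15896, 29228, 22616, 21592, 37068, 15912, 15520, 14648]

theorem check_walkValues : ∀ k : Fin 32,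
    force (orthWord (listedNames.getD k 0)) walkWord = walkValues.getD k 0 := by
  decide +kernel

theorem walkValues_injective : ∀ k l : Fin 32,
    walkValues.getD k 0 = walkValues.getD l 0 → k = l := by
  decide +kernel

theorem walkInvariant_uomList (k : Fin 32) :
    walkInvariant (fun c i t => decide (NameOrth (uomList k i c) (uomList k t c))) =
      walkValues.getD k 0 := by
  rw [← check_walkValues, force_eq]
  refine (walkWord_eq _ _ (fun c i t => ?_) fun c i t => ?_).symm
  · rw [Bool.eq_iff_iff, testBit_orthWord, decide_eq_true_eq]
  · rw [Bool.eq_iff_iff, decide_eq_true_eq, decide_eq_true_eq]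
    exact ⟨NameOrth.symm, NameOrth.symm⟩

/-- Renamings preserve orthogonality of names, so equivalent matrices have the same invariant. -/
theorem walkInvariant_of_equivalent {A B : Matrix (Fin 8) (Fin 5) ℕ} (h : Equivalent A B) :
    walkInvariant (fun c i t => decide (NameOrth (B i c) (B t c))) =
      walkInvariant (fun c i t => decide (NameOrth (A i c) (A t c))) := by
  obtain ⟨σ, τ, f, hf, h⟩ := h
  refine walkInvariant_congr σ τ fun c i t => ?_
  rw [Bool.eq_iff_iff, decide_eq_true_eq, decide_eq_true_eq, h, h]
  exact (hf c).2 _ ⟨i, rfl⟩ _ ⟨t, rfl⟩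

theorem eq_of_equivalent_both {A : Matrix (Fin 8) (Fin 5) ℕ} {k l : Fin 32}
    (hk : Equivalent A (uomList k)) (hl : Equivalent A (uomList l)) : k = l :=
  walkValues_injective _ _ (by
    rw [← walkInvariant_uomList, ← walkInvariant_uomList, walkInvariant_of_equivalent hk,
      walkInvariant_of_equivalent hl])

theorem eq_of_equivalent (k l : Fin 32) (h : Equivalent (uomList k) (uomList l)) : k = l :=
  walkValues_injective _ _ (by
    rw [← walkInvariant_uomList, ← walkInvariant_uomList, walkInvariant_of_equivalent h])


/-! ### The listed matrices are unextendible orthogonal matrices -/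

/-- No choice of a class in each of the columns `rem` covers the row set `unc`: the class of the
highest row cannot be chosen in any of them, by recursion with one column fewer. -/
def uncoverable (s : ℕ) : ℕ → List ℕ → ℕ → Bool
  | 0, _, unc => Bool.not (Nat.beq unc 0)
  | n + 1, rem, unc => and (Bool.not (Nat.beq unc 0)) (rem.all fun c =>
      force (strike s unc c) fun unc' => uncoverable s n (rem.erase c) unc')

theorem uncoverable_sound {E : Fin 5 → Fin 8 → Fin 8 → Prop} {s : ℕ}
    (hs : ∀ c i t u, E c u i → E c u t → s.testBit (64 * c.1 + 8 * i.1 + t.1) = true)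
    (f : Fin 5 → Fin 8) : ∀ (n : ℕ) (rem : List ℕ) (unc : ℕ), rem.length ≤ n → rem.Nodup →
      unc < 256 → (∀ i : Fin 8, unc.testBit i = true → ∃ c : Fin 5, c.1 ∈ rem ∧ E c (f c) i) →
      uncoverable s n rem unc = false := by
  have htop : ∀ unc < 256, (!Nat.beq unc 0) = true →
      ∃ r : Fin 8, r.1 = highBit unc ∧ unc.testBit r = true := fun unc hunc h0 => by
    have h0 : unc ≠ 0 := by rintro rfl; simp at h0
    exact ⟨⟨_, highBit_lt unc hunc⟩, rfl, testBit_highBit unc hunc h0⟩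
  intro n
  induction n with
  | zero =>
    intro rem unc hlen _ hunc h
    by_contra hc
    rw [uncoverable] at hc
    obtain ⟨r, -, hr⟩ := htop unc hunc (eq_true_of_ne_false hc)
    obtain ⟨c, hc, -⟩ := h r hr
    rw [List.length_eq_zero_iff.1 (Nat.le_zero.1 hlen)] at hc
    simp at hc
  | succ n ih =>
    intro rem unc hlen hnd hunc h
    by_contra hc
    simp only [uncoverable, force_eq, Bool.not_eq_false, Bool.and_eq_true, List.all_eq_true] at hc
    obtain ⟨r, hr', hr⟩ := htop unc hunc hc.1
    obtain ⟨c, hcr, hE⟩ := h r hr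
    have h2 := hc.2 c hcr
    rw [ih] at h2
    · simp at h2
    · rw [List.length_erase_of_mem hcr]; omega
    · exact hnd.erase _
    · exact strike_lt s c hunc
    · intro i hi
      rw [testBit_strike, testBit_cell, Bool.and_eq_true] at hi
      obtain ⟨d, hd, hEd⟩ := h i hi.1
      refine ⟨d, (hnd.mem_erase_iff).2 ⟨?_, hd⟩, hEd⟩
      intro e
      obtain rfl : d = c := Fin.ext e
      have h3 := hs d r i (f d) hE hEd
      rw [← hr', h3] at hi
      simp at hi

theorem check_uncoverable : ∀ k : Fin 32, (force (eqWord (listedNames.getD k 0)) fun s =>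
    uncoverable s 5 [0, 1, 2, 3, 4] 255) = true := by
  decide +kernel

theorem uomList_unext (k : Fin 32) (f : Fin 5 → Fin 8) :
    ∃ i, ∀ c, uomList k (f c) c ≠ uomList k i c := by
  by_contra hc
  push Not at hc
  have h := check_uncoverable k
  rw [force_eq, uncoverable_sound (E := fun c i t => uomList k i c = uomList k t c)
    (fun c i t u h h' => (testBit_eqWord k c i t).2 (h.symm.trans h')) f 5 _ _ (by simp)
    (by decide) (by norm_num)] at h
  · simp at h
  · intro i _
    obtain ⟨c, hc⟩ := hc i
    exact ⟨c, by have := c.2; interval_cases c.1 <;> simp, hc⟩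

/-- The coordinates of the qubit state with a given name. The names `2 p + 1` and `2 p + 2` get an
orthonormal basis of `ℚ²` built from a Pythagorean triple; no two of the four bases share a
line. -/
def stateCoord : ℕ → ℚ × ℚ
  | 1 => (1, 0)
  | 2 => (0, 1)
  | 3 => (3 / 5, 4 / 5)
  | 4 => (-4 / 5, 3 / 5)
  | 5 => (5 / 13, 12 / 13)
  | 6 => (-12 / 13, 5 / 13)
  | 7 => (8 / 17, 15 / 17)
  | 8 => (-15 / 17, 8 / 17)
  | _ => (0, 0)

/-- The qubit state with a given name. -/
noncomputable def nameState (a : ℕ) : Qubit := !₂[((stateCoord a).1 : ℂ), ((stateCoord a).2 : ℂ)]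

theorem inner_nameState (a b : ℕ) : inner ℂ (nameState a) (nameState b) =
    (((stateCoord a).1 * (stateCoord b).1 + (stateCoord a).2 * (stateCoord b).2 : ℚ) : ℂ) := by
  rw [inner_qubit]
  simp [nameState]

theorem stateCoord_norm : ∀ a < 9, 1 ≤ a →
    (stateCoord a).1 * (stateCoord a).1 + (stateCoord a).2 * (stateCoord a).2 = 1 := by
  decide +kernel

theorem stateCoord_orth : ∀ a < 9, ∀ b < 9, 1 ≤ a → 1 ≤ b → (NameOrth a b ↔
    (stateCoord a).1 * (stateCoord b).1 + (stateCoord a).2 * (stateCoord b).2 = 0) := by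
  decide +kernel

theorem stateCoord_eq : ∀ a < 9, ∀ b < 9, 1 ≤ a → 1 ≤ b →
    (stateCoord a).1 * (stateCoord b).2 = (stateCoord a).2 * (stateCoord b).1 → a = b := by
  decide +kernel

theorem norm_nameState {a : ℕ} (h : a < 9) (h1 : 1 ≤ a) : ‖nameState a‖ = 1 := by
  have h2 : (inner ℂ (nameState a) (nameState a) : ℂ) = 1 := by
    rw [inner_nameState, stateCoord_norm a h h1]; simp
  exact norm_eq_one_of_inner_self h2

theorem nameOrth_iff {a b : ℕ} (ha : a < 9) (hb : b < 9) (ha1 : 1 ≤ a) (hb1 : 1 ≤ b) :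
    NameOrth a b ↔ inner ℂ (nameState a) (nameState b) = 0 := by
  rw [inner_nameState, stateCoord_orth a ha b hb ha1 hb1, Rat.cast_eq_zero]

theorem name_eq_iff {a b : ℕ} (ha : a < 9) (hb : b < 9) (ha1 : 1 ≤ a) (hb1 : 1 ≤ b) :
    a = b ↔ ∃ z : ℂ, nameState b = z • nameState a := by
  constructor
  · rintro rfl; exact ⟨1, by simp⟩
  · rintro ⟨z, h⟩
    apply stateCoord_eq a ha b hb ha1 hb1
    have h0 : ((stateCoord b).1 : ℂ) = z * (stateCoord a).1 := congrArg (fun v : Qubit => v 0) h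
    have h1 : ((stateCoord b).2 : ℂ) = z * (stateCoord a).2 := congrArg (fun v : Qubit => v 1) h
    have h2 : ((stateCoord a).1 : ℂ) * (stateCoord b).2 = (stateCoord a).2 * (stateCoord b).1 := by
      rw [h0, h1]; ring
    exact_mod_cast h2

theorem uomList_covers (k : Fin 32) (i t : Fin 8) (h : i ≠ t) :
    ∃ c, NameOrth (uomList k i c) (uomList k t c) := by
  have key : ∀ (k : Fin 32) (i t : Fin 8), i ≠ t → ∃ c : Fin 5,
      orthNames (digit (listedNames.getD k 0) i c) (digit (listedNames.getD k 0) t c) = true := by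
    decide +kernel
  obtain ⟨c, hc⟩ := key k i t h
  rw [digit_listedNames, digit_listedNames] at hc
  have h := uomList_mem k i c
  have h' := uomList_mem k t c
  exact ⟨c, (orthNames_iff _ h.2 _ h'.2 h.1 h'.1).1 hc⟩

/-- With `nameState` for the names, the rows of a listed matrix are orthonormal since every two of
them have orthogonal names in some column. A product vector orthogonal to all of them would choose a
class in each column, and these classes would cover all rows. -/
theorem isUOM_uomList (k : Fin 32) : IsUOM (uomList k) := by
  let ψ : Fin 8 → Fin 5 → Qubit := fun i j => nameState (uomList k i j)
  have hm := uomList_mem k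
  have hψ : ∀ i j, ‖ψ i j‖ = 1 := fun i j => norm_nameState (hm i j).2 (hm i j).1
  have h0 : ∀ i j, ψ i j ≠ 0 := fun i j h => by simpa [h] using hψ i j
  have hE : ∀ i t j, uomList k i j = uomList k t j ↔ ∃ z : ℂ, ψ t j = z • ψ i j := fun i t j =>
    name_eq_iff (hm i j).2 (hm t j).2 (hm i j).1 (hm t j).1
  have hO : ∀ i t j, NameOrth (uomList k i j) (uomList k t j) ↔ inner ℂ (ψ i j) (ψ t j) = 0 :=
    fun i t j => nameOrth_iff (hm i j).2 (hm t j).2 (hm i j).1 (hm t j).1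
  refine ⟨fun i => productVector (ψ i), ⟨⟨fun i => ?_, fun i t hit => ?_⟩, fun i => ⟨ψ i, rfl⟩,
    by norm_num, fun φ hφ => ?_⟩, fun i j => (hm i j).1, ψ, hψ, fun i => rfl,
    fun i t j => ⟨hE i t j, hO i t j⟩⟩
  · have h : (inner ℂ (productVector (ψ i)) (productVector (ψ i)) : ℂ) = 1 := by
      rw [inner_productVector]
      exact Finset.prod_eq_one fun j _ => by rw [inner_self_eq_norm_sq_to_K, hψ]; simp
    exact norm_eq_one_of_inner_self h
  · obtain ⟨c, hc⟩ := uomList_covers k i t hit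
    change inner ℂ (productVector (ψ i)) (productVector (ψ t)) = 0
    rw [inner_productVector]
    exact Finset.prod_eq_zero (Finset.mem_univ c) ((hO i t c).1 hc)
  · by_contra hc
    push Not at hc
    rw [productVector_ne_zero_iff] at hφ
    have hc' : ∀ i, ∃ c, inner ℂ (ψ i c) (φ c) = 0 := fun i => by
      have h := hc i
      rw [inner_productVector, Finset.prod_eq_zero_iff] at h
      obtain ⟨c, _, h⟩ := h
      exact ⟨c, h⟩
    -- In each column, choose a row whose state is orthogonal to `φ`, if there is one.
    have hf : ∀ c, ∃ t, ∀ i, inner ℂ (ψ i c) (φ c) = 0 → inner ℂ (ψ t c) (φ c) = 0 := fun c => by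
      by_cases h : ∃ t, inner ℂ (ψ t c) (φ c) = 0
      · exact ⟨h.choose, fun _ _ => h.choose_spec⟩
      · exact ⟨0, fun i hi => absurd ⟨i, hi⟩ h⟩
    choose f hf using hf
    obtain ⟨i, hi⟩ := uomList_unext k f
    obtain ⟨c, hc⟩ := hc' i
    exact hi c ((hE _ _ _).2 (exists_smul_of_inner_eq_zero (h0 _ _) (hφ c) (hf c i hc) hc))

/-! ### Equivalence to a listed matrix -/

/-- Matrices with the same pattern, up to permutations of rows and columns, are equivalent. -/
theorem equivalent_of_pattern {A B : Matrix (Fin 8) (Fin 5) ℕ} (σ : Equiv.Perm (Fin 8))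
    (τ : Equiv.Perm (Fin 5))
    (hE : ∀ c i t, A (σ i) (τ c) = A (σ t) (τ c) ↔ B i c = B t c)
    (hO : ∀ c i t, NameOrth (A (σ i) (τ c)) (A (σ t) (τ c)) ↔ NameOrth (B i c) (B t c)) :
    Equivalent A B := by
  classical
  let f : Fin 5 → ℕ → ℕ := fun j a =>
    if h : ∃ i, A i j = a then B (σ.symm h.choose) (τ.symm j) else 0
  have hf : ∀ i j, f j (A i j) = B (σ.symm i) (τ.symm j) := fun i j => by
    have h : ∃ t, A t j = A i j := ⟨i, rfl⟩
    simp only [f, dif_pos h]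
    rw [← hE]
    simpa using h.choose_spec
  refine ⟨σ.symm, τ.symm, f, fun j => ⟨?_, ?_⟩, fun i j => (hf i j).symm⟩
  · rintro _ ⟨i, rfl⟩ _ ⟨t, rfl⟩ h
    simp only [hf] at h
    simpa using (hE _ _ _).2 h
  · rintro _ ⟨i, rfl⟩ _ ⟨t, rfl⟩
    simp only [hf]
    rw [← hO]
    simp

/-- The names of any representation are those of the pattern, as the factors of the product vectors
are unique up to phases. -/
theorem exists_equivalent {u : Fin 8 → Qubits 5} (hu : IsUPB u) :
    ∃ k, ∀ A, Represents A u → Equivalent A (uomList k) := by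
  obtain ⟨ψ, hψ, huψ⟩ := exists_unit_factors hu
  obtain ⟨k, σ, τ, h⟩ := (isPattern_of_isUPB hu hψ huψ).isListed
  refine ⟨k, fun A hA => ?_⟩
  obtain ⟨-, χ, hχ, huχ, hA⟩ := hA
  have hphase : ∀ i j, ∃ z : ℂ, z ≠ 0 ∧ χ i j = z • ψ i j := fun i j =>
    factor_unique (hψ i) (hχ i) ((huψ i).symm.trans (huχ i)) j
  refine equivalent_of_pattern σ τ (fun c i t => ?_) fun c i t => ?_
  · rw [(hA _ _ _).1, ← (h c i t).1, SameState]
    obtain ⟨z, hz, hi⟩ := hphase (σ i) (τ c)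
    obtain ⟨w, hw, ht⟩ := hphase (σ t) (τ c)
    rw [hi, ht]
    constructor
    · rintro ⟨v, hv⟩
      refine ⟨w⁻¹ * (v * z), ?_⟩
      rw [mul_smul, mul_smul, ← hv, smul_smul, inv_mul_cancel₀ hw, one_smul]
    · rintro ⟨v, hv⟩
      refine ⟨w * v * z⁻¹, ?_⟩
      rw [hv, smul_smul, smul_smul, mul_assoc, mul_assoc, inv_mul_cancel₀ hz, mul_one]
  · rw [(hA _ _ _).2, ← (h c i t).2, OrthState]
    obtain ⟨z, hz, hi⟩ := hphase (σ i) (τ c)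
    obtain ⟨w, hw, ht⟩ := hphase (σ t) (τ c)
    rw [hi, ht, inner_smul_left, inner_smul_right]
    simp [hz, hw]

/-! ### Multiplicity lists -/

theorem columnFeatures_uomList : ∀ k : Fin 32,
    columnFeatures (uomList k) = heading (groupIndex k) := by
  decide +kernel

theorem heading_injective : Function.Injective heading := by
  decide +kernel

end QubitUPB

theorem mainTheorem3 :
    (∀ k : Fin 32, QubitUPB.IsUOM (QubitUPB.uomList k)) ∧
    (∀ k l : Fin 32,
      QubitUPB.Equivalent (QubitUPB.uomList k) (QubitUPB.uomList l) → k = l) ∧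
    (∀ u : Fin 8 → QubitUPB.Qubits 5, QubitUPB.IsUPB u →
      (∃ A : Matrix (Fin 8) (Fin 5) ℕ, QubitUPB.Represents A u) ∧
      ∃! k : Fin 32, ∀ A : Matrix (Fin 8) (Fin 5) ℕ,
        QubitUPB.Represents A u → QubitUPB.Equivalent A (QubitUPB.uomList k)) ∧
    (∀ k : Fin 32, QubitUPB.columnFeatures (QubitUPB.uomList k) =
      QubitUPB.heading (QubitUPB.groupIndex k)) ∧
    Function.Injective QubitUPB.heading := by
  refine ⟨QubitUPB.isUOM_uomList, QubitUPB.eq_of_equivalent, fun u hu =>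
    ⟨QubitUPB.exists_represents hu, ?_⟩, QubitUPB.columnFeatures_uomList,
    QubitUPB.heading_injective⟩
  obtain ⟨k, hk⟩ := QubitUPB.exists_equivalent hu
  obtain ⟨A, hA⟩ := QubitUPB.exists_represents hu
  exact ⟨k, hk, fun l hl => QubitUPB.eq_of_equivalent_both (hl A hA) (hk A hA)⟩
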